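/- **Theorem.** $\textsf{Latin Square Isotopy} \in \beta_2\mathsf{L} \cap \beta_2\mathsf{FOLL}$, where the notions are as follows. A *quasigroup* is a set $G$ with a binary operation such that for all $a, b \in G$ there are unique $x, y \in G$ with $ax = b$ and $ya = b$. The problem *Latin Square Isotopy* takes as input two finite nonempty quasigroups $L_1, L_2$, given by their multiplication tables (an element of a quasigroup of order $n$ is written with $\lceil \log_2 n \rceil$ bits), and asks whether there are bijections $\alpha, \beta, \gamma : L_1 \to L_2$ with $\alpha(x)\beta(y) = \gamma(xy)$ for all $x, y \in L_1$. As a language it is the set of binary strings that encode such pairs $(L_1, L_2)$ for which $\alpha, \beta, \gamma$ exist. $\mathsf{L}$ is the class of languages decided by deterministic Turing machines with a read-only input tape that use $O(\log n)$ cells of their work tapes on inputs of length $n$. $\mathsf{FOLL}$ is the class of languages decided by families $(C_n)_{n \in \mathbb{N}}$ of Boolean circuits with $\mathsf{NOT}$ gates and $\mathsf{AND}$, $\mathsf{OR}$ gates of unbounded fan-in, of size $n^{O(1)}$ and depth $O(\log\log n)$, that are logspace uniform: a deterministic logarithmic space machine computes $1^n \mapsto \langle C_n \rangle$. For a class $\mathcal{C}$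 of languages, $\beta_2\mathcal{C}$ is the class of languages $A$ for which there are $B \in \mathcal{C}$ and a bound $\ell(n) = O(\log^2 n)$ such that, for every $x$, $x \in A$ if and only if there is a string $y$ of length at most $\ell(|x|)$ with $(x, y) \in B$. -/

import Mathlib

namespace LatinIsotopy

/-! ### Logarithmic space Turing machines -/

/-- What the input head sees: an end marker or a bit. An input `x` of length `n` is written as
`⊢ x ⊣`: the left marker is in cell `0`, bit `j` of `x` in cell `j + 1`, the right marker in
cell `n + 1`. -/
inductive InSym
  | leftEnd
  | rightEnd
  | bit (b : Bool)

/-- The symbol in cell `p` of the input tape holding `x`. -/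
def inSym (x : List Bool) : ℕ → InSym
  | 0 => .leftEnd
  | p + 1 => if h : p < x.length then .bit x[p] else .rightEnd

/-- Head movement on a tape with cells `0, 1, 2, …`; `none` means that the head stays, and a head
on cell `0` cannot move left. -/
def moveHead : Option Turing.Dir → ℕ → ℕ
  | none, p => p
  | some .left, p => p - 1
  | some .right, p => p + 1

/-- What a machine does in one step: new state, movement of the input head, symbols written on
the `k` work tapes, movements of the work heads, and possibly a bit written on the output tape. -/
structure Action (Q Γ : Type) (k : ℕ) where
  next : Q
  inMove : Option Turing.Dir
  write : Fin k → Γ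
  move : Fin k → Option Turing.Dir
  emit : Option Bool

/-- A deterministic Turing machine with a read-only two-way input tape, `k` read-write work tapes
(infinite to the right) and a write-only one-way output tape. The machine halts where `δ` is
`none`. -/
structure Machine where
  Q : Type
  Γ : Type
  finQ : Fintype Q
  finΓ : Fintype Γ
  k : ℕ
  start : Q
  accept : Set Q
  blank : Γ
  δ : Q → InSym → (Fin k → Γ) → Option (Action Q Γ k)

namespace Machine

variable (M : Machine)

/-- A configuration: state, position of the input head, contents of the work tapes, positions of
the work heads, and the string written so far on the output tape. -/
structure Cfg where
  state : M.Q
  inPos : ℕ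
  tape : Fin M.k → ℕ → M.Γ
  head : Fin M.k → ℕ
  out : List Bool

/-- The initial configuration: work tapes blank, the input head on the left marker. -/
def init : M.Cfg where
  state := M.start
  inPos := 0
  tape := fun _ _ => M.blank
  head := fun _ => 0
  out := []

/-- The configuration after an action, on an input of length `n`. The input head cannot move
beyond the end markers. -/
def act (n : ℕ) (c : M.Cfg) (a : Action M.Q M.Γ M.k) : M.Cfg where
  state := a.next
  inPos := min (moveHead a.inMove c.inPos) (n + 1)
  tape := fun i => Function.update (c.tape i) (c.head i) (a.write i)
  head := fun i => moveHead (a.move i) (c.head i)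
  out := c.out ++ a.emit.toList

/-- One step of the computation on input `x`; `none` if the machine halts. -/
def step (x : List Bool) (c : M.Cfg) : Option M.Cfg :=
  (M.δ c.state (inSym x c.inPos) (fun i => c.tape i (c.head i))).map (M.act x.length c)

/-- On input `x` the machine only ever visits the first `s` cells of each work tape. -/
def SpaceAtMost (x : List Bool) (s : ℕ) : Prop :=
  ∀ c : M.Cfg, StateTransition.Reaches (M.step x) M.init c → ∀ i, c.head i < s

/-- On input `x` the machine halts in configuration `c`. -/
def HaltsAt (x : List Bool) (c : M.Cfg) : Prop :=
  c ∈ StateTransition.eval (M.step x) M.init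

end Machine

/-- The class `L`: languages decided by a deterministic machine that halts on every input and
uses `O(log n)` cells of its work tapes on inputs of length `n`. -/
def LogSpace : Set (Language Bool) :=
  {A | ∃ (M : Machine) (c : ℕ), ∀ x : List Bool,
    M.SpaceAtMost x (c * Nat.log 2 x.length + c) ∧
    ∃ f : M.Cfg, M.HaltsAt x f ∧ (x ∈ A ↔ f.state ∈ M.accept)}

/-- A deterministic logarithmic space machine computes the map `1ⁿ ↦ f n`. -/
def LogSpaceOnUnary (f : ℕ → List Bool) : Prop :=
  ∃ (M : Machine) (c : ℕ), ∀ n : ℕ,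
    M.SpaceAtMost (List.replicate n true) (c * Nat.log 2 n + c) ∧
    ∃ g : M.Cfg, M.HaltsAt (List.replicate n true) g ∧ g.out = f n

/-! ### Boolean circuits with gates of unbounded fan-in -/

/-- A gate: an input bit, or the negation, conjunction or disjunction of the values of gates,
which are named by their index in the circuit. -/
inductive Gate
  | input (i : ℕ)
  | not (j : ℕ)
  | and (js : List ℕ)
  | or (js : List ℕ)

/-- A circuit is the list of its gates in topological order; the last gate is the output. -/
abbrev Circuit := List Gate

namespace Gate

/-- A gate that reads `n` input bits and earlier gates `0, …, m - 1` only. -/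
def WellFormed (n m : ℕ) : Gate → Prop
  | input i => i < n
  | not j => j < m
  | and js => ∀ j ∈ js, j < m
  | or js => ∀ j ∈ js, j < m

/-- The value of a gate, given the input `x` and the values `vs` of the earlier gates. -/
def value (x vs : List Bool) : Gate → Bool
  | input i => x.getD i false
  | not j => !vs.getD j false
  | and js => js.all fun j => vs.getD j false
  | or js => js.any fun j => vs.getD j false

/-- The depth of a gate, given the depths `ds` of the earlier gates: the largest number of
non-input gates on a path ending in this gate. -/
def depth (ds : List ℕ) : Gate → ℕ
  | input _ => 0
  | not j => ds.getD j 0 + 1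
  | and js => (js.map fun j => ds.getD j 0).foldr max 0 + 1
  | or js => (js.map fun j => ds.getD j 0).foldr max 0 + 1

end Gate

/-- The number `m` as the string `1ᵐ0`. -/
def unary (m : ℕ) : List Bool := List.replicate m true ++ [false]

/-- A list of numbers: each one is preceded by `1`, and the list is closed by `0`. -/
def encodeList (js : List ℕ) : List Bool :=
  (js.flatMap fun j => true :: unary j) ++ [false]

/-- A prefix code for gates: two bits for the kind, then the arguments. -/
def Gate.encode : Gate → List Bool
  | .input i => [false, false] ++ unary i
  | .not j => [false, true] ++ unary j
  | .and js => [true, false] ++ encodeList js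
  | .or js => [true, true] ++ encodeList js

namespace Circuit

/-- A circuit with `n` input bits: it is not empty and each gate reads only input bits and
earlier gates. -/
def WellFormed (n : ℕ) (C : Circuit) : Prop :=
  C ≠ [] ∧ ∀ (m : ℕ) (h : m < C.length), C[m].WellFormed n m

/-- The values of all gates on input `x`. -/
def values (x : List Bool) (C : Circuit) : List Bool :=
  C.foldl (fun vs g => vs ++ [g.value x vs]) []

/-- The output of the circuit on input `x`. -/
def output (x : List Bool) (C : Circuit) : Bool :=
  (values x C).getLastD false

/-- The depths of all gates. -/
def depths (C : Circuit) : List ℕ :=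
  C.foldl (fun ds g => ds ++ [g.depth ds]) []

/-- The depth of the circuit: the largest depth of a gate. -/
def depth (C : Circuit) : ℕ := (depths C).foldr max 0

/-- The circuit as a binary string. Gate indices are written in unary; for circuits of polynomial
size this is, up to a logarithmic space translation, the same as writing them in binary. -/
def encode (C : Circuit) : List Bool := C.flatMap Gate.encode

end Circuit

/-- The class `FO(d(n))`: languages decided by logspace uniform families of circuits of unbounded
fan-in, of depth `O(d(n))` and of polynomial size. -/
def FO (d : ℕ → ℕ) : Set (Language Bool) :=
  {A | ∃ (C : ℕ → Circuit) (c : ℕ),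
    LogSpaceOnUnary (fun n => (C n).encode) ∧
    (∀ n, (C n).WellFormed n ∧ (C n).length ≤ c * n ^ c + c ∧ (C n).depth ≤ c * d n + c) ∧
    ∀ x : List Bool, x ∈ A ↔ (C x.length).output x = true}

/-- The class `FOLL = FO(log log n)`. -/
def FOLL : Set (Language Bool) := FO fun n => Nat.log 2 (Nat.log 2 n)

/-! ### Limited nondeterminism -/

/-- The pair `(x, y)` as a string: each bit of `x` is preceded by `1`, then come `0` and `y`. -/
def pair (x y : List Bool) : List Bool :=
  (x.flatMap fun b => [true, b]) ++ false :: y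

/-- The class `β_i 𝒞`: languages `A` for which there is `B ∈ 𝒞` such that `x ∈ A` if and only if
`(x, y) ∈ B` for some `y` of length `O(logⁱ |x|)`. -/
def Beta (i : ℕ) (𝒞 : Set (Language Bool)) : Set (Language Bool) :=
  {A | ∃ B ∈ 𝒞, ∃ c : ℕ, ∀ x : List Bool,
    x ∈ A ↔ ∃ y : List Bool, y.length ≤ c * Nat.log 2 x.length ^ i + c ∧ pair x y ∈ B}

/-! ### Latin squares -/

/-- `op` is the multiplication of a quasigroup. -/
def IsQuasigroup {G : Type*} (op : G → G → G) : Prop :=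
  ∀ a b : G, (∃! x, op a x = b) ∧ (∃! y, op y a = b)

/-- There is an isotopy `(α, β, γ)` between the two operations. -/
def Isotopic {G H : Type*} (op₁ : G → G → G) (op₂ : H → H → H) : Prop :=
  ∃ α β γ : G ≃ H, ∀ x y : G, op₂ (α x) (β y) = γ (op₁ x y)

/-- The multiplication table of an operation on `{0, …, n - 1}`, row by row, each entry written
in binary with `⌈log₂ n⌉` bits, the lowest bit first. -/
def encodeTable {n : ℕ} (op : Fin n → Fin n → Fin n) : List Bool :=
  (List.finRange n).flatMap fun i => (List.finRange n).flatMap fun j =>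
    (List.range (Nat.clog 2 n)).map fun t => (op i j : ℕ).testBit t

/-- The Latin Square Isotopy problem: the pairs of multiplication tables of isotopic (nonempty,
finite) quasigroups. -/
def LatinSquareIsotopy : Language Bool :=
  {w | ∃ (n m : ℕ) (op₁ : Fin n → Fin n → Fin n) (op₂ : Fin m → Fin m → Fin m),
    0 < n ∧ 0 < m ∧ IsQuasigroup op₁ ∧ IsQuasigroup op₂ ∧ Isotopic op₁ op₂ ∧
    w = pair (encodeTable op₁) (encodeTable op₂)}

end LatinIsotopy

/-! Let L = ⌈log₂ n⌉ and fix an element b of a quasigroup of order n. For an element h consider the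
shift u ↦ (u / b) h, where u / b is the solution x of x b = u. For a fixed target z, distinct points
of a set S need distinct h to be shifted to z. Averaging over h therefore gives a shift such that
the relative size of the complement of S ∪ shift(S) is at most the square of that of S
(`exists_shift`). From a single point, the relative complement after k such steps is at most (1 -
1/n)^(2^k) ≤ exp(-2^k / n), so 2L shifts reach everything (`exists_cube`). Hence u₀, b and 2L
elements h_i name every element by a number e of 2L bits: T e is the end of the walk from u₀ that
performs shift i exactly when bit i of e is set.

A certificate lists a, b, u₀ and the h_i for both squares: 2(2L + 3) elements of L bits, which is
O(log²). An isotopy satisfies γ((u / b) h) = (γ u / β b) β h, so it carries a good row for the first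
square to one for the second, with T' e = γ (T e) (`walk_isotopy`). Conversely, suppose that T and
T' are onto and that T e₃ = (T e₁ / b)(a \ T e₂) always implies the same equation for T'. Then T'
factors through T, the factor is a bijection γ, and α and β are read off from γ
(`isotopic_of_triple`).

Apart from the walks, checking a certificate is first order over the bits of the input, with
polynomially many values for each variable. For `LogSpace` a walk is followed step by step, keeping
only the current element (`walkSpec_followRel`). For `FOLL` a walk of s steps is split into halves
with a guessed midpoint; each halving costs one round of constant depth, and O(log log) rounds
suffice for 2L steps (`stage_pathEnv`). A single formula `isotopyF` serves both classes: its main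
part is evaluated in logarithmic space with the walk relation as an oracle, and the iteration of the
whole formula unrolls into uniform circuits (`Fml.mem_FOLL`).

Logarithmic space is handled by a calculus of functions `LS` and string functions `Emits`, closed
under composition, bounded recursion and bounded quantification. Its members are computed by
register programs with polynomially bounded registers. A machine keeps all registers in binary on
parallel tracks of one work tape, so that register operations and comparisons become sweeps of a
two-state transducer. -/

namespace LatinIsotopy

/-! ### Components of machines with one work tape -/

/-- What a component does in one step: it goes on to a state or leaves by an exit, moves the input
head, writes a symbol, moves the work head, and possibly writes an output bit. -/
structure CAct (Q E Γ : Type) where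
  next : Q ⊕ E
  inMove : Option Turing.Dir
  write : Γ
  move : Option Turing.Dir
  emit : Option Bool

/-- A part of a machine with one work tape, which is entered at `start` and left by an exit. -/
structure Comp (Γ E : Type) where
  Q : Type
  finQ : Fintype Q
  start : Q
  δ : Q → InSym → Γ → CAct Q E Γ

/-- A configuration of a machine with one work tape, without the state. -/
structure MemCfg (Γ : Type) where
  inPos : ℕ
  tape : ℕ → Γ
  head : ℕ
  out : List Bool

namespace Comp

variable {Γ E F : Type}

/-- The memory after an action, on an input of length `n`. -/
def after {Q E : Type} (n : ℕ) (c : MemCfg Γ) (a : CAct Q E Γ) : MemCfg Γ where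
  inPos := min (moveHead a.inMove c.inPos) (n + 1)
  tape := Function.update c.tape c.head a.write
  head := moveHead a.move c.head
  out := c.out ++ a.emit.toList

/-- The action taken in state `q` and memory `c`. -/
def action (C : Comp Γ E) (x : List Bool) (q : C.Q) (c : MemCfg Γ) : CAct C.Q E Γ :=
  C.δ q (inSym x c.inPos) (c.tape c.head)

/-- Started in state `q`, the component leaves by exit `e`, and on the way (up to the step that
leaves) the work head visits only the first `S` cells. -/
inductive Run (C : Comp Γ E) (x : List Bool) (S : ℕ) : C.Q → MemCfg Γ → E → MemCfg Γ → Prop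
  | exit {q c e} (hS : c.head < S) (h : (C.action x q c).next = .inr e) :
      Run C x S q c e (after x.length c (C.action x q c))
  | step {q c q' e c'} (hS : c.head < S) (h : (C.action x q c).next = .inl q')
      (hr : Run C x S q' (after x.length c (C.action x q c)) e c') : Run C x S q c e c'

theorem Run.exit_of {C : Comp Γ E} {x : List Bool} {S : ℕ} {q c e c'} (hS : c.head < S)
    (h : (C.action x q c).next = .inr e) (h' : after x.length c (C.action x q c) = c') :
    Run C x S q c e c' := h' ▸ .exit hS h

theorem Run.step_of {C : Comp Γ E} {x : List Bool} {S : ℕ} {q c q' c₁ e c'} (hS : c.head < S)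
    (h : (C.action x q c).next = .inl q') (h' : after x.length c (C.action x q c) = c₁)
    (hr : Run C x S q' c₁ e c') : Run C x S q c e c' := .step hS h (h' ▸ hr)

/-- The action with the continuation replaced. -/
def _root_.LatinIsotopy.CAct.map {Q E Q' E' : Type} (f : Q ⊕ E → Q' ⊕ E') (a : CAct Q E Γ) :
    CAct Q' E' Γ where
  next := f a.next
  inMove := a.inMove
  write := a.write
  move := a.move
  emit := a.emit

/-- Sequential composition: on exit `e` of `C` go on with `D e`. -/
def bind (C : Comp Γ E) (D : E → Comp Γ F) [Fintype E] : Comp Γ F where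
  Q := C.Q ⊕ (Σ e, (D e).Q)
  finQ :=
    letI := C.finQ
    letI := fun e => (D e).finQ
    inferInstance
  start := .inl C.start
  δ
    | .inl q, i, g => (C.δ q i g).map fun
      | .inl q' => .inl (.inl q')
      | .inr e => .inl (.inr ⟨e, (D e).start⟩)
    | .inr ⟨e, q⟩, i, g => ((D e).δ q i g).map fun
      | .inl q' => .inl (.inr ⟨e, q'⟩)
      | .inr f => .inr f

theorem Run.bind [Fintype E] {C : Comp Γ E} {D : E → Comp Γ F} {x : List Bool} {S : ℕ}
    {c₀ c₁ c₂ : MemCfg Γ} {q : C.Q} {e : E} {f : F} (h₁ : Run C x S q c₀ e c₁)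
    (h₂ : Run (D e) x S (D e).start c₁ f c₂) : Run (C.bind D) x S (.inl q) c₀ f c₂ := by
  induction h₁ with
  | exit hS h =>
    rename_i q c e
    refine .step_of hS (C := C.bind D) (q' := Sum.inr ⟨e, (D e).start⟩) ?_ rfl ?_
    · simp only [action, Comp.bind, CAct.map] at h ⊢
      rw [h]
    -- Once inside the copy of `D e`, the composite never leaves it before the final exit, so a run
    -- of `D e` transfers state by state.
    · have key : ∀ {q c f c'}, Run (D e) x S q c f c' →
          Run (C.bind D) x S (.inr ⟨e, q⟩) c f c' := by
        intro q c f c' hr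
        induction hr with
        | exit hS h =>
          refine .exit_of hS ?_ rfl
          simp only [action, Comp.bind, CAct.map] at h ⊢
          rw [h]
        | step hS h hr ih =>
          refine .step_of hS (C := C.bind D) (q' := Sum.inr ⟨e, _⟩) ?_ rfl ih
          simp only [action, Comp.bind, CAct.map] at h ⊢
          rw [h]
      exact key h₂
  | step hS h hr ih =>
    refine .step_of hS (C := C.bind D) (q' := Sum.inl _) ?_ rfl (ih h₂)
    simp only [action, Comp.bind, CAct.map] at h ⊢
    rw [h]

/-- Iteration: start again on exit `none`, leave on exit `some e`. -/
def iter (C : Comp Γ (Option E)) : Comp Γ E where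
  Q := C.Q
  finQ := C.finQ
  start := C.start
  δ q i g := (C.δ q i g).map fun
    | .inl q' => .inl q'
    | .inr none => .inl C.start
    | .inr (some e) => .inr e

theorem Run.iter_some {C : Comp Γ (Option E)} {x : List Bool} {S : ℕ} {c₀ c₁ : MemCfg Γ}
    {q : C.Q} {e : E} (h : Run C x S q c₀ (some e) c₁) : Run C.iter x S q c₀ e c₁ := by
  generalize he : some e = o at h
  induction h with
  | exit hS h =>
    subst he
    refine .exit_of hS ?_ rfl
    simp only [action, iter, CAct.map] at h ⊢
    rw [h]
  | step hS h hr ih =>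
    refine .step_of hS ?_ rfl (ih he)
    simp only [action, iter, CAct.map] at h ⊢
    rw [h]

theorem Run.iter_none {C : Comp Γ (Option E)} {x : List Bool} {S : ℕ} {c₀ c₁ c₂ : MemCfg Γ}
    {q : C.Q} {e : E} (h : Run C x S q c₀ none c₁) (h' : Run C.iter x S C.start c₁ e c₂) :
    Run C.iter x S q c₀ e c₂ := by
  generalize he : none = o at h
  induction h with
  | exit hS h =>
    subst he
    refine .step_of hS (C := C.iter) (q' := C.start) ?_ rfl h'
    simp only [action, iter, CAct.map] at h ⊢
    rw [h]
  | step hS h hr ih =>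
    refine .step_of hS ?_ rfl (ih h' he)
    simp only [action, iter, CAct.map] at h ⊢
    rw [h]

/-- A single step that leaves the work tape alone. -/
def atom (f : InSym → E) (d : Option Turing.Dir) (b : Option Bool) : Comp Γ E where
  Q := Unit
  finQ := inferInstance
  start := ()
  δ _ i g := ⟨.inr (f i), d, g, none, b⟩

theorem run_atom (f : InSym → E) (d : Option Turing.Dir) (b : Option Bool) {x : List Bool} {S : ℕ}
    {c c' : MemCfg Γ} (hS : c.head < S)
    (h : ⟨min (moveHead d c.inPos) (x.length + 1), c.tape, c.head, c.out ++ b.toList⟩ = c') :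
    Run (atom f d b) x S () c (f (inSym x c.inPos)) c' := by
  subst h
  refine .exit_of hS rfl ?_
  simp [after, action, atom, moveHead]

/-- Move the input head to the left marker. -/
def rewind : Comp Γ Unit where
  Q := Unit
  finQ := inferInstance
  start := ()
  δ
    | _, .leftEnd, g => ⟨.inr (), none, g, none, none⟩
    | _, _, g => ⟨.inl (), some .left, g, none, none⟩

theorem run_rewind {x : List Bool} {S : ℕ} {c : MemCfg Γ} (hS : c.head < S)
    (hp : c.inPos ≤ x.length + 1) :
    Run rewind x S () c () ⟨0, c.tape, c.head, c.out⟩ := by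
  obtain ⟨p, t, h, o⟩ := c
  induction p with
  | zero =>
    refine .exit_of hS rfl ?_
    simp [after, action, rewind, inSym, moveHead]
  | succ p ih =>
    simp only at hp hS ih ⊢
    have hne : inSym x (p + 1) ≠ .leftEnd := by
      simp only [inSym]; split <;> simp
    have ha : (rewind (Γ := Γ)).action x () ⟨p + 1, t, h, o⟩ =
        ⟨.inl (), some .left, t h, none, none⟩ := by
      simp only [action]
      revert hne
      cases inSym x (p + 1) <;> simp [rewind]
    refine .step_of hS (by rw [ha]) ?_ (ih hS (by omega))
    rw [ha]
    simp [after, moveHead]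
    omega

/-! ### From components to machines -/

/-- The machine that runs the component and accepts on exit `true`. -/
def toMachine (C : Comp Γ Bool) (hΓ : Fintype Γ) (blank : Γ) : Machine where
  Q := C.Q ⊕ Bool
  Γ := Γ
  finQ := letI := C.finQ; inferInstance
  finΓ := hΓ
  k := 1
  start := .inl C.start
  accept := {.inr true}
  blank := blank
  δ
    | .inl q, i, g =>
      let a := C.δ q i (g 0)
      some ⟨a.next, a.inMove, fun _ => a.write, fun _ => a.move, a.emit⟩
    | .inr _, _, _ => none

/-- A configuration of `toMachine` from a state and the memory. -/
def toCfg (C : Comp Γ Bool) (hΓ : Fintype Γ) (blank : Γ) (q : C.Q ⊕ Bool) (c : MemCfg Γ) :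
    (C.toMachine hΓ blank).Cfg :=
  ⟨q, c.inPos, fun _ => c.tape, fun _ => c.head, c.out⟩

theorem step_toCfg (C : Comp Γ Bool) (hΓ : Fintype Γ) (blank : Γ) (x : List Bool) (q : C.Q)
    (c : MemCfg Γ) :
    (C.toMachine hΓ blank).step x (C.toCfg hΓ blank (.inl q) c) =
      some (C.toCfg hΓ blank (C.action x q c).next (after x.length c (C.action x q c))) := rfl

theorem step_toCfg_exit (C : Comp Γ Bool) (hΓ : Fintype Γ) (blank : Γ) (x : List Bool) (e : Bool)
    (c : MemCfg Γ) :
    (C.toMachine hΓ blank).step x (C.toCfg hΓ blank (.inr e) c) = none := rfl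

theorem Run.reaches {C : Comp Γ Bool} (hΓ : Fintype Γ) (blank : Γ) {x : List Bool} {S : ℕ}
    {q c e c'} (h : Run C x S q c e c') :
    StateTransition.Reaches ((C.toMachine hΓ blank).step x) (C.toCfg hΓ blank (.inl q) c)
      (C.toCfg hΓ blank (.inr e) c') := by
  induction h with
  | exit hS h =>
    refine Relation.ReflTransGen.single ?_
    rw [step_toCfg, h]
    rfl
  | step hS h hr ih =>
    refine Relation.ReflTransGen.head ?_ ih
    rw [step_toCfg, h]
    rfl

/-- The machine is deterministic, so every reachable configuration lies on the run or is its halting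
configuration. The run does not bound the head of the latter; this is what `hc` adds. -/
theorem Run.head_lt {C : Comp Γ Bool} (hΓ : Fintype Γ) (blank : Γ) {x : List Bool} {S : ℕ}
    {q c e c'} (h : Run C x S q c e c') (hc : c'.head < S) (d : (C.toMachine hΓ blank).Cfg)
    (hd : StateTransition.Reaches ((C.toMachine hΓ blank).step x)
      (C.toCfg hΓ blank (.inl q) c) d) (i) : d.head i < S := by
  induction h with
  | exit hS h =>
    rcases Relation.ReflTransGen.cases_head hd with rfl | ⟨d', h', h''⟩
    · exact hS
    · rw [step_toCfg, h] at h'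
      cases h'
      rcases Relation.ReflTransGen.cases_head h'' with rfl | ⟨d'', h₁, h₂⟩
      · exact hc
      · rw [step_toCfg_exit] at h₁
        cases h₁
  | step hS h hr ih =>
    rcases Relation.ReflTransGen.cases_head hd with rfl | ⟨d', h', h''⟩
    · exact hS
    · rw [step_toCfg, h] at h'
      cases h'
      exact ih hc h''

/-- A run of the component from the initial memory gives the result of the machine. -/
theorem Run.machine {C : Comp Γ Bool} (hΓ : Fintype Γ) (blank : Γ) {x : List Bool} {S : ℕ} {e c'}
    (h : Run C x S C.start ⟨0, fun _ => blank, 0, []⟩ e c') (hc : c'.head < S) :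
    (C.toMachine hΓ blank).SpaceAtMost x S ∧
      (C.toMachine hΓ blank).HaltsAt x (C.toCfg hΓ blank (.inr e) c') :=
  ⟨fun d hd i => h.head_lt hΓ blank hc d hd i,
    StateTransition.mem_eval.2 ⟨h.reaches hΓ blank, rfl⟩⟩

end Comp

/-! ### Sweeps over a work tape with several tracks -/

/-- Work tape symbols: blank, the left marker, or a cell with one bit on each of `K` tracks. -/
abbrev Sym (K : ℕ) := Option (Option (Fin K → Bool))

/-- The tape with the left marker, the cells `D 0, …, D (ℓ - 1)`, and blanks. -/
def tapeOf {K : ℕ} (ℓ : ℕ) (D : ℕ → Fin K → Bool) : ℕ → Sym K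
  | 0 => some none
  | i + 1 => if i < ℓ then some (some (D i)) else none

theorem tapeOf_congr {K ℓ : ℕ} {D D' : ℕ → Fin K → Bool} (h : ∀ i < ℓ, D i = D' i) :
    tapeOf ℓ D = tapeOf ℓ D' := by
  funext i
  cases i with
  | zero => rfl
  | succ i =>
    simp only [tapeOf]
    split
    · rw [h i ‹_›]
    · rfl

namespace Comp

/-- Sweep over the cells with the transducer `f`, append a cell if `ext` is set and the final state
is `true`, return to the left marker, and leave by the final state. -/
def sweep {K : ℕ} (f : Bool → (Fin K → Bool) → Bool × (Fin K → Bool)) (σ₀ ext : Bool) :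
    Comp (Sym K) Bool where
  Q := Option (Bool × Bool)
  finQ := inferInstance
  start := none
  δ
    | none, _, g => ⟨.inl (some (true, σ₀)), none, g, some .right, none⟩
    | some (true, σ), _, some (some d) =>
      ⟨.inl (some (true, (f σ d).1)), none, some (some (f σ d).2), some .right, none⟩
    | some (true, σ), _, g =>
      ⟨.inl (some (false, σ)), none,
        if ext && σ then some (some (f σ fun _ => false).2) else g, some .left, none⟩
    | some (false, σ), _, some none => ⟨.inr σ, none, some none, none, none⟩
    | some (false, σ), _, g => ⟨.inl (some (false, σ)), none, g, some .left, none⟩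

/-- The state of the transducer before cell `i`. -/
def sweepState {K : ℕ} (f : Bool → (Fin K → Bool) → Bool × (Fin K → Bool)) (σ₀ : Bool)
    (D : ℕ → Fin K → Bool) : ℕ → Bool
  | 0 => σ₀
  | i + 1 => (f (sweepState f σ₀ D i) (D i)).1

variable {K : ℕ} {f : Bool → (Fin K → Bool) → Bool × (Fin K → Bool)} {σ₀ ext : Bool}
  {x : List Bool} {S : ℕ}

theorem run_sweep_left (σ : Bool) {tape : ℕ → Sym K} {p h : ℕ} {o : List Bool}
    (h0 : tape 0 = some none) (hne : ∀ i, 0 < i → i ≤ h → tape i ≠ some none) (hS : h < S)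
    (hp : p ≤ x.length + 1) :
    Run (sweep f σ₀ ext) x S (some (false, σ)) ⟨p, tape, h, o⟩ σ ⟨p, tape, 0, o⟩ := by
  induction h with
  | zero =>
    refine .exit_of hS ?_ ?_
    · simp [action, h0, sweep]
    · simp [action, h0, sweep, after, moveHead, hp, Function.update_eq_self_iff]
  | succ h ih =>
    have ha : (sweep f σ₀ ext).action x (some (false, σ)) ⟨p, tape, h + 1, o⟩ =
        ⟨.inl (some (false, σ)), none, tape (h + 1), some .left, none⟩ := by
      have := hne (h + 1) (by omega) le_rfl
      simp only [action]
      match htc : tape (h + 1) with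
      | none => rfl
      | some none => exact absurd htc this
      | some (some d) => rfl
    refine .step_of hS (by rw [ha]) ?_ (ih (fun i hi hi' => hne i hi (by omega)) (by omega))
    rw [ha]
    simp [after, moveHead, hp]

/-- Cells before `i` are already rewritten, the others are still original. By `hD` the blank after
the last cell stands for a cell of zeros, so a cell appended there is the output of the transducer
on `D ℓ`, and one formula describes the tape whether or not it grows. -/
theorem run_sweep_right {ℓ : ℕ} {D : ℕ → Fin K → Bool} {p : ℕ} {o : List Bool}
    (hD : D ℓ = fun _ => false) (hS : ℓ + 1 < S) (hp : p ≤ x.length + 1) (i : ℕ) (hi : i ≤ ℓ) :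
    Run (sweep f σ₀ ext) x S (some (true, sweepState f σ₀ D i))
      ⟨p, tapeOf ℓ (fun j => if j < i then (f (sweepState f σ₀ D j) (D j)).2 else D j), i + 1, o⟩
      (sweepState f σ₀ D ℓ)
      ⟨p, tapeOf (if ext && sweepState f σ₀ D ℓ then ℓ + 1 else ℓ)
        (fun j => (f (sweepState f σ₀ D j) (D j)).2), 0, o⟩ := by
  obtain ⟨d, rfl⟩ := Nat.exists_eq_add_of_le hi
  induction d generalizing i with
  | zero =>
    simp only [Nat.add_zero] at hD hS ⊢
    have htape : tapeOf i (fun j => if j < i then (f (sweepState f σ₀ D j) (D j)).2 else D j) =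
        tapeOf i (fun j => (f (sweepState f σ₀ D j) (D j)).2) :=
      tapeOf_congr fun j hj => by simp [hj]
    rw [htape]
    refine .step_of (q' := some (false, sweepState f σ₀ D i)) (by simpa using hS) ?_ ?_
      (run_sweep_left (h := i) _ (tape := tapeOf _ _) rfl ?_ (by omega) hp)
    · simp [action, tapeOf, sweep]
    · simp only [action, tapeOf, sweep, after, moveHead, MemCfg.mk.injEq, lt_irrefl, if_false]
      refine ⟨by simp [hp], ?_, by simp, by simp⟩
      funext j
      rcases j with _ | j
      · simp [tapeOf]
      · by_cases hj : j = i
        · subst hj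
          cases hb : (ext && sweepState f σ₀ D j) <;> simp [tapeOf, hD]
        · rw [Function.update_of_ne (by omega)]
          simp only [tapeOf]
          split_ifs <;> first | rfl | omega
    · intro j hj _
      obtain ⟨j, rfl⟩ := Nat.exists_eq_succ_of_ne_zero hj.ne'
      simp only [tapeOf]
      split <;> simp
  | succ d ih =>
    have ih' := ih (i + 1) (by convert hD using 2; omega) (by omega) (by omega)
    have e : i + 1 + d = i + (d + 1) := by omega
    rw [e] at ih'
    refine .step_of (by simp only; omega) ?_ ?_ ih'
    · simp [action, tapeOf, sweep, sweepState]
    · simp only [action, tapeOf, sweep, after, moveHead, MemCfg.mk.injEq, lt_irrefl, if_false]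
      have : i < i + (d + 1) := by omega
      simp only [this, if_true]
      refine ⟨by simp [hp], ?_, by simp, by simp⟩
      funext j
      rcases j with _ | j
      · simp [tapeOf]
      · by_cases hj : j = i
        · subst hj
          simp [tapeOf]
        · rw [Function.update_of_ne (by omega)]
          simp only [tapeOf]
          have : j < i ↔ j < i + 1 := by omega
          simp only [this]

theorem run_sweep {ℓ : ℕ} {D : ℕ → Fin K → Bool} {p : ℕ} {o : List Bool}
    (hD : D ℓ = fun _ => false) (hS : ℓ + 1 < S) (hp : p ≤ x.length + 1) :
    Run (sweep f σ₀ ext) x S none ⟨p, tapeOf ℓ D, 0, o⟩ (sweepState f σ₀ D ℓ)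
      ⟨p, tapeOf (if ext && sweepState f σ₀ D ℓ then ℓ + 1 else ℓ)
        (fun j => (f (sweepState f σ₀ D j) (D j)).2), 0, o⟩ := by
  refine .step_of (by simp only; omega) (q' := some (true, σ₀)) ?_ ?_
    (run_sweep_right hD hS hp 0 (by omega))
  · simp [action, sweep]
  · simp [action, sweep, after, moveHead, hp]

end Comp

/-! ### Register programs -/

/-- The state of a register program: registers, position of the input head, output. -/
structure PState where
  reg : ℕ → ℕ
  pos : ℕ
  out : List Bool

/-- Tests: equality of registers, input symbol `1`, right end of the input. -/
inductive Test
  | eq (r s : ℕ)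
  | isOne
  | isEnd

/-- Whether a test succeeds. -/
def Test.Holds (x : List Bool) (s : PState) : Test → Prop
  | eq r t => s.reg r = s.reg t
  | isOne => inSym x s.pos = .bit true
  | isEnd => inSym x s.pos = .rightEnd

/-- Programs; `loop T P` repeats `P` until `T` holds. -/
inductive Prog
  | inc (r : ℕ)
  | clear (r : ℕ)
  | copy (r s : ℕ)
  | emit (b : Bool)
  | home
  | right
  | seq (P Q : Prog)
  | ite (T : Test) (P Q : Prog)
  | loop (T : Test) (P : Prog)

/-- `Exec x B P s s'`: on input `x`, program `P` takes state `s` to `s'`, and no register is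
increased beyond `B` on the way. -/
inductive Exec (x : List Bool) (B : ℕ) : Prog → PState → PState → Prop
  | inc {r s} (h : s.reg r + 1 ≤ B) :
      Exec x B (.inc r) s { s with reg := Function.update s.reg r (s.reg r + 1) }
  | clear {r s} : Exec x B (.clear r) s { s with reg := Function.update s.reg r 0 }
  | copy {r t s} : Exec x B (.copy r t) s { s with reg := Function.update s.reg r (s.reg t) }
  | emit {b s} : Exec x B (.emit b) s { s with out := s.out ++ [b] }
  | home {s} : Exec x B .home s { s with pos := 0 }
  | right {s} : Exec x B .right s { s with pos := min (s.pos + 1) (x.length + 1) }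
  | seq {P Q s₁ s₂ s₃} (h : Exec x B P s₁ s₂) (h' : Exec x B Q s₂ s₃) : Exec x B (.seq P Q) s₁ s₃
  | iteTrue {T P Q s s'} (hT : T.Holds x s) (h : Exec x B P s s') : Exec x B (.ite T P Q) s s'
  | iteFalse {T P Q s s'} (hT : ¬ T.Holds x s) (h : Exec x B Q s s') : Exec x B (.ite T P Q) s s'
  | loopDone {T P s} (hT : T.Holds x s) : Exec x B (.loop T P) s s
  | loopStep {T P s₁ s₂ s₃} (hT : ¬ T.Holds x s₁) (h : Exec x B P s₁ s₂)
      (h' : Exec x B (.loop T P) s₂ s₃) : Exec x B (.loop T P) s₁ s₃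

theorem Exec.mono {x : List Bool} {B B' : ℕ} {P s s'} (h : Exec x B P s s') (hB : B ≤ B') :
    Exec x B' P s s' := by
  induction h with
  | inc h => exact .inc (h.trans hB)
  | clear => exact .clear
  | copy => exact .copy
  | emit => exact .emit
  | home => exact .home
  | right => exact .right
  | seq _ _ h₁ h₂ => exact .seq h₁ h₂
  | iteTrue hT _ ih => exact .iteTrue hT ih
  | iteFalse hT _ ih => exact .iteFalse hT ih
  | loopDone hT => exact .loopDone hT
  | loopStep hT _ _ h₁ h₂ => exact .loopStep hT h₁ h₂

/-- A bound for the registers of a test. -/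
def Test.width : Test → ℕ
  | eq r s => max r s + 1
  | _ => 0

/-- A bound for the registers of a program. -/
def Prog.width : Prog → ℕ
  | inc r => r + 1
  | clear r => r + 1
  | copy r s => max r s + 1
  | seq P Q => max P.width Q.width
  | ite T P Q => max T.width (max P.width Q.width)
  | loop T P => max T.width P.width
  | _ => 0

/-! ### Compilation of programs to components -/

/-- Bit `i` of the registers below `K`. -/
def digits (K : ℕ) (reg : ℕ → ℕ) (i : ℕ) : Fin K → Bool := fun r => (reg r).testBit i

/-- Track `r` of a cell. -/
def getTrack {K : ℕ} (d : Fin K → Bool) (r : ℕ) : Bool := if h : r < K then d ⟨r, h⟩ else false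

/-- A cell with track `r` replaced. -/
def setTrack {K : ℕ} (d : Fin K → Bool) (r : ℕ) (b : Bool) : Fin K → Bool :=
  fun i => if i.val = r then b else d i

theorem getTrack_digits {K : ℕ} (reg : ℕ → ℕ) (i : ℕ) {r : ℕ} (h : r < K) :
    getTrack (digits K reg i) r = (reg r).testBit i := by
  simp [getTrack, digits, h]

theorem setTrack_digits {K : ℕ} (reg : ℕ → ℕ) (i r v : ℕ) (b : Bool) (h : v.testBit i = b) :
    setTrack (digits K reg i) r b = digits K (Function.update reg r v) i := by
  funext j
  simp only [setTrack, digits, Function.update_apply]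
  split <;> simp_all

open LatinIsotopy.Comp in
/-- The component performing a test. -/
def Test.comp (K : ℕ) : Test → Comp (Sym K) Bool
  | eq r s => sweep (fun σ d => (σ && (getTrack d r == getTrack d s), d)) true false
  | isOne => atom (fun | .bit b => b | _ => false) none none
  | isEnd => atom (fun | .rightEnd => true | _ => false) none none

open LatinIsotopy.Comp in
/-- The component performing a program. -/
def Prog.comp (K : ℕ) : Prog → Comp (Sym K) Unit
  | inc r => (sweep (fun σ d => (σ && getTrack d r, setTrack d r (xor σ (getTrack d r))))
      true true).bind fun _ => atom (fun _ => ()) none none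
  | clear r => (sweep (fun _ d => (false, setTrack d r false)) false false).bind
      fun _ => atom (fun _ => ()) none none
  | copy r s => (sweep (fun _ d => (false, setTrack d r (getTrack d s))) false false).bind
      fun _ => atom (fun _ => ()) none none
  | emit b => atom (fun _ => ()) none (some b)
  | home => rewind
  | right => atom (fun _ => ()) (some .right) none
  | seq P Q => (P.comp K).bind fun _ => Q.comp K
  | ite T P Q => (T.comp K).bind fun b => if b then P.comp K else Q.comp K
  | loop T P => ((T.comp K).bind fun b => if b then atom (fun _ => some ()) none none else
      (P.comp K).bind fun _ => atom (fun _ => none) none none).iter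

/-- The memory of the machine in the given state of the program. -/
def PState.mem (K ℓ : ℕ) (s : PState) : MemCfg (Sym K) :=
  ⟨s.pos, tapeOf ℓ (digits K s.reg), 0, s.out⟩

theorem digits_eq_false {K ℓ : ℕ} {reg : ℕ → ℕ} (h : ∀ r < K, reg r < 2 ^ ℓ) :
    digits K reg ℓ = fun _ => false := by
  funext r
  exact Nat.testBit_lt_two_pow (h r r.2)

/-- Ripple-carry addition: `c i` is the carry into bit `i`. The initial carry is left general
because the induction passes to `v / 2` with the carries shifted by one. -/
theorem testBit_add_carry (v i : ℕ) (c : ℕ → Bool) (hs : ∀ i, c (i + 1) = (c i && v.testBit i)) :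
    (v + (c 0).toNat).testBit i = xor (c i) (v.testBit i) := by
  induction i generalizing v c with
  | zero =>
    rcases Nat.mod_two_eq_zero_or_one v with h | h <;> cases c 0 <;>
      simp [Nat.testBit_zero, Nat.add_mod, h]
  | succ i ih =>
    rw [Nat.testBit_succ, Nat.testBit_succ, ← ih (v / 2) (fun i => c (i + 1))
      (fun i => by rw [hs, Nat.testBit_succ])]
    congr 1
    rw [hs 0, Nat.testBit_zero]
    cases c 0 <;> simp
    rcases Nat.mod_two_eq_zero_or_one v with h | h <;> simp [h] <;> omega

theorem testBit_add_one (v i : ℕ) (c : ℕ → Bool) (h0 : c 0 = true)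
    (hs : ∀ i, c (i + 1) = (c i && v.testBit i)) :
    (v + 1).testBit i = xor (c i) (v.testBit i) := by
  simpa [h0] using testBit_add_carry v i c hs

theorem Test.run_comp {x : List Bool} {K ℓ S : ℕ} {s : PState} (T : Test) (hK : T.width ≤ K)
    (hr : ∀ r < K, s.reg r < 2 ^ ℓ) (hS : ℓ + 1 < S) (hp : s.pos ≤ x.length + 1) :
    ∃ b, (b = true ↔ T.Holds x s) ∧
      (T.comp K).Run x S (T.comp K).start (s.mem K ℓ) b (s.mem K ℓ) := by
  cases T with
  | eq r t =>
    simp only [width] at hK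
    refine ⟨_, ?_, Comp.run_sweep (digits_eq_false hr) hS hp⟩
    have hst : ∀ i, Comp.sweepState (fun σ d => (σ && (getTrack d r == getTrack d t), d)) true
        (digits K s.reg) i = true ↔ ∀ j < i, (s.reg r).testBit j = (s.reg t).testBit j := by
      intro i
      induction i with
      | zero => simp [Comp.sweepState]
      | succ i ih =>
        rw [Comp.sweepState, Bool.and_eq_true, ih, getTrack_digits _ _ (by omega),
          getTrack_digits _ _ (by omega), beq_iff_eq]
        constructor
        · rintro ⟨h₁, h₂⟩ j hj
          rcases Nat.lt_succ_iff_lt_or_eq.1 hj with h | rfl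
          exacts [h₁ j h, h₂]
        · exact fun h => ⟨fun j hj => h j (by omega), h i (by omega)⟩
    rw [hst]
    simp only [Holds]
    constructor
    · intro h
      apply Nat.eq_of_testBit_eq
      intro j
      by_cases hj : j < ℓ
      · exact h j hj
      · have hp := Nat.pow_le_pow_right (n := 2) (by omega) (not_lt.1 hj)
        rw [Nat.testBit_lt_two_pow ((hr r (by omega)).trans_le hp),
          Nat.testBit_lt_two_pow ((hr t (by omega)).trans_le hp)]
    · intro h j _
      rw [h]
  | isOne =>
    refine ⟨_, ?_, Comp.run_atom _ none none (by simp [PState.mem]; omega)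
      (by simp [PState.mem, moveHead, hp])⟩
    simp only [Holds, PState.mem]
    cases inSym x s.pos <;> simp
  | isEnd =>
    refine ⟨_, ?_, Comp.run_atom _ none none (by simp [PState.mem]; omega)
      (by simp [PState.mem, moveHead, hp])⟩
    simp only [Holds, PState.mem]
    cases inSym x s.pos <;> simp

/-- The idle step turns one kind of exit into another: it discards the final bit of a sweep, and
tells a loop whether to go on. -/
theorem run_skip {E : Type} {x : List Bool} {K ℓ S : ℕ} {s : PState} (e : E) (hS : ℓ + 1 < S)
    (hp : s.pos ≤ x.length + 1) :
    (Comp.atom (fun _ => e) none none).Run x S () (s.mem K ℓ) e (s.mem K ℓ) := by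
  exact Comp.run_atom _ none none (by simp [PState.mem]; omega) (by simp [PState.mem, moveHead, hp])

theorem lt_of_update {K ℓ : ℕ} {reg : ℕ → ℕ} {r v : ℕ} (hr : ∀ r < K, reg r < 2 ^ ℓ)
    (hv : v < 2 ^ ℓ) : ∀ t < K, Function.update reg r v t < 2 ^ ℓ := by
  intro t ht
  rw [Function.update_apply]
  split
  exacts [hv, hr t ht]

/-- The invariant is that all registers fit into `ℓ ≤ log B + 1` cells. Only an increment can
lengthen the tape. The head visits the marker, the `ℓ` cells and the blank where a sweep turns
round, which gives `log B + 3`. -/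
theorem Exec.run_comp {x : List Bool} {B K : ℕ} {P : Prog} {s s' : PState} (h : Exec x B P s s')
    (hK : P.width ≤ K) (ℓ : ℕ) (hr : ∀ r < K, s.reg r < 2 ^ ℓ) (hℓ : ℓ ≤ Nat.log 2 B + 1)
    (hp : s.pos ≤ x.length + 1) :
    ∃ ℓ' ≤ Nat.log 2 B + 1, (∀ r < K, s'.reg r < 2 ^ ℓ') ∧ s'.pos ≤ x.length + 1 ∧
      (P.comp K).Run x (Nat.log 2 B + 3) (P.comp K).start (s.mem K ℓ) () (s'.mem K ℓ') := by
  induction h generalizing ℓ with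
  | @inc r s h =>
    simp only [Prog.width] at hK
    have hS : ℓ + 1 < Nat.log 2 B + 3 := by omega
    set f : Bool → (Fin K → Bool) → Bool × (Fin K → Bool) :=
      fun σ d => (σ && getTrack d r, setTrack d r (xor σ (getTrack d r))) with hf
    set c := Comp.sweepState f true (digits K s.reg) with hc
    have hbit := fun i => testBit_add_one (s.reg r) i c rfl (fun i => by
      rw [hc, Comp.sweepState, ← hc, hf]
      simp only
      rw [getTrack_digits _ _ (by omega)])
    have run := Comp.run_sweep (f := f) (σ₀ := true) (ext := true) (x := x) (o := s.out)
      (digits_eq_false hr) hS hp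
    rw [← hc, Bool.true_and] at run
    have hlt := hr r (by omega)
    have hbit' := hbit ℓ
    rw [Nat.testBit_lt_two_pow hlt, Bool.xor_false] at hbit'
    have hmem : ∀ ℓ', tapeOf ℓ' (fun j => (f (c j) (digits K s.reg j)).2) =
        tapeOf ℓ' (digits K (Function.update s.reg r (s.reg r + 1))) := fun ℓ' => by
      refine tapeOf_congr fun i _ => ?_
      simp only [hf]
      refine setTrack_digits _ _ _ _ _ ?_
      rw [getTrack_digits _ _ (by omega), hbit]
    rw [hmem] at run
    -- The tape grows only if a carry leaves the last cell. Then bit `ℓ` of the new value is set, so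
    -- `2 ^ ℓ ≤ B`.
    have hℓ' : (if c ℓ then ℓ + 1 else ℓ) ≤ Nat.log 2 B + 1 := by
      cases hcl : c ℓ
      · simpa using hℓ
      · simp only [if_true]
        rw [hcl] at hbit'
        have := Nat.ge_two_pow_of_testBit hbit'
        have := (Nat.le_log_iff_pow_le (b := 2) (by omega) (by omega)).2 (this.trans h)
        omega
    refine ⟨if c ℓ then ℓ + 1 else ℓ, hℓ', ?_, hp, Comp.Run.bind run
      (run_skip (s := ⟨Function.update s.reg r (s.reg r + 1), s.pos, s.out⟩) () (by omega) hp)⟩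
    cases hcl : c ℓ
    · simp only [Bool.false_eq_true, if_false]
      -- Without a final carry the new value cannot be `2 ^ ℓ`, since its bit `ℓ` is zero.
      refine lt_of_update hr (lt_of_le_of_ne hlt fun he => ?_)
      rw [hcl, he] at hbit'
      simp [Nat.testBit_two_pow_self] at hbit'
    · simp only [if_true]
      refine lt_of_update (fun t ht => (hr t ht).trans ?_) ?_ <;> rw [pow_succ] <;> omega
  | @clear r s =>
    simp only [Prog.width] at hK
    have hS : ℓ + 1 < Nat.log 2 B + 3 := by omega
    have run := Comp.run_sweep (f := fun _ d => (false, setTrack d r false)) (σ₀ := false)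
      (ext := false) (x := x) (o := s.out) (digits_eq_false hr) hS hp
    rw [tapeOf_congr (D' := digits K (Function.update s.reg r 0))
      (fun i _ => setTrack_digits _ _ _ _ _ (by simp))] at run
    exact ⟨ℓ, hℓ, lt_of_update hr (by positivity), hp, Comp.Run.bind run
      (run_skip (s := ⟨Function.update s.reg r 0, s.pos, s.out⟩) () hS hp)⟩
  | @copy r t s =>
    simp only [Prog.width] at hK
    have hS : ℓ + 1 < Nat.log 2 B + 3 := by omega
    have run := Comp.run_sweep (f := fun _ d => (false, setTrack d r (getTrack d t)))
      (σ₀ := false) (ext := false) (x := x) (o := s.out) (digits_eq_false hr) hS hp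
    rw [tapeOf_congr (D' := digits K (Function.update s.reg r (s.reg t)))
      (fun i _ => setTrack_digits _ _ _ _ _ (by rw [getTrack_digits _ _ (by omega)]))] at run
    exact ⟨ℓ, hℓ, lt_of_update hr (hr t (by omega)), hp,
      Comp.Run.bind run
        (run_skip (s := ⟨Function.update s.reg r (s.reg t), s.pos, s.out⟩) () hS hp)⟩
  | @emit b s =>
    refine ⟨ℓ, hℓ, hr, hp, ?_⟩
    exact Comp.run_atom _ none (some b) (by simp [PState.mem]) (by simp [PState.mem, moveHead, hp])
  | @home s =>
    exact ⟨ℓ, hℓ, hr, by simp, Comp.run_rewind (c := s.mem K ℓ) (by simp [PState.mem]) hp⟩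
  | @right s =>
    refine ⟨ℓ, hℓ, hr, by simp, ?_⟩
    exact Comp.run_atom _ (some .right) none (by simp [PState.mem]) (by simp [PState.mem, moveHead])
  | seq _ _ ih₁ ih₂ =>
    simp only [Prog.width, max_le_iff] at hK
    obtain ⟨ℓ₁, h₁, hr₁, hp₁, run₁⟩ := ih₁ hK.1 ℓ hr hℓ hp
    obtain ⟨ℓ₂, h₂, hr₂, hp₂, run₂⟩ := ih₂ hK.2 ℓ₁ hr₁ h₁ hp₁
    exact ⟨ℓ₂, h₂, hr₂, hp₂, run₁.bind run₂⟩
  | iteTrue hT _ ih =>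
    simp only [Prog.width, max_le_iff] at hK
    obtain ⟨b, hb, runT⟩ := Test.run_comp _ hK.1 hr (show ℓ + 1 < Nat.log 2 B + 3 by omega) hp
    obtain ⟨ℓ₁, h₁, hr₁, hp₁, run₁⟩ := ih hK.2.1 ℓ hr hℓ hp
    obtain rfl := hb.2 hT
    exact ⟨ℓ₁, h₁, hr₁, hp₁, runT.bind run₁⟩
  | iteFalse hT _ ih =>
    simp only [Prog.width, max_le_iff] at hK
    obtain ⟨b, hb, runT⟩ := Test.run_comp _ hK.1 hr (show ℓ + 1 < Nat.log 2 B + 3 by omega) hp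
    obtain ⟨ℓ₁, h₁, hr₁, hp₁, run₁⟩ := ih hK.2.2 ℓ hr hℓ hp
    obtain rfl : b = false := by simpa using mt hb.1 hT
    exact ⟨ℓ₁, h₁, hr₁, hp₁, runT.bind run₁⟩
  | loopDone hT =>
    simp only [Prog.width, max_le_iff] at hK
    have hS : ℓ + 1 < Nat.log 2 B + 3 := by omega
    obtain ⟨b, hb, runT⟩ := Test.run_comp _ hK.1 hr hS hp
    obtain rfl := hb.2 hT
    exact ⟨ℓ, hℓ, hr, hp, (runT.bind (run_skip (some ()) hS hp)).iter_some⟩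
  | loopStep hT _ _ ih₁ ih₂ =>
    have hK' := hK
    simp only [Prog.width, max_le_iff] at hK
    have hS : ℓ + 1 < Nat.log 2 B + 3 := by omega
    obtain ⟨b, hb, runT⟩ := Test.run_comp _ hK.1 hr hS hp
    obtain ⟨ℓ₁, h₁, hr₁, hp₁, run₁⟩ := ih₁ hK.2 ℓ hr hℓ hp
    obtain ⟨ℓ₂, h₂, hr₂, hp₂, run₂⟩ := ih₂ hK' ℓ₁ hr₁ h₁ hp₁
    obtain rfl : b = false := by simpa using mt hb.1 hT
    exact ⟨ℓ₂, h₂, hr₂, hp₂, (runT.bind (run₁.bind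
      (run_skip none (by omega) hp₁))).iter_none run₂⟩

/-- The component that marks the left end of the work tape. -/
def markLeft (K : ℕ) : Comp (Sym K) Unit where
  Q := Unit
  finQ := inferInstance
  start := ()
  δ _ _ _ := ⟨.inr (), none, some none, none, none⟩

/-- The initial state of a program. -/
def PState.init : PState := ⟨fun _ => 0, 0, []⟩

/-- The machine that runs a program and then accepts if registers `r` and `t` agree. -/
def Prog.machine (P : Prog) (r t : ℕ) : Machine :=
  let K := max P.width (max r t + 1)
  ((markLeft K).bind fun _ => (P.comp K).bind fun _ => (Test.eq r t).comp K).toMachine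
    inferInstance none

theorem Exec.machine {x : List Bool} {B : ℕ} {P : Prog} {s : PState}
    (h : Exec x B P .init s) (r t : ℕ) :
    (P.machine r t).SpaceAtMost x (Nat.log 2 B + 3) ∧ ∃ f, (P.machine r t).HaltsAt x f ∧
      f.out = s.out ∧ (f.state ∈ (P.machine r t).accept ↔ s.reg r = s.reg t) := by
  set K := max P.width (max r t + 1) with hK
  obtain ⟨ℓ, hℓ, hr, hp, run⟩ := h.run_comp (K := K) (by omega) 0 (by simp [PState.init]) (by omega)
    (by simp [PState.init])
  obtain ⟨b, hb, runT⟩ := Test.run_comp (x := x) (.eq r t) (K := K) (by simp [Test.width, hK]) hr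
    (show ℓ + 1 < Nat.log 2 B + 3 by omega) hp
  have hm : (markLeft K).Run x (Nat.log 2 B + 3) () ⟨0, fun _ => none, 0, []⟩ ()
      (PState.init.mem K 0) := by
    refine .exit_of (by simp) rfl ?_
    simp only [Comp.after, Comp.action, markLeft, PState.mem, moveHead, PState.init,
      MemCfg.mk.injEq]
    refine ⟨by simp, ?_, trivial, by simp⟩
    funext i
    cases i <;> simp [tapeOf]
  have hrun := hm.bind (D := fun _ => (P.comp K).bind fun _ => (Test.eq r t).comp K)
    (run.bind (D := fun _ => (Test.eq r t).comp K) runT)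
  obtain ⟨h₁, h₂⟩ := hrun.machine inferInstance none (by simp [PState.mem])
  refine ⟨h₁, _, h₂, rfl, ?_⟩
  rw [← Test.Holds.eq_1 x, ← hb]
  show (Sum.inr b : _ ⊕ Bool) ∈ ({.inr true} : Set _) ↔ _
  simp

/-! ### Functions computable in logarithmic space -/

/-- Data that consist of an input string and finitely many numbers. -/
class Ctx (α : Type) where
  inp : α → List Bool
  arity : ℕ
  var : α → ℕ → ℕ

instance : Ctx (List Bool) := ⟨id, 0, fun _ _ => 0⟩

/-- The most recently added number has index `0`, as with de Bruijn indices. -/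
instance {α : Type} [Ctx α] : Ctx (α × ℕ) where
  inp a := Ctx.inp a.1
  arity := Ctx.arity α + 1
  var a
    | 0 => a.2
    | i + 1 => Ctx.var a.1 i

open Ctx

variable {α : Type} [Ctx α]

/-- `B` bounds the length of the input and the numbers. -/
structure Fit (a : α) (B : ℕ) : Prop where
  two_le : 2 ≤ B
  length_le : (inp a).length ≤ B
  var_le : ∀ i < arity α, var a i ≤ B

/-- Intermediate values are only bounded by a power of `B`. Raising the bound makes room to append
them to the context, and composed bounds stay polynomial. -/
theorem Fit.pow {a : α} {B : ℕ} (h : Fit a B) (c : ℕ) : Fit a (B ^ (c + 1)) := by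
  have : B ≤ B ^ (c + 1) := Nat.le_self_pow (by omega) B
  exact ⟨h.two_le.trans this, h.length_le.trans this, fun i hi => (h.var_le i hi).trans this⟩

theorem Fit.cons {a : α} {B v : ℕ} (h : Fit a B) (hv : v ≤ B) : Fit (a, v) B := by
  refine ⟨h.two_le, h.length_le, fun i hi => ?_⟩
  cases i with
  | zero => exact hv
  | succ i => exact h.var_le i (Nat.lt_of_succ_lt_succ hi)

theorem pow_le_pow_of_fit {a : α} {B c c' : ℕ} (h : Fit a B) (hc : c ≤ c') : B ^ c ≤ B ^ c' :=
  Nat.pow_le_pow_right (by have := h.two_le; omega) hc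

/-- The values are bounded by a polynomial in the length of the input and the numbers. -/
def PolyBounded (f : α → ℕ) : Prop := ∃ c, ∀ a B, Fit a B → f a ≤ B ^ c

/-- The registers `ρ i` hold the numbers of `a`. -/
def Holds (ρ : ℕ → ℕ) (a : α) (s : PState) : Prop := ∀ i < arity α, s.reg (ρ i) = var a i

/-- Registers below `m` are the same. -/
def Agree (m : ℕ) (s s' : PState) : Prop := ∀ r < m, s'.reg r = s.reg r

/-- Functions computable in logarithmic space, with polynomially bounded values: wherever the
arguments are stored, some program with polynomially bounded registers computes the value into
register `m` without changing the registers below. -/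
structure LS (f : α → ℕ) : Prop where
  bounded : PolyBounded f
  prog : ∀ (ρ : ℕ → ℕ) (m : ℕ), (∀ i < arity α, ρ i < m) → ∃ (P : Prog) (c : ℕ),
    ∀ (a : α) (s : PState) (B : ℕ), Fit a B → Holds ρ a s →
      ∃ s', Exec (inp a) (B ^ c) P s s' ∧ s'.reg m = f a ∧ Agree m s s' ∧ s'.out = s.out

/-- String functions computable in logarithmic space. -/
def Emits (F : α → List Bool) : Prop :=
  ∀ (ρ : ℕ → ℕ) (m : ℕ), (∀ i < arity α, ρ i < m) → ∃ (P : Prog) (c : ℕ),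
    ∀ (a : α) (s : PState) (B : ℕ), Fit a B → Holds ρ a s →
      ∃ s', Exec (inp a) (B ^ c) P s s' ∧ Agree m s s' ∧ s'.out = s.out ++ F a

theorem Agree.trans {m m' : ℕ} {s₁ s₂ s₃ : PState} (h : Agree m s₁ s₂) (h' : Agree m' s₂ s₃)
    (hm : m ≤ m') : Agree m s₁ s₃ := fun r hr => (h' r (hr.trans_le hm)).trans (h r hr)

theorem Holds.of_agree {ρ : ℕ → ℕ} {a : α} {s s' : PState} {m : ℕ} (h : Holds ρ a s)
    (hs : Agree m s s') (hρ : ∀ i < arity α, ρ i < m) : Holds ρ a s' :=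
  fun i hi => (hs _ (hρ i hi)).trans (h i hi)

/-- Locations of the numbers of `(a, v)` from those of `a` and of `v`. -/
def consLoc (r : ℕ) (ρ : ℕ → ℕ) : ℕ → ℕ
  | 0 => r
  | i + 1 => ρ i

theorem consLoc_lt {r m m' : ℕ} {ρ : ℕ → ℕ} (hρ : ∀ i < arity α, ρ i < m) (hr : r < m')
    (hm : m ≤ m') : ∀ i < arity (α × ℕ), consLoc r ρ i < m' := by
  intro i hi
  cases i with
  | zero => exact hr
  | succ i => exact (hρ i (Nat.lt_of_succ_lt_succ hi)).trans_le hm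

theorem Holds.cons {ρ : ℕ → ℕ} {a : α} {s : PState} {r v : ℕ} (h : Holds ρ a s)
    (hv : s.reg r = v) : Holds (consLoc r ρ) (a, v) s := by
  intro i hi
  cases i with
  | zero => exact hv
  | succ i => exact h i (Nat.lt_of_succ_lt_succ hi)

/-- The rule for counting loops, by induction on the number of remaining rounds. The invariant has
to fix both the counter `r` and the limit `n`, as the loop ends by comparing them. -/
theorem exec_for {x : List Bool} {B r n N : ℕ} {P : Prog} (I : ℕ → PState → Prop)
    (hI : ∀ t s, I t s → s.reg r = t ∧ s.reg n = N)
    (hstep : ∀ t < N, ∀ s, I t s → ∃ s', Exec x B P s s' ∧ I (t + 1) s') {s : PState} (h : I 0 s) :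
    ∃ s', Exec x B (.loop (.eq r n) P) s s' ∧ I N s' := by
  suffices key : ∀ d t s, t + d = N → I t s →
      ∃ s', Exec x B (.loop (.eq r n) P) s s' ∧ I N s' from key N 0 s (by omega) h
  intro d
  induction d with
  | zero =>
    intro t s ht h
    obtain rfl : t = N := by omega
    exact ⟨s, .loopDone (by simp [Test.Holds, hI _ _ h]), h⟩
  | succ d ih =>
    intro t s ht h
    obtain ⟨s₁, h₁, h₁'⟩ := hstep t (by omega) s h
    obtain ⟨s₂, h₂, h₂'⟩ := ih (t + 1) s₁ (by omega) h₁'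
    refine ⟨s₂, .loopStep ?_ h₁ h₂, h₂'⟩
    simp only [Test.Holds, hI _ _ h]
    omega

namespace LS

theorem snd : LS (fun a : α × ℕ => a.2) := by
  refine ⟨⟨1, fun a B h => ?_⟩, fun ρ m hρ => ⟨.copy m (ρ 0), 0, fun a s B h hs => ?_⟩⟩
  · rw [pow_one]
    exact h.var_le 0 (Nat.succ_pos _)
  · refine ⟨_, .copy, ?_, fun r hr => ?_, rfl⟩
    · simp only [Function.update_self]
      exact hs 0 (Nat.succ_pos _)
    · simp [Function.update_of_ne hr.ne]

/-- Projection to some of the numbers. -/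
theorem rename {β : Type} [Ctx β] {f : α → ℕ} (hf : LS f) (π : β → α) (r : ℕ → ℕ)
    (hi : ∀ b, inp (π b) = inp b) (hr : ∀ i < arity α, r i < arity β)
    (hv : ∀ b, ∀ i < arity α, var (π b) i = var b (r i)) : LS (fun b => f (π b)) := by
  have hfit : ∀ {b : β} {B}, Fit b B → Fit (π b) B := fun {b B} h =>
    ⟨h.two_le, by rw [hi]; exact h.length_le, fun i hi => by
      rw [hv b i hi]
      exact h.var_le _ (hr i hi)⟩
  refine ⟨hf.bounded.imp fun c hc a B h => hc (π a) B (hfit h), fun ρ m hρ => ?_⟩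
  obtain ⟨P, c, hP⟩ := hf.prog (fun i => ρ (r i)) m fun i hi => hρ _ (hr i hi)
  refine ⟨P, c, fun b s B h hs => ?_⟩
  rw [← hi]
  exact hP (π b) s B (hfit h) fun i hi => (hs (r i) (hr i hi)).trans (hv b i hi).symm

theorem weaken {f : α → ℕ} (hf : LS f) : LS (fun a : α × ℕ => f a.1) :=
  hf.rename (fun a : α × ℕ => a.1) (· + 1) (fun _ => rfl) (fun _ hi => Nat.succ_lt_succ hi)
    fun _ _ _ => rfl

/-- Weakening below the last number. -/
theorem weaken_snd {f : α × ℕ → ℕ} (hf : LS f) : LS (fun a : (α × ℕ) × ℕ => f (a.1.1, a.2)) :=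
  hf.rename (fun a : (α × ℕ) × ℕ => (a.1.1, a.2)) (fun | 0 => 0 | i + 1 => i + 2) (fun _ => rfl)
    (fun i hi => by
      cases i with
      | zero => exact Nat.succ_pos _
      | succ i => exact Nat.succ_lt_succ hi)
    fun _ i _ => by cases i <;> rfl

theorem zero : LS (fun _ : α => 0) := by
  refine ⟨⟨0, fun _ _ _ => Nat.zero_le _⟩, fun ρ m _ => ⟨.clear m, 0, fun a s B _ _ => ?_⟩⟩
  refine ⟨_, .clear, by simp, fun r hr => ?_, rfl⟩
  simp [Function.update_of_ne hr.ne]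

theorem _root_.LatinIsotopy.PolyBounded.succ {f : α → ℕ} (hf : PolyBounded f) :
    PolyBounded (fun a => f a + 1) := by
  obtain ⟨c, hc⟩ := hf
  refine ⟨c + 1, fun a B h => ?_⟩
  have h1 := hc a B h
  have h2 := h.two_le
  have h3 : 0 < B ^ c := by positivity
  rw [pow_succ]
  nlinarith

theorem succ {f : α → ℕ} (hf : LS f) : LS (fun a => f a + 1) := by
  refine ⟨hf.bounded.succ, fun ρ m hρ => ?_⟩
  obtain ⟨c', hc'⟩ := hf.bounded.succ
  obtain ⟨P, c, hP⟩ := hf.prog ρ m hρ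
  refine ⟨.seq P (.inc m), max c c', fun a s B h hs => ?_⟩
  obtain ⟨s₁, h₁, hv, hA, ho⟩ := hP a s B h hs
  refine ⟨_, .seq (h₁.mono (pow_le_pow_of_fit h (le_max_left _ _))) (.inc ?_), ?_, ?_, ?_⟩
  · rw [hv]
    exact (hc' a B h).trans (pow_le_pow_of_fit h (le_max_right _ _))
  · simp [hv]
  · intro r hr
    simpa [Function.update_of_ne hr.ne] using hA r hr
  · exact ho

theorem const (n : ℕ) : LS (fun _ : α => n) := by
  induction n with
  | zero => exact zero
  | succ n ih => exact ih.succ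

theorem comp {f : α × ℕ → ℕ} {g : α → ℕ} (hf : LS f) (hg : LS g) : LS (fun a => f (a, g a)) := by
  obtain ⟨cg, hcg⟩ := hg.bounded
  have hfit : ∀ {a B}, Fit a B → Fit (a, g a) (B ^ (cg + 1)) := fun {a B} h =>
    (h.pow cg).cons ((hcg a B h).trans (pow_le_pow_of_fit h (by omega)))
  refine ⟨?_, fun ρ m hρ => ?_⟩
  · obtain ⟨cf, hcf⟩ := hf.bounded
    refine ⟨(cg + 1) * cf, fun a B h => ?_⟩
    rw [pow_mul]
    exact hcf _ _ (hfit h)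
  · obtain ⟨P, c, hP⟩ := hg.prog ρ m hρ
    obtain ⟨P', c', hP'⟩ := hf.prog (consLoc m ρ) (m + 1) (consLoc_lt hρ (by omega) (by omega))
    refine ⟨.seq P (.seq P' (.copy m (m + 1))), max c ((cg + 1) * c'), fun a s B h hs => ?_⟩
    obtain ⟨s₁, h₁, hv, hA, ho⟩ := hP a s B h hs
    obtain ⟨s₂, h₂, hv', hA', ho'⟩ := hP' (a, g a) s₁ _ (hfit h) ((hs.of_agree hA hρ).cons hv)
    rw [← pow_mul] at h₂
    refine ⟨_, .seq (h₁.mono (pow_le_pow_of_fit h (le_max_left _ _)))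
      (.seq (h₂.mono (pow_le_pow_of_fit h (le_max_right _ _))) .copy), ?_, ?_, ?_⟩
    · simp [hv']
    · intro r hr
      simpa [Function.update_of_ne hr.ne] using hA.trans hA' (by omega) r hr
    · exact ho'.trans ho

theorem ite_eq {f g h k : α → ℕ} (hf : LS f) (hg : LS g) (hh : LS h) (hk : LS k) :
    LS (fun a => if f a = g a then h a else k a) := by
  refine ⟨?_, fun ρ m hρ => ?_⟩
  · obtain ⟨c, hc⟩ := hh.bounded
    obtain ⟨c', hc'⟩ := hk.bounded
    refine ⟨max c c', fun a B H => ?_⟩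
    dsimp only
    split
    · exact (hc a B H).trans (pow_le_pow_of_fit H (le_max_left _ _))
    · exact (hc' a B H).trans (pow_le_pow_of_fit H (le_max_right _ _))
  · obtain ⟨P₁, c₁, hP₁⟩ := hf.prog ρ m hρ
    obtain ⟨P₂, c₂, hP₂⟩ := hg.prog ρ (m + 1) fun i hi => (hρ i hi).trans (by omega)
    obtain ⟨P₃, c₃, hP₃⟩ := hh.prog ρ m hρ
    obtain ⟨P₄, c₄, hP₄⟩ := hk.prog ρ m hρ
    refine ⟨.seq P₁ (.seq P₂ (.ite (.eq m (m + 1)) P₃ P₄)), max (max c₁ c₂) (max c₃ c₄),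
      fun a s B H hs => ?_⟩
    obtain ⟨s₁, e₁, hv₁, hA₁, ho₁⟩ := hP₁ a s B H hs
    obtain ⟨s₂, e₂, hv₂, hA₂, ho₂⟩ := hP₂ a s₁ B H (hs.of_agree hA₁ hρ)
    have hA := hA₁.trans hA₂ (by omega)
    have hs₂ := hs.of_agree hA hρ
    have hm : s₂.reg m = f a := (hA₂ m (by omega)).trans hv₁
    obtain ⟨s₃, e₃, hv₃, hA₃, ho₃⟩ := hP₃ a s₂ B H hs₂
    obtain ⟨s₄, e₄, hv₄, hA₄, ho₄⟩ := hP₄ a s₂ B H hs₂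
    by_cases hfg : f a = g a
    · refine ⟨s₃, .seq (e₁.mono (pow_le_pow_of_fit H (by omega)))
        (.seq (e₂.mono (pow_le_pow_of_fit H (by omega)))
        (.iteTrue ?_ (e₃.mono (pow_le_pow_of_fit H (by omega))))), ?_, hA.trans hA₃ le_rfl, ?_⟩
      · rw [Test.Holds, hm, hv₂, hfg]
      · simp [hfg, hv₃]
      · rw [ho₃, ho₂, ho₁]
    · refine ⟨s₄, .seq (e₁.mono (pow_le_pow_of_fit H (by omega)))
        (.seq (e₂.mono (pow_le_pow_of_fit H (by omega)))
        (.iteFalse ?_ (e₄.mono (pow_le_pow_of_fit H (by omega))))), ?_, hA.trans hA₄ le_rfl, ?_⟩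
      · rwa [Test.Holds, hm, hv₂]
      · simp [hfg, hv₄]
      · rw [ho₄, ho₂, ho₁]

/-- Bounded recursion. -/
theorem recursion {f g : α → ℕ} {h : (α × ℕ) × ℕ → ℕ} (hf : LS f) (hg : LS g) (hh : LS h)
    {F : α → ℕ → ℕ} (F0 : ∀ a, F a 0 = f a) (Fs : ∀ a t, F a (t + 1) = h ((a, t), F a t))
    (hF : ∃ c, ∀ a B, Fit a B → ∀ t ≤ g a, F a t ≤ B ^ c) : LS (fun a => F a (g a)) := by
  obtain ⟨cF, hcF⟩ := hF
  obtain ⟨cg, hcg⟩ := hg.bounded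
  refine ⟨⟨cF, fun a B H => hcF a B H _ le_rfl⟩, fun ρ m hρ => ?_⟩
  obtain ⟨P₁, c₁, hP₁⟩ := hg.prog ρ m hρ
  obtain ⟨P₂, c₂, hP₂⟩ := hf.prog ρ (m + 1) fun i hi => (hρ i hi).trans (by omega)
  obtain ⟨P₃, c₃, hP₃⟩ := hh.prog (consLoc (m + 1) (consLoc (m + 2) ρ)) (m + 3)
    (consLoc_lt (consLoc_lt hρ (show m + 2 < m + 3 by omega) (by omega)) (by omega) le_rfl)
  set C := max (max c₁ c₂) (max ((cF + cg + 1) * c₃) cg) with hC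
  -- Register `m` holds the number of rounds, `m + 1` the current value, `m + 2` the counter, and `m
  -- + 3` receives the next value. Registers from `m + 3` on are free for the step.
  refine ⟨.seq P₁ (.seq P₂ (.seq (.clear (m + 2)) (.seq (.loop (.eq (m + 2) m)
    (.seq P₃ (.seq (.copy (m + 1) (m + 3)) (.inc (m + 2))))) (.copy m (m + 1))))), C,
    fun a s B H hs => ?_⟩
  have hle : ∀ {c}, c ≤ C → B ^ c ≤ B ^ C := fun hc => pow_le_pow_of_fit H hc
  obtain ⟨s₁, e₁, hv₁, hA₁, ho₁⟩ := hP₁ a s B H hs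
  obtain ⟨s₂, e₂, hv₂, hA₂, ho₂⟩ := hP₂ a s₁ B H (hs.of_agree hA₁ hρ)
  have hA := hA₁.trans hA₂ (by omega)
  obtain ⟨s₃, e₃, h₃⟩ := exec_for (x := inp a) (B := B ^ C) (r := m + 2) (n := m) (N := g a)
    (P := .seq P₃ (.seq (.copy (m + 1) (m + 3)) (.inc (m + 2))))
    (fun t u => (t ≤ g a ∧ u.reg (m + 1) = F a t ∧ Agree m s u ∧ u.out = s.out) ∧
      u.reg (m + 2) = t ∧ u.reg m = g a)
    (fun t u hu => hu.2)
    (by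
      rintro t ht u ⟨⟨-, hu, hAu, hou⟩, hut, hum⟩
      have hfit : Fit ((a, t), F a t) (B ^ (cF + cg + 1)) :=
        ((H.pow (cF + cg)).cons (ht.le.trans ((hcg a B H).trans
          (pow_le_pow_of_fit H (by omega))))).cons
          ((hcF a B H t ht.le).trans (pow_le_pow_of_fit H (by omega)))
      obtain ⟨s', e', hv', hA', ho'⟩ := hP₃ ((a, t), F a t) u _ hfit
        (((hs.of_agree hAu hρ).cons hut).cons hu)
      rw [← pow_mul] at e'
      refine ⟨_, .seq (e'.mono (hle (by omega))) (.seq .copy (.inc ?_)), ⟨?_, ?_, ?_, ?_⟩, ?_, ?_⟩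
      · simp only
        rw [Function.update_of_ne (by omega), hA' (m + 2) (by omega), hut]
        exact (Nat.succ_le_of_lt ht).trans ((hcg a B H).trans (hle (by omega)))
      · exact ht
      · simp [hv', Fs]
      · intro r hr
        simp only
        rw [Function.update_of_ne (by omega), Function.update_of_ne (by omega),
          hA' r (by omega), hAu r hr]
      · exact ho'.trans hou
      · simp only [Function.update_self]
        rw [Function.update_of_ne (by omega), hA' (m + 2) (by omega), hut]
      · simp only
        rw [Function.update_of_ne (by omega), Function.update_of_ne (by omega),
          hA' m (by omega), hum])
    (s := { s₂ with reg := Function.update s₂.reg (m + 2) 0 })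
    (by
      refine ⟨⟨Nat.zero_le _, ?_, ?_, ho₂.trans ho₁⟩, by simp, ?_⟩
      · simp only
        rw [Function.update_of_ne (by omega), hv₂, F0]
      · intro r hr
        simp only
        rw [Function.update_of_ne (by omega), hA r hr]
      · simp only
        rw [Function.update_of_ne (by omega), hA₂ m (by omega), hv₁])
  obtain ⟨⟨-, hu, hAu, hou⟩, -, -⟩ := h₃
  refine ⟨_, .seq (e₁.mono (hle (by omega))) (.seq (e₂.mono (hle (by omega)))
    (.seq .clear (.seq e₃ .copy))), ?_, ?_, hou⟩
  · simp [hu]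
  · intro r hr
    simp only
    rw [Function.update_of_ne hr.ne, hAu r hr]

theorem length : LS (fun a : α => (inp a).length) := by
  refine ⟨⟨1, fun a B h => by simpa using h.length_le⟩, fun ρ m hρ => ?_⟩
  refine ⟨.seq .home (.seq .right (.seq (.clear m) (.loop .isEnd (.seq .right (.inc m))))), 1,
    fun a s B H hs => ?_⟩
  have key : ∀ d t (u : PState), t + d = (inp a).length → u.pos = t + 1 → u.reg m = t →
      ∃ u', Exec (inp a) (B ^ 1) (.loop .isEnd (.seq .right (.inc m))) u u' ∧
        u'.reg m = (inp a).length ∧ Agree m u u' ∧ u'.out = u.out := by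
    intro d
    induction d with
    | zero =>
      intro t u ht hp hm
      refine ⟨u, .loopDone ?_, by omega, fun _ _ => rfl, rfl⟩
      simp [Test.Holds, hp, inSym, show ¬ t < (inp a).length by omega]
    | succ d ih =>
      intro t u ht hp hm
      obtain ⟨u', e', hv, hA, ho⟩ := ih (t + 1)
        ⟨Function.update u.reg m (t + 1), t + 2, u.out⟩ (by omega) rfl (by simp)
      have e₁ : Exec (inp a) (B ^ 1) (.seq .right (.inc m)) u
          ⟨Function.update u.reg m (t + 1), t + 2, u.out⟩ := by
        have := Exec.seq (Exec.right (x := inp a) (B := B ^ 1) (s := u))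
          (Exec.inc (r := m) (by simp only [hm, pow_one]; have := H.length_le; omega))
        convert this using 2
        · rw [hm]
        · simp only [hp]
          omega
      refine ⟨u', .loopStep ?_ e₁ e', hv, fun r hr => ?_, ho⟩
      · simp [Test.Holds, hp, inSym, show t < (inp a).length by omega]
      · rw [hA r hr]
        exact Function.update_of_ne hr.ne _ _
  obtain ⟨u, e, hv, hA, ho⟩ := key _ 0 ⟨Function.update s.reg m 0, 1, s.out⟩ (Nat.zero_add _) rfl
    (by simp)
  refine ⟨u, .seq .home (.seq .right (.seq .clear ?_)), hv, fun r hr => ?_, ho⟩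
  · convert e using 2
    simp
  · rw [hA r hr]
    exact Function.update_of_ne hr.ne _ _

theorem bit {f : α → ℕ} (hf : LS f) : LS (fun a => ((inp a).getD (f a) false).toNat) := by
  refine ⟨⟨0, fun a B h => ?_⟩, fun ρ m hρ => ?_⟩
  · simp only [pow_zero]
    exact Bool.toNat_le _
  obtain ⟨cf, hcf⟩ := hf.bounded
  obtain ⟨P, c, hP⟩ := hf.prog ρ m hρ
  -- The final `.home` is a no-op for the result: register `m` has just been cleared, which is the
  -- value of a zero bit.
  refine ⟨.seq P (.seq .home (.seq .right (.seq (.clear (m + 1)) (.seq (.loop (.eq (m + 1) m)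
    (.seq .right (.inc (m + 1)))) (.seq (.clear m) (.ite .isOne (.inc m) .home)))))), max c cf,
    fun a s B H hs => ?_⟩
  obtain ⟨s₁, e₁, hv₁, hA₁, ho₁⟩ := hP a s B H hs
  obtain ⟨s₂, e₂, ⟨hp₂, hA₂, ho₂⟩, hr₂, hm₂⟩ := exec_for (x := inp a) (B := B ^ max c cf)
    (r := m + 1) (n := m) (N := f a) (P := .seq .right (.inc (m + 1)))
    (fun t u => (u.pos = min (t + 1) ((inp a).length + 1) ∧ Agree m s u ∧ u.out = s.out) ∧
      u.reg (m + 1) = t ∧ u.reg m = f a)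
    (fun t u hu => hu.2)
    (by
      rintro t ht u ⟨⟨hp, hA, ho⟩, hr, hm⟩
      refine ⟨_, .seq .right (.inc ?_), ⟨?_, ?_, ho⟩, ?_, ?_⟩
      · simp only [hr]
        exact (Nat.succ_le_of_lt ht).trans ((hcf a B H).trans (pow_le_pow_of_fit H (by omega)))
      · simp only [hp]; omega
      · intro r hr
        simp only
        rw [Function.update_of_ne (by omega), hA r hr]
      · simp [hr]
      · simp only
        rw [Function.update_of_ne (by omega), hm])
    (s := ⟨Function.update s₁.reg (m + 1) 0, min (0 + 1) ((inp a).length + 1), s₁.out⟩)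
    (by
      refine ⟨⟨rfl, ?_, ho₁⟩, by simp, ?_⟩
      · intro r hr
        simp only
        rw [Function.update_of_ne (by omega), hA₁ r hr]
      · simp only
        rw [Function.update_of_ne (by omega), hv₁])
  have e₁' := e₁.mono (pow_le_pow_of_fit H (le_max_left c cf))
  -- For an index beyond the input the head is stopped at the right marker, which agrees with the
  -- default value `false`.
  have hsym : inSym (inp a) s₂.pos = .bit true ↔ (inp a).getD (f a) false = true := by
    rw [hp₂]
    rcases lt_or_ge (f a) (inp a).length with h | h
    · rw [min_eq_left (by omega)]
      simp [inSym, h]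
    · rw [min_eq_right (by omega)]
      simp [inSym, h]
  have hfin : ∀ v, Agree m s ⟨Function.update s₂.reg m v, s₂.pos, s₂.out⟩ := by
    intro v r hr
    simp only
    rw [Function.update_of_ne hr.ne, hA₂ r hr]
  by_cases hb : (inp a).getD (f a) false = true
  · refine ⟨_, .seq e₁' (.seq .home (.seq .right (.seq .clear (.seq e₂ (.seq .clear
      (.iteTrue (hsym.2 hb) (.inc ?_))))))), ?_, ?_, ho₂⟩
    · simp only [Function.update_self]
      exact Nat.one_le_pow _ _ (by have := H.two_le; omega)
    · simp only [Function.update_self, hb, Bool.toNat_true]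
    · simpa using hfin _
  · refine ⟨_, .seq e₁' (.seq .home (.seq .right (.seq .clear (.seq e₂ (.seq .clear
      (.iteFalse (mt hsym.1 hb) .home)))))), ?_, ?_, ho₂⟩
    · simp only [Function.update_self, Bool.not_eq_true _ ▸ hb, Bool.toNat_false]
    · exact hfin _

end LS

/-! ### Arithmetic, predicates and bounded quantifiers in logarithmic space. -/

open Ctx

variable {α : Type} [Ctx α]

open Classical in
/-- The indicator of a proposition. -/
noncomputable def ind (p : Prop) : ℕ := if p then 1 else 0

theorem ind_le_one (p : Prop) : ind p ≤ 1 := by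
  unfold ind
  split <;> simp

theorem ind_eq_one {p : Prop} : ind p = 1 ↔ p := by
  unfold ind
  split <;> simp_all

/-- Predicates decidable in logarithmic space. -/
def LSP (p : α → Prop) : Prop := LS (fun a => ind (p a))

theorem LS.congr {f g : α → ℕ} (hf : LS f) (h : ∀ a, f a = g a) : LS g :=
  (funext h : f = g) ▸ hf

theorem LSP.congr {p q : α → Prop} (hp : LSP p) (h : ∀ a, p a ↔ q a) : LSP q :=
  (funext fun a => propext (h a) : p = q) ▸ hp

namespace LS

/-- Recursion with values below a polynomially bounded function. -/
theorem recursion_le {f g : α → ℕ} {h : (α × ℕ) × ℕ → ℕ} (hf : LS f) (hg : LS g) (hh : LS h)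
    {F : α → ℕ → ℕ} (F0 : ∀ a, F a 0 = f a) (Fs : ∀ a t, F a (t + 1) = h ((a, t), F a t))
    {q : α → ℕ} (hq : PolyBounded q) (hF : ∀ a, ∀ t ≤ g a, F a t ≤ q a) :
    LS (fun a => F a (g a)) :=
  recursion hf hg hh F0 Fs (hq.imp fun _ hc a B H t ht => (hF a t ht).trans (hc a B H))

theorem pred {f : α → ℕ} (hf : LS f) : LS (fun a => f a - 1) :=
  recursion_le (F := fun _ t => t - 1) zero hf snd.weaken (fun _ => rfl) (fun _ _ => rfl)
    hf.bounded fun a t ht => by omega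

theorem sub {f g : α → ℕ} (hf : LS f) (hg : LS g) : LS (fun a => f a - g a) :=
  recursion_le (F := fun a t => f a - t) hf hg snd.pred (fun _ => rfl) (fun _ _ => rfl)
    hf.bounded fun a t _ => by omega

theorem _root_.LatinIsotopy.PolyBounded.add {f g : α → ℕ} (hf : PolyBounded f)
    (hg : PolyBounded g) : PolyBounded (fun a => f a + g a) := by
  obtain ⟨c, hc⟩ := hf
  obtain ⟨d, hd⟩ := hg
  refine ⟨max c d + 1, fun a B H => ?_⟩
  have h₁ := (hc a B H).trans (pow_le_pow_of_fit H (le_max_left c d))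
  have h₂ := (hd a B H).trans (pow_le_pow_of_fit H (le_max_right c d))
  have := H.two_le
  rw [pow_succ]
  nlinarith

theorem _root_.LatinIsotopy.PolyBounded.mul {f g : α → ℕ} (hf : PolyBounded f)
    (hg : PolyBounded g) : PolyBounded (fun a => f a * g a) := by
  obtain ⟨c, hc⟩ := hf
  obtain ⟨d, hd⟩ := hg
  refine ⟨c + d, fun a B H => ?_⟩
  rw [pow_add]
  exact Nat.mul_le_mul (hc a B H) (hd a B H)

theorem add {f g : α → ℕ} (hf : LS f) (hg : LS g) : LS (fun a => f a + g a) :=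
  recursion_le (F := fun a t => f a + t) hf hg snd.succ (fun _ => rfl) (fun _ _ => rfl)
    (hf.bounded.add hg.bounded) fun a t _ => by omega

theorem mul {f g : α → ℕ} (hf : LS f) (hg : LS g) : LS (fun a => f a * g a) :=
  recursion_le (F := fun a t => f a * t) zero hg (snd.add hf.weaken.weaken) (fun _ => rfl)
    (fun a t => by rw [Nat.mul_succ]) (hf.bounded.mul hg.bounded)
    fun a t ht => Nat.mul_le_mul le_rfl ht

theorem pow_const {f : α → ℕ} (hf : LS f) (n : ℕ) : LS (fun a => f a ^ n) := by
  induction n with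
  | zero => exact const 1
  | succ n ih => exact ih.mul hf

theorem ite {p : α → Prop} [∀ a, Decidable (p a)] {f g : α → ℕ} (hp : LSP p) (hf : LS f)
    (hg : LS g) : LS (fun a => if p a then f a else g a) :=
  (ite_eq hp (const 1) hf hg).congr fun a => by simp only [ind_eq_one]

end LS

namespace LSP

theorem eq {f g : α → ℕ} (hf : LS f) (hg : LS g) : LSP (fun a => f a = g a) :=
  (LS.ite_eq hf hg (LS.const 1) (LS.const 0)).congr fun a => by
    unfold ind
    split <;> rfl

theorem le {f g : α → ℕ} (hf : LS f) (hg : LS g) : LSP (fun a => f a ≤ g a) :=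
  (eq (hf.sub hg) (LS.const 0)).congr fun a => by omega

theorem lt {f g : α → ℕ} (hf : LS f) (hg : LS g) : LSP (fun a => f a < g a) :=
  le hf.succ hg

theorem not {p : α → Prop} (hp : LSP p) : LSP (fun a => ¬ p a) :=
  (eq hp (LS.const 0)).congr fun a => by
    unfold ind
    split <;> simp_all

theorem and {p q : α → Prop} (hp : LSP p) (hq : LSP q) : LSP (fun a => p a ∧ q a) :=
  (eq (hp.mul hq) (LS.const 1)).congr fun a => by
    rw [mul_eq_one, ind_eq_one, ind_eq_one]

theorem or {p q : α → Prop} (hp : LSP p) (hq : LSP q) : LSP (fun a => p a ∨ q a) :=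
  (hp.not.and hq.not).not.congr fun a => by tauto

theorem weaken {p : α → Prop} (hp : LSP p) : LSP (fun a : α × ℕ => p a.1) := LS.weaken hp

theorem weaken_snd {p : α × ℕ → Prop} (hp : LSP p) :
    LSP (fun a : (α × ℕ) × ℕ => p (a.1.1, a.2)) := LS.weaken_snd hp

theorem comp {p : α × ℕ → Prop} {g : α → ℕ} (hp : LSP p) (hg : LS g) : LSP (fun a => p (a, g a)) :=
  LS.comp hp hg

theorem const (p : Prop) : LSP (fun _ : α => p) := LS.const _

/-- Exhaustive search as a recursion whose value is a single bit, namely whether a witness has been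
met so far. -/
theorem ex {p : α × ℕ → Prop} {g : α → ℕ} (hp : LSP p) (hg : LS g) :
    LSP (fun a => ∃ t < g a, p (a, t)) := by
  classical
  refine LS.recursion_le (F := fun a n => ind (∃ t < n, p (a, t))) LS.zero hg
    (h := fun b => if p (b.1.1, b.1.2) then 1 else b.2)
    (LS.ite hp.weaken (LS.const 1) LS.snd) (fun a => ?_) (fun a t => ?_)
    (LS.const 1).bounded (fun a t _ => ind_le_one _)
  · simp [ind]
  · simp only [ind]
    by_cases h : p (a, t)
    · rw [if_pos ⟨t, by omega, h⟩, if_pos h]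
    · rw [if_neg h]
      congr 1
      refine propext ⟨?_, fun ⟨u, hu, hp⟩ => ⟨u, by omega, hp⟩⟩
      rintro ⟨u, hu, hp⟩
      rcases Nat.lt_succ_iff_lt_or_eq.1 hu with h' | rfl
      exacts [⟨u, h', hp⟩, absurd hp h]

theorem all {p : α × ℕ → Prop} {g : α → ℕ} (hp : LSP p) (hg : LS g) :
    LSP (fun a => ∀ t < g a, p (a, t)) :=
  (hp.not.ex hg).not.congr fun a => by simp

theorem bit {f : α → ℕ} (hf : LS f) : LSP (fun a => (inp a).getD (f a) false = true) :=
  (eq hf.bit (LS.const 1)).congr fun a => by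
    cases (inp a).getD (f a) false <;> simp

end LSP

namespace LS

/-- Bounded search yields division, logarithms and, later, the successor in a walk. -/
theorem findGreatest {p : α × ℕ → Prop} [∀ a, Decidable (p a)] {g : α → ℕ} (hp : LSP p)
    (hg : LS g) : LS (fun a => Nat.findGreatest (fun t => p (a, t)) (g a)) :=
  recursion_le (F := fun a n => Nat.findGreatest (fun t => p (a, t)) n)
    (h := fun b => if p (b.1.1, b.1.2 + 1) then b.1.2 + 1 else b.2) zero hg
    (ite (hp.weaken_snd.weaken_snd.comp snd.weaken.succ) snd.weaken.succ snd)
    (fun _ => rfl) (fun a t => by rw [Nat.findGreatest_succ]) hg.bounded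
    fun a t ht => (Nat.findGreatest_le t).trans ht

theorem div {f g : α → ℕ} (hf : LS f) (hg : LS g) : LS (fun a => f a / g a) := by
  refine (ite (LSP.eq hg (const 0)) zero (findGreatest
    (p := fun b : α × ℕ => b.2 * g b.1 ≤ f b.1) (LSP.le (snd.mul hg.weaken) hf.weaken) hf)).congr
    fun a => ?_
  by_cases h : g a = 0
  · simp [h]
  · rw [if_neg h, Nat.findGreatest_eq_iff]
    have hpos := Nat.pos_of_ne_zero h
    refine ⟨Nat.div_le_self _ _, fun _ => Nat.div_mul_le_self _ _, fun t ht _ => ?_⟩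
    rw [not_le, ← Nat.div_lt_iff_lt_mul hpos]
    exact ht

theorem mod {f g : α → ℕ} (hf : LS f) (hg : LS g) : LS (fun a => f a % g a) :=
  (hf.sub (hg.mul (hf.div hg))).congr fun a => by
    have := Nat.div_add_mod (f a) (g a)
    omega

/-- The power `2 ^ g a` need not be polynomially bounded, so it is never computed; the number is
halved `g a` times. -/
theorem div_two_pow {f g : α → ℕ} (hf : LS f) (hg : LS g) : LS (fun a => f a / 2 ^ g a) :=
  recursion_le (F := fun a t => f a / 2 ^ t) hf hg (snd.div (const 2)) (fun _ => by simp)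
    (fun a t => by rw [pow_succ, Nat.div_div_eq_div_mul]) hf.bounded
    fun _ _ _ => Nat.div_le_self _ _

/-- The logarithm is the least `t` with `(f a - 1) / 2 ^ t = 0`. Since the available search finds a
greatest number, it runs over `f a - t`. -/
theorem clog {f : α → ℕ} (hf : LS f) : LS (fun a => Nat.clog 2 (f a)) := by
  refine (hf.sub (findGreatest (p := fun b : α × ℕ => (f b.1 - 1) / 2 ^ (f b.1 - b.2) = 0)
    (LSP.eq ((hf.pred.weaken).div_two_pow (hf.weaken.sub snd)) (const 0)) hf)).congr fun a => ?_
  have hself : Nat.clog 2 (f a) ≤ f a := by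
    rw [Nat.clog_le_iff_le_pow (by omega)]
    exact Nat.lt_two_pow_self.le
  have key : ∀ t, (f a - 1) / 2 ^ t = 0 ↔ Nat.clog 2 (f a) ≤ t := by
    intro t
    rw [Nat.div_eq_zero_iff_lt (by positivity), Nat.clog_le_iff_le_pow (by omega)]
    have := Nat.one_le_two_pow (n := t)
    omega
  have : Nat.findGreatest (fun t => (f a - 1) / 2 ^ (f a - t) = 0) (f a) =
      f a - Nat.clog 2 (f a) := by
    rw [Nat.findGreatest_eq_iff]
    refine ⟨by omega, fun _ => ?_, fun t ht ht' => ?_⟩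
    · rw [key]; omega
    · rw [key]; omega
  simp only [this]
  omega

theorem log {f : α → ℕ} (hf : LS f) : LS (fun a => Nat.log 2 (f a)) := by
  refine (findGreatest (p := fun b : α × ℕ => 1 ≤ f b.1 / 2 ^ b.2)
    (LSP.le (const 1) (hf.weaken.div_two_pow snd)) hf).congr fun a => ?_
  rw [Nat.findGreatest_eq_iff]
  refine ⟨Nat.log_le_self _ _, fun h => ?_, fun t ht _ => ?_⟩
  · rw [Nat.le_div_iff_mul_le (by positivity), one_mul]
    exact Nat.pow_log_le_self 2 fun h0 => h (by simp [h0])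
  · rw [Nat.le_div_iff_mul_le (by positivity), one_mul, not_le]
    exact Nat.lt_pow_of_log_lt (by omega) ht

end LS

theorem LSP.testBit {f g : α → ℕ} (hf : LS f) (hg : LS g) :
    LSP (fun a => (f a).testBit (g a) = true) :=
  (LSP.eq ((hf.div_two_pow hg).mod (LS.const 2)) (LS.const 1)).congr fun a => by
    rw [Nat.testBit_eq_decide_div_mod_eq, decide_eq_true_iff]

/-! ### Strings computable in logarithmic space -/

namespace Emits

theorem congr {F G : α → List Bool} (hF : Emits F) (h : ∀ a, F a = G a) : Emits G :=
  (funext h : F = G) ▸ hF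

theorem bit (b : Bool) : Emits (fun _ : α => [b]) :=
  fun _ _ _ => ⟨.emit b, 0, fun _ _ _ _ _ => ⟨_, .emit, fun _ _ => rfl, rfl⟩⟩

theorem append {F G : α → List Bool} (hF : Emits F) (hG : Emits G) :
    Emits (fun a => F a ++ G a) := by
  intro ρ m hρ
  obtain ⟨P₁, c₁, hP₁⟩ := hF ρ m hρ
  obtain ⟨P₂, c₂, hP₂⟩ := hG ρ m hρ
  refine ⟨.seq P₁ P₂, max c₁ c₂, fun a s B H hs => ?_⟩
  obtain ⟨s₁, e₁, hA₁, ho₁⟩ := hP₁ a s B H hs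
  obtain ⟨s₂, e₂, hA₂, ho₂⟩ := hP₂ a s₁ B H (hs.of_agree hA₁ hρ)
  refine ⟨s₂, .seq (e₁.mono (pow_le_pow_of_fit H (le_max_left _ _)))
    (e₂.mono (pow_le_pow_of_fit H (le_max_right _ _))), hA₁.trans hA₂ le_rfl, ?_⟩
  rw [ho₂, ho₁, List.append_assoc]

theorem ite_eq {f g : α → ℕ} {F G : α → List Bool} (hf : LS f) (hg : LS g) (hF : Emits F)
    (hG : Emits G) : Emits (fun a => if f a = g a then F a else G a) := by
  intro ρ m hρ
  obtain ⟨P₁, c₁, hP₁⟩ := hf.prog ρ m hρ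
  obtain ⟨P₂, c₂, hP₂⟩ := hg.prog ρ (m + 1) fun i hi => (hρ i hi).trans (by omega)
  obtain ⟨P₃, c₃, hP₃⟩ := hF ρ m hρ
  obtain ⟨P₄, c₄, hP₄⟩ := hG ρ m hρ
  refine ⟨.seq P₁ (.seq P₂ (.ite (.eq m (m + 1)) P₃ P₄)), max (max c₁ c₂) (max c₃ c₄),
    fun a s B H hs => ?_⟩
  obtain ⟨s₁, e₁, hv₁, hA₁, ho₁⟩ := hP₁ a s B H hs
  obtain ⟨s₂, e₂, hv₂, hA₂, ho₂⟩ := hP₂ a s₁ B H (hs.of_agree hA₁ hρ)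
  have hA := hA₁.trans hA₂ (by omega)
  have hs₂ := hs.of_agree hA hρ
  have hm : s₂.reg m = f a := (hA₂ m (by omega)).trans hv₁
  obtain ⟨s₃, e₃, hA₃, ho₃⟩ := hP₃ a s₂ B H hs₂
  obtain ⟨s₄, e₄, hA₄, ho₄⟩ := hP₄ a s₂ B H hs₂
  by_cases hfg : f a = g a
  · refine ⟨s₃, .seq (e₁.mono (pow_le_pow_of_fit H (by omega)))
      (.seq (e₂.mono (pow_le_pow_of_fit H (by omega)))
      (.iteTrue ?_ (e₃.mono (pow_le_pow_of_fit H (by omega))))), hA.trans hA₃ le_rfl, ?_⟩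
    · rw [Test.Holds, hm, hv₂, hfg]
    · simp only [ho₃, ho₂, ho₁, if_pos hfg]
  · refine ⟨s₄, .seq (e₁.mono (pow_le_pow_of_fit H (by omega)))
      (.seq (e₂.mono (pow_le_pow_of_fit H (by omega)))
      (.iteFalse ?_ (e₄.mono (pow_le_pow_of_fit H (by omega))))), hA.trans hA₄ le_rfl, ?_⟩
    · rwa [Test.Holds, hm, hv₂]
    · simp only [ho₄, ho₂, ho₁, if_neg hfg]

theorem ite {p : α → Prop} [∀ a, Decidable (p a)] {F G : α → List Bool} (hp : LSP p)
    (hF : Emits F) (hG : Emits G) :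
    Emits (fun a => if p a then F a else G a) :=
  (ite_eq hp (LS.const 1) hF hG).congr fun a => by simp only [ind_eq_one]

theorem nil : Emits (fun _ : α => []) := by
  refine fun _ m _ => ⟨.clear m, 0, fun _ _ _ _ _ => ⟨_, .clear, fun r hr => ?_, by simp⟩⟩
  simp [Function.update_of_ne hr.ne]

theorem flatMap {F : α × ℕ → List Bool} {g : α → ℕ} (hF : Emits F) (hg : LS g) :
    Emits (fun a => (List.range (g a)).flatMap fun t => F (a, t)) := by
  obtain ⟨cg, hcg⟩ := hg.bounded
  intro ρ m hρ
  obtain ⟨P₁, c₁, hP₁⟩ := hg.prog ρ m hρ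
  obtain ⟨P₂, c₂, hP₂⟩ := hF (consLoc (m + 1) ρ) (m + 2) (consLoc_lt hρ (by omega) (by omega))
  set C := max c₁ (max ((cg + 1) * c₂) cg) with hC
  refine ⟨.seq P₁ (.seq (.clear (m + 1)) (.loop (.eq (m + 1) m) (.seq P₂ (.inc (m + 1))))), C,
    fun a s B H hs => ?_⟩
  have hle : ∀ {c}, c ≤ C → B ^ c ≤ B ^ C := fun hc => pow_le_pow_of_fit H hc
  obtain ⟨s₁, e₁, hv₁, hA₁, ho₁⟩ := hP₁ a s B H hs
  obtain ⟨s₃, e₃, ⟨hA₃, ho₃⟩, -⟩ := exec_for (x := inp a) (B := B ^ C) (r := m + 1) (n := m)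
    (N := g a) (P := .seq P₂ (.inc (m + 1)))
    (fun t u => (Agree m s u ∧ u.out = s.out ++ (List.range t).flatMap fun t => F (a, t)) ∧
      u.reg (m + 1) = t ∧ u.reg m = g a)
    (fun t u hu => hu.2)
    (by
      rintro t ht u ⟨⟨hAu, hou⟩, hut, hum⟩
      have hfit : Fit (a, t) (B ^ (cg + 1)) :=
        (H.pow cg).cons (ht.le.trans ((hcg a B H).trans (pow_le_pow_of_fit H (by omega))))
      obtain ⟨s', e', hA', ho'⟩ := hP₂ (a, t) u _ hfit ((hs.of_agree hAu hρ).cons hut)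
      rw [← pow_mul] at e'
      refine ⟨_, .seq (e'.mono (hle (by omega))) (.inc ?_), ⟨?_, ?_⟩, ?_, ?_⟩
      · rw [hA' (m + 1) (by omega), hut]
        exact (Nat.succ_le_of_lt ht).trans ((hcg a B H).trans (hle (by omega)))
      · intro r hr
        simp only
        rw [Function.update_of_ne (by omega), hA' r (by omega), hAu r hr]
      · simp [ho', hou, List.range_succ]
      · simp only [Function.update_self]
        rw [hA' (m + 1) (by omega), hut]
      · simp only
        rw [Function.update_of_ne (by omega), hA' m (by omega), hum])
    (s := { s₁ with reg := Function.update s₁.reg (m + 1) 0 })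
    (by
      refine ⟨⟨?_, by simp [ho₁]⟩, by simp, ?_⟩
      · intro r hr
        simp only
        rw [Function.update_of_ne (by omega), hA₁ r hr]
      · simp only
        rw [Function.update_of_ne (by omega), hv₁])
  exact ⟨s₃, .seq (e₁.mono (hle (by omega))) (.seq .clear e₃), hA₃, ho₃⟩

theorem replicate (b : Bool) {g : α → ℕ} (hg : LS g) :
    Emits (fun a => List.replicate (g a) b) :=
  (flatMap (bit b) hg).congr fun a => by
    rw [List.flatMap_def]
    simp [List.map_const']

theorem unary {g : α → ℕ} (hg : LS g) : Emits (fun a => unary (g a)) :=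
  (replicate true hg).append (bit false)

end Emits

/-! ### The classes -/

/-- Polynomially bounded registers mean logarithmic space. The base is `n + 2` because `Fit`
requires a bound of at least `2`, even on the empty input. -/
theorem log_pow_le (n c : ℕ) : Nat.log 2 ((n + 2) ^ c) + 3 ≤ (2 * c + 3) * Nat.log 2 n +
    (2 * c + 3) := by
  have h : n + 2 < 2 ^ (Nat.log 2 n + 2) := by
    have := Nat.lt_pow_succ_log_self (b := 2) (by omega) n
    have : 2 ≤ 2 ^ (Nat.log 2 n + 1) := Nat.le_self_pow (by omega) 2
    rw [pow_succ 2 (Nat.log 2 n + 1)]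
    omega
  have h2 : (n + 2) ^ c ≤ 2 ^ ((Nat.log 2 n + 2) * c) := by
    rw [pow_mul]
    exact Nat.pow_le_pow_left h.le c
  have h3 := Nat.log_mono_right (b := 2) h2
  rw [Nat.log_pow (by omega)] at h3
  nlinarith

theorem mem_logSpace {A : Language Bool} (h : LSP (fun x : List Bool => x ∈ A)) : A ∈ LogSpace := by
  obtain ⟨P, c, hP⟩ := LS.prog h id 0 (fun i hi => absurd hi (Nat.not_lt_zero i))
  -- The indicator is in register `0`; register `1` is set to one, and the machine accepts if they
  -- agree.
  refine ⟨(Prog.seq P (.seq (.clear 1) (.inc 1))).machine 0 1, 2 * (c + 1) + 3, fun x => ?_⟩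
  obtain ⟨s, e, hv, -, -⟩ := hP x .init (x.length + 2)
    ⟨by omega, by simp [inp], fun i hi => absurd hi (Nat.not_lt_zero i)⟩
    (fun i hi => absurd hi (Nat.not_lt_zero i))
  have e' := Exec.seq (e.mono (Nat.pow_le_pow_right (show 0 < x.length + 2 by omega)
    (Nat.le_succ c))) (.seq (Exec.clear (r := 1)) (Exec.inc (r := 1)
      (by simp only [Function.update_self]; exact Nat.one_le_pow _ _ (by omega))))
  obtain ⟨h₁, f, h₂, -, h₃⟩ := e'.machine 0 1
  refine ⟨fun d hd i => (h₁ d hd i).trans_le (log_pow_le _ _), f, h₂, ?_⟩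
  rw [h₃]
  simp [hv, ind_eq_one]

theorem logSpaceOnUnary {F : List Bool → List Bool} (h : Emits F) :
    LogSpaceOnUnary (fun n => F (List.replicate n true)) := by
  obtain ⟨P, c, hP⟩ := h id 0 (fun i hi => absurd hi (Nat.not_lt_zero i))
  refine ⟨P.machine 0 0, 2 * c + 3, fun n => ?_⟩
  obtain ⟨s, e, -, ho⟩ := hP (List.replicate n true) .init (n + 2)
    ⟨by omega, by simp [inp], fun i hi => absurd hi (Nat.not_lt_zero i)⟩
    (fun i hi => absurd hi (Nat.not_lt_zero i))
  obtain ⟨h₁, f, h₂, h₃, -⟩ := e.machine 0 0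
  exact ⟨fun d hd i => (h₁ d hd i).trans_le (log_pow_le _ _), f, h₂, by simp [h₃, ho, PState.init]⟩

open Ctx

/-! ### Formulas -/

/-- Assignments of numbers to variables. -/
abbrev Env := ℕ → ℕ

/-- First order formulas about an input string: numerical predicates and positions depend on the
length of the string and on the variables, and `call f` refers to a relation on assignments. -/
inductive Fml
  | num (p : ℕ → Env → Prop)
  | lit (pos : ℕ → Env → ℕ)
  | not (φ : Fml)
  | and (φ ψ : Fml)
  | or (φ ψ : Fml)
  | ex (i : ℕ) (φ : Fml)
  | all (i : ℕ) (φ : Fml)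
  | call (f : ℕ → Env → Env)

/-- The bound for the variables on inputs of length `N`. -/
def base (N : ℕ) : ℕ := (N + 2) ^ 2

/-- The first `D` variables reduced modulo `b`, the others set to zero. -/
def normEnv (b D : ℕ) (v : Env) : Env := fun i => if i < D then v i % b else 0

/-- The truth value of a formula with `D` variables, with `R` for the relation called. -/
def Fml.Eval (D : ℕ) (w : List Bool) (R : Env → Prop) : Fml → Env → Prop
  | num p, v => p w.length v
  | lit pos, v => w.getD (pos w.length v) false = true
  | not φ, v => ¬ φ.Eval D w R v
  | and φ ψ, v => φ.Eval D w R v ∧ ψ.Eval D w R v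
  | or φ ψ, v => φ.Eval D w R v ∨ ψ.Eval D w R v
  | ex i φ, v => ∃ t < base w.length, φ.Eval D w R (Function.update v i t)
  | all i φ, v => ∀ t < base w.length, φ.Eval D w R (Function.update v i t)
  | call f, v => R (normEnv (base w.length) D (f w.length v))

/-- The relation obtained by iterating a formula, starting with the empty relation. -/
def Fml.stage (D : ℕ) (w : List Bool) (φ : Fml) : ℕ → Env → Prop
  | 0, _ => False
  | ℓ + 1, v => φ.Eval D w (stage D w φ ℓ) v

/-- Numerical functions computable in logarithmic space. -/
def NumLS (f : ℕ → Env → ℕ) : Prop :=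
  ∀ {α : Type} [Ctx α] {v : α → Env}, (∀ i, LS fun a => v a i) →
    LS fun a => f (inp a).length (v a)

/-- Numerical predicates decidable in logarithmic space. -/
def NumLSP (p : ℕ → Env → Prop) : Prop :=
  ∀ {α : Type} [Ctx α] {v : α → Env}, (∀ i, LS fun a => v a i) →
    LSP fun a => p (inp a).length (v a)

/-- The numerical parts of the formula are computable in logarithmic space, and quantifiers bind
only the first `D` variables. -/
def Fml.Uniform (D : ℕ) : Fml → Prop
  | num p => NumLSP p
  | lit pos => NumLS pos
  | not φ => φ.Uniform D
  | and φ ψ => φ.Uniform D ∧ ψ.Uniform D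
  | or φ ψ => φ.Uniform D ∧ ψ.Uniform D
  | ex i φ => i < D ∧ φ.Uniform D
  | all i φ => i < D ∧ φ.Uniform D
  | call f => ∀ i, NumLS fun N v => f N v i

variable {α : Type} [Ctx α]

theorem LS.base : LS (fun a : α => base (inp a).length) :=
  (LS.length.add (LS.const 2)).pow_const 2

theorem LS.update {v : α → Env} (hv : ∀ i, LS fun a => v a i) (i j : ℕ) :
    LS (fun a : α × ℕ => Function.update (v a.1) i a.2 j) := by
  by_cases h : j = i
  · subst h
    exact LS.snd.congr fun a => by simp
  · exact (hv j).weaken.congr fun a => by simp [h]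

theorem LS.normEnv {b : α → ℕ} (hb : LS b) (D : ℕ) {v : α → Env} (hv : ∀ i, LS fun a => v a i)
    (i : ℕ) : LS (fun a => normEnv (b a) D (v a) i) := by
  by_cases h : i < D
  · exact ((hv i).mod hb).congr fun a => by simp [LatinIsotopy.normEnv, h]
  · exact LS.zero.congr fun a => by simp [LatinIsotopy.normEnv, h]

/-- Formulas with a relation decidable in logarithmic space are decidable in logarithmic space. -/
theorem Fml.Uniform.lsp {D : ℕ} {R : List Bool → Env → Prop}
    (hR : ∀ {α : Type} [Ctx α] {v : α → Env}, (∀ i, LS fun a => v a i) →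
      LSP fun a => R (inp a) (v a)) {φ : Fml} (hφ : φ.Uniform D) {v : α → Env}
    (hv : ∀ i, LS fun a => v a i) : LSP (fun a => φ.Eval D (inp a) (R (inp a)) (v a)) := by
  induction φ generalizing α with
  | num p => exact hφ hv
  | lit pos => exact LSP.bit (hφ hv)
  | not φ ih => exact (ih hφ hv).not
  | and φ ψ ih₁ ih₂ => exact (ih₁ hφ.1 hv).and (ih₂ hφ.2 hv)
  | or φ ψ ih₁ ih₂ => exact (ih₁ hφ.1 hv).or (ih₂ hφ.2 hv)
  | ex i φ ih => exact (ih hφ.2 (LS.update hv i)).ex LS.base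
  | all i φ ih => exact (ih hφ.2 (LS.update hv i)).all LS.base
  | call f => exact hR (LS.normEnv LS.base D fun i => hφ i hv)

/-! ### Circuits for iterated formulas -/

namespace Fml

/-- The subformulas, each one after its own subformulas. -/
def flat : Fml → List Fml
  | not φ => φ.flat ++ [not φ]
  | and φ ψ => φ.flat ++ ψ.flat ++ [and φ ψ]
  | or φ ψ => φ.flat ++ ψ.flat ++ [or φ ψ]
  | ex i φ => φ.flat ++ [ex i φ]
  | all i φ => φ.flat ++ [all i φ]
  | φ => [φ]

/-- The number of subformulas. -/
def size (φ : Fml) : ℕ := φ.flat.length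

theorem flat_eq (φ : Fml) : ∃ l, φ.flat = l ++ [φ] := by
  cases φ with
  | num | lit | call => exact ⟨[], rfl⟩
  | _ => exact ⟨_, rfl⟩

theorem size_pos (φ : Fml) : 0 < φ.size := by
  obtain ⟨l, h⟩ := φ.flat_eq
  simp [size, h]

theorem flat_getElem?_last {φ : Fml} {l l' : List Fml} {n : ℕ} (h : n + 1 = l.length + φ.size) :
    (l ++ (φ.flat ++ l'))[n]? = some φ := by
  obtain ⟨k, hk⟩ := φ.flat_eq
  simp only [size, hk, List.length_append, List.length_singleton] at h ⊢
  obtain rfl : n = l.length + k.length := by omega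
  simp

theorem exists_flat_eq_of_last {φ ψ : Fml} {σ : ℕ} (h : φ.flat[σ]? = some ψ)
    (hσ : ¬ σ + 1 < φ.size) :
    ∃ l l', φ.flat = l ++ ψ.flat ++ l' ∧ l.length + ψ.size = σ + 1 := by
  have h1 := (List.getElem?_eq_some_iff.1 h).1
  have h2 := flat_getElem?_last (φ := φ) (l := []) (l' := []) (n := σ)
    (by simp only [size, List.length_nil] at hσ ⊢; omega)
  simp only [List.nil_append, List.append_nil, h, Option.some.injEq] at h2
  subst h2
  exact ⟨[], [], by simp, by simp only [size, List.length_nil] at hσ ⊢; omega⟩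

/-- In this post-order listing the subformulas of `ψ` form a contiguous block that ends at `ψ`.
Hence the immediate subformulas sit at fixed distances before `ψ`, and gates can refer to them by
subtraction. -/
theorem exists_flat_eq {φ ψ : Fml} {σ : ℕ} (h : φ.flat[σ]? = some ψ) :
    ∃ l l', φ.flat = l ++ ψ.flat ++ l' ∧ l.length + ψ.size = σ + 1 := by
  induction φ generalizing σ with
  | num | lit | call =>
    exact exists_flat_eq_of_last h (by simp [size, flat])
  | not φ ih | ex _ φ ih | all _ φ ih =>
    by_cases hσ : σ < φ.size
    · simp only [flat] at h ⊢
      rw [List.getElem?_append_left hσ] at h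
      obtain ⟨l, l', h₁, h₂⟩ := ih h
      exact ⟨l, l' ++ [_], by rw [h₁, ← List.append_assoc], h₂⟩
    · refine exists_flat_eq_of_last h ?_
      simp only [size, flat, List.length_append, List.length_singleton] at hσ ⊢
      omega
  | and φ ψ ih₁ ih₂ | or φ ψ ih₁ ih₂ =>
    by_cases hσ : σ < φ.size
    · simp only [flat] at h ⊢
      rw [List.append_assoc, List.getElem?_append_left hσ] at h
      obtain ⟨l, l', h₁, h₂⟩ := ih₁ h
      exact ⟨l, l' ++ (ψ.flat ++ [_]), by rw [h₁]; simp only [List.append_assoc]; rfl, h₂⟩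
    by_cases hσ' : σ < φ.size + ψ.size
    · simp only [flat] at h ⊢
      rw [List.append_assoc, List.getElem?_append_right (not_lt.1 hσ),
        List.getElem?_append_left (by simp only [size] at hσ hσ' ⊢; omega)] at h
      obtain ⟨l, l', h₁, h₂⟩ := ih₂ h
      refine ⟨φ.flat ++ l, l' ++ [_], by rw [h₁]; simp only [List.append_assoc]; rfl, ?_⟩
      rw [List.length_append]
      simp only [size] at hσ hσ' h₂ ⊢
      omega
    · refine exists_flat_eq_of_last h ?_
      simp only [size, flat, List.length_append, List.length_singleton] at hσ hσ' ⊢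
      omega

end Fml

/-- The assignment with code `a`: the digits of `a` in base `b`. -/
def decEnv (b D a : ℕ) : Env := normEnv b D fun i => a / b ^ i

theorem exists_decEnv {b D : ℕ} (hb : 0 < b) (v : Env) :
    ∃ a < b ^ D, decEnv b D a = normEnv b D v := by
  suffices h : ∃ a < b ^ D, ∀ i < D, a / b ^ i % b = v i % b by
    obtain ⟨a, ha, h⟩ := h
    refine ⟨a, ha, funext fun i => ?_⟩
    simp only [decEnv, normEnv]
    split
    exacts [h i ‹_›, rfl]
  induction D generalizing v with
  | zero => exact ⟨0, by simp, by simp⟩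
  | succ D ih =>
    obtain ⟨a, ha, h⟩ := ih fun i => v (i + 1)
    have h0 := Nat.mod_lt (v 0) hb
    refine ⟨v 0 % b + b * a, ?_, fun i hi => ?_⟩
    · rw [pow_succ]
      nlinarith
    · cases i with
      | zero => simp [Nat.add_mul_mod_self_left]
      | succ i =>
        rw [pow_succ', ← Nat.div_div_eq_div_mul, Nat.add_mul_div_left _ _ hb,
          Nat.div_eq_of_lt h0, zero_add]
        exact h i (by omega)

/-- The output of a circuit is its last gate, so the assignment with the greatest code, all of whose
digits are `b - 1`, is the one at which the formula gets evaluated. -/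
theorem decEnv_last {b D : ℕ} (hb : 0 < b) :
    decEnv b D (b ^ D - 1) = fun i => if i < D then b - 1 else 0 := by
  funext i
  simp only [decEnv, normEnv]
  split
  · rename_i hi
    obtain ⟨k, rfl⟩ := Nat.exists_eq_add_of_lt hi
    have h1 : 0 < b ^ i := by positivity
    have h2 : 0 < b ^ k := by positivity
    -- The number is split into the digits below `i`, digit `i` and the digits above.
    have e : b ^ (i + k + 1) - 1 = (b ^ i - 1) + b ^ i * ((b - 1) + b * (b ^ k - 1)) := by
      obtain ⟨c, rfl⟩ := Nat.exists_eq_succ_of_ne_zero hb.ne'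
      obtain ⟨p, hp⟩ := Nat.exists_eq_succ_of_ne_zero h1.ne'
      obtain ⟨q, hq⟩ := Nat.exists_eq_succ_of_ne_zero h2.ne'
      rw [pow_succ, pow_add, hp, hq]
      simp only [Nat.succ_eq_add_one, Nat.add_sub_cancel]
      have : (p + 1) * (q + 1) * (c + 1) = p + (p + 1) * (c + (c + 1) * q) + 1 := by ring
      omega
    rw [e, Nat.add_mul_div_left _ _ h1, Nat.div_eq_of_lt (by omega), zero_add,
      Nat.add_mul_mod_self_left, Nat.mod_eq_of_lt (by omega)]
  · rfl

/-- Gate `h` belongs to the subformula before that of gate `g`, and their assignments differ at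
most in variable `i`. -/
def QuantChild (D N i g h : ℕ) : Prop :=
  h / base N ^ D + 1 = g / base N ^ D ∧ ∀ j < D, j ≠ i →
    decEnv (base N) D (h % base N ^ D) j = decEnv (base N) D (g % base N ^ D) j

/-- Gate `h` belongs to the last subformula in the round before that of gate `g`, and its assignment
arises from that of `g` by `f`. -/
def CallChild (D K N : ℕ) (f : ℕ → Env → Env) (g h : ℕ) : Prop :=
  h / base N ^ D + 1 = g / base N ^ D / K * K ∧ ∀ j < D, decEnv (base N) D (h % base N ^ D) j =
    normEnv (base N) D (f N (decEnv (base N) D (g % base N ^ D))) j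

open Classical in
/-- Gate `g` of the circuit for inputs of length `N`. Gate `(ℓ * K + σ) * A + a`, where
`A = b ^ D`, computes the value of subformula number `σ` under the assignment with code `a` in
round `ℓ`. -/
noncomputable def Fml.gate (D K N g : ℕ) : Fml → Gate
  | num p => if p N (decEnv (base N) D (g % base N ^ D)) then .and [] else .or []
  | lit pos =>
    let i := pos N (decEnv (base N) D (g % base N ^ D))
    if i < N then .input i else .or []
  | not _ => .not (g - base N ^ D)
  | and _ ψ => .and [g - base N ^ D, g - (ψ.size + 1) * base N ^ D]
  | or _ ψ => .or [g - base N ^ D, g - (ψ.size + 1) * base N ^ D]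
  | ex i _ => .or ((List.range g).filter fun h => QuantChild D N i g h)
  | all i _ => .and ((List.range g).filter fun h => QuantChild D N i g h)
  | call f => .or ((List.range g).filter fun h => CallChild D K N f g h)

/-- The circuit that iterates a formula for `T` rounds. -/
noncomputable def Fml.circuit (φ : Fml) (D T N : ℕ) : Circuit :=
  (List.range (T * φ.size * base N ^ D)).map fun g =>
    (φ.flat.getD (g / base N ^ D % φ.size) φ).gate D φ.size N g

/-! #### Uniformity -/

theorem LSP.forall_lt_const {p : ℕ → α → Prop} (hp : ∀ j, LSP (p j)) (D : ℕ) :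
    LSP (fun a => ∀ j < D, p j a) := by
  induction D with
  | zero => exact (LSP.const True).congr fun a => by simp
  | succ D ih => exact (ih.and (hp D)).congr fun a => by rw [Nat.forall_lt_succ_right]

theorem LS.decEnv {b c : α → ℕ} (hb : LS b) (hc : LS c) (D i : ℕ) :
    LS (fun a => decEnv (b a) D (c a) i) :=
  LS.normEnv hb D (fun i => hc.div (hb.pow_const i)) i

open Classical in
theorem Emits.encodeList_filter {p : α × ℕ → Prop} (hp : LSP p) {g : α → ℕ} (hg : LS g) :
    Emits (fun a => encodeList ((List.range (g a)).filter fun t => p (a, t))) := by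
  refine ((flatMap (ite hp ((bit true).append (unary LS.snd)) nil) hg).append (bit false)).congr
    fun a => ?_
  rw [encodeList]
  congr 1
  induction List.range (g a) with
  | nil => rfl
  | cons t l ih =>
    rw [List.flatMap_cons, ih]
    by_cases h : p (a, t) <;> simp [h]

theorem Emits.getD {l : List Fml} {F : Fml → α → List Bool} {d : Fml} (hl : ∀ ψ ∈ l, Emits (F ψ))
    (hd : Emits (F d)) {σ : α → ℕ} (hσ : LS σ) : Emits (fun a => F (l.getD (σ a) d) a) := by
  induction l generalizing σ with
  | nil => simpa using hd
  | cons ψ l ih =>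
    refine (ite_eq hσ LS.zero (hl ψ (by simp)) (ih (fun χ hχ => hl χ (by simp [hχ]))
      hσ.pred)).congr fun a => ?_
    cases h : σ a <;> simp

theorem Fml.Uniform.of_mem_flat {D : ℕ} {φ ψ : Fml} (hφ : φ.Uniform D) (h : ψ ∈ φ.flat) :
    ψ.Uniform D := by
  induction φ with
  | num | lit | call =>
    simp only [flat, List.mem_singleton] at h
    subst h
    exact hφ
  | not φ ih =>
    simp only [flat, List.mem_append, List.mem_singleton] at h
    rcases h with h | rfl
    exacts [ih hφ h, hφ]
  | ex _ φ ih | all _ φ ih =>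
    simp only [flat, List.mem_append, List.mem_singleton] at h
    rcases h with h | rfl
    exacts [ih hφ.2 h, hφ]
  | and φ ψ ih₁ ih₂ | or φ ψ ih₁ ih₂ =>
    simp only [flat, List.mem_append, List.mem_singleton] at h
    rcases h with (h | h) | rfl
    exacts [ih₁ hφ.1 h, ih₂ hφ.2 h, hφ]

theorem Fml.Uniform.emits_gate {D : ℕ} {ψ : Fml} (hψ : ψ.Uniform D) (K : ℕ) {g : α → ℕ}
    (hg : LS g) : Emits (fun a => (ψ.gate D K (inp a).length (g a)).encode) := by
  classical
  have hA : LS (fun a : α => base (inp a).length ^ D) := LS.base.pow_const D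
  have hv : ∀ i, LS (fun a => decEnv (base (inp a).length) D
      (g a % base (inp a).length ^ D) i) := LS.decEnv LS.base (hg.mod hA) D
  have hv' : ∀ i, LS (fun a : α × ℕ => decEnv (base (inp a.1).length) D
      (a.2 % base (inp a.1).length ^ D) i) := LS.decEnv LS.base.weaken (LS.snd.mod hA.weaken) D
  have hq : LS (fun a => g a / base (inp a).length ^ D) := hg.div hA
  have hq' : LS (fun a : α × ℕ => a.2 / base (inp a.1).length ^ D + 1) :=
    (LS.snd.div hA.weaken).succ
  have hquant : ∀ i, LSP (fun a : α × ℕ => QuantChild D (inp a.1).length i (g a.1) a.2) :=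
    fun i => (LSP.eq hq' hq.weaken).and (LSP.forall_lt_const (fun j => LSP.or (LSP.const (j = i))
      (LSP.eq (hv' j) (hv j).weaken) |>.congr fun a => or_iff_not_imp_left) D)
  have two : ∀ b c, Emits (fun _ : α => [b, c]) := fun b c => (Emits.bit b).append (Emits.bit c)
  have hand := (two true false).append (α := α) (Emits.bit false)
  have hor := (two true true).append (α := α) (Emits.bit false)
  have pair : ∀ {k l : α → ℕ}, LS k → LS l → Emits (fun a => encodeList [k a, l a]) :=
    fun hk hl => ((((Emits.bit true).append (.unary hk)).append ((Emits.bit true).append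
      (.unary hl))).append (Emits.bit false)).congr fun a => by simp [encodeList]
  cases ψ with
  | num p =>
    refine (Emits.ite (hψ hv) hand hor).congr fun a => ?_
    simp only [gate]
    split <;> simp [Gate.encode, encodeList]
  | lit pos =>
    refine (Emits.ite (LSP.lt (hψ hv) LS.length) ((two false false).append (.unary (hψ hv)))
      hor).congr fun a => ?_
    simp only [gate]
    split <;> simp [Gate.encode, encodeList]
  | not φ => exact (two false true).append (.unary (hg.sub hA))
  | and φ ψ =>
    exact (two true false).append (pair (hg.sub hA) (hg.sub ((LS.const _).mul hA)))
  | or φ ψ =>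
    exact (two true true).append (pair (hg.sub hA) (hg.sub ((LS.const _).mul hA)))
  | ex i φ => exact (two true true).append (.encodeList_filter (hquant i) hg)
  | all i φ => exact (two true false).append (.encodeList_filter (hquant i) hg)
  | call f =>
    exact (two true true).append (.encodeList_filter
      (p := fun a : α × ℕ => CallChild D K (inp a.1).length f (g a.1) a.2)
      ((LSP.eq hq' ((hq.div (LS.const K)).mul (LS.const K)).weaken).and
        (LSP.forall_lt_const (fun j => LSP.eq (hv' j)
          (LS.normEnv LS.base D (fun i => hψ i hv) j).weaken) D)) hg)

theorem Fml.Uniform.emits_circuit {D : ℕ} {φ : Fml} (hφ : φ.Uniform D) {T : α → ℕ} (hT : LS T) :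
    Emits (fun a => (φ.circuit D (T a) (inp a).length).encode) := by
  have hA : LS (fun a : α => base (inp a).length ^ D) := LS.base.pow_const D
  refine (Emits.flatMap (F := fun a : α × ℕ => ((φ.flat.getD
    (a.2 / base (inp a.1).length ^ D % φ.size) φ).gate D φ.size (inp a.1).length a.2).encode)
    (Emits.getD (F := fun ψ a => (ψ.gate D φ.size (inp a.1).length a.2).encode)
      (fun ψ hψ => (hφ.of_mem_flat hψ).emits_gate _ LS.snd) (hφ.emits_gate _ LS.snd)
      ((LS.snd.div hA.weaken).mod (LS.const _)))
    ((hT.mul (LS.const φ.size)).mul hA)).congr fun a => ?_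
  simp only [Circuit.encode, circuit, List.flatMap_map]

open Ctx

/-! #### Values and depths of the gates -/

/-- The gates read by a gate. -/
def Gate.deps : Gate → List ℕ
  | input _ => []
  | not j => [j]
  | and js => js
  | or js => js

theorem foldr_max_le {l : List ℕ} {b : ℕ} (h : ∀ a ∈ l, a ≤ b) : l.foldr max 0 ≤ b := by
  induction l with
  | nil => simp
  | cons a l ih => simp_all

theorem Gate.depth_le {ds : List ℕ} {G : Gate} {b : ℕ} (h : ∀ j ∈ G.deps, ds.getD j 0 ≤ b) :
    G.depth ds ≤ b + 1 := by
  cases G with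
  | input i => simp [Gate.depth]
  | not j => simpa [Gate.depth, deps] using h
  | and js | or js =>
    refine Nat.succ_le_succ (foldr_max_le fun a ha => ?_)
    obtain ⟨j, hj, rfl⟩ := List.mem_map.1 ha
    exact h j hj

namespace Circuit

/-- Evaluating a circuit reduces to proposing the value of each gate and checking every gate locally
against the proposed values of the earlier ones. -/
theorem values_map {x : List Bool} {gate : ℕ → Gate} {val : ℕ → Bool} {T : ℕ}
    (h : ∀ g < T, (gate g).value x ((List.range g).map val) = val g) :
    values x ((List.range T).map gate) = (List.range T).map val := by
  induction T with
  | zero => rfl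
  | succ T ih =>
    have ih := ih fun g hg => h g (by omega)
    rw [values] at ih
    rw [values, List.range_succ, List.map_append, List.foldl_append, ih]
    simp [h T (by omega)]

theorem depths_map {gate : ℕ → Gate} {bnd : ℕ → ℕ} {T : ℕ}
    (h : ∀ g < T, ∀ ds : List ℕ, (∀ j < g, ds.getD j 0 ≤ bnd j) → (gate g).depth ds ≤ bnd g) :
    (depths ((List.range T).map gate)).length = T ∧
      ∀ j < T, (depths ((List.range T).map gate)).getD j 0 ≤ bnd j := by
  induction T with
  | zero => exact ⟨rfl, by simp⟩
  | succ T ih =>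
    obtain ⟨h₁, h₂⟩ := ih fun g hg => h g (by omega)
    have hT := h T (by omega) _ h₂
    set ds := depths ((List.range T).map gate) with hds
    have e : depths ((List.range (T + 1)).map gate) = ds ++ [(gate T).depth ds] := by
      rw [depths, List.range_succ, List.map_append, List.foldl_append]
      rfl
    rw [e]
    refine ⟨by simp [h₁], fun j hj => ?_⟩
    rcases Nat.lt_succ_iff_lt_or_eq.1 hj with hj | rfl
    · rw [List.getD_append _ _ _ _ (by omega)]
      exact h₂ j hj
    · rw [List.getD_append_right _ _ _ _ (by omega), h₁]
      simpa using hT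

end Circuit

theorem getD_map_range {val : ℕ → Bool} {g j : ℕ} (h : j < g) :
    ((List.range g).map val).getD j false = val j := by
  simp [h]

namespace Fml

theorem base_pos (N : ℕ) : 0 < base N := by
  unfold base
  positivity

section

variable {φ ψ : Fml} {D N g : ℕ}

theorem flat_getElem? (h : ψ = φ.flat.getD (g / base N ^ D % φ.size) φ) :
    φ.flat[g / base N ^ D % φ.size]? = some ψ := by
  have := Nat.mod_lt (g / base N ^ D) φ.size_pos
  rw [h, List.getD_eq_getElem?_getD, List.getElem?_eq_getElem this]
  rfl

/-- Gate numbers are triples of round, subformula and assignment. Going back `s` blocks within a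
round lowers the subformula number by `s` and keeps round and assignment. -/
theorem sub_block {A K g s : ℕ} (hA : 0 < A) (hs : s ≤ g / A % K) :
    (g - s * A) / A = g / A - s ∧ (g - s * A) % A = g % A ∧ (g / A - s) / K = g / A / K ∧
      (g / A - s) % K = g / A % K - s ∧ s * A ≤ g := by
  have h1 : s ≤ g / A := hs.trans (Nat.mod_le _ _)
  have h2 : s * A ≤ g := (Nat.le_div_iff_mul_le hA).1 h1
  refine ⟨?_, ?_, ?_, ?_, h2⟩
  · rw [mul_comm, Nat.sub_mul_div_of_le]
    rwa [mul_comm]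
  · rw [mul_comm]
    exact Nat.sub_mul_mod (by rwa [mul_comm])
  all_goals
    rcases Nat.eq_zero_or_pos K with rfl | hK
    · simp
    have h3 := Nat.div_add_mod (g / A) K
    have h4 := Nat.mod_lt (g / A) hK
    have h5 : g / A - s = (g / A % K - s) + K * (g / A / K) := by omega
    rw [h5]
  · rw [Nat.add_mul_div_left _ _ hK, Nat.div_eq_of_lt (by omega), zero_add]
  · rw [Nat.add_mul_mod_self_left, Nat.mod_eq_of_lt (by omega)]

theorem unary_child {χ : Fml} (h : ψ = φ.flat.getD (g / base N ^ D % φ.size) φ)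
    (hχ : ψ.flat = χ.flat ++ [ψ]) :
    1 ≤ g / base N ^ D % φ.size ∧ φ.flat.getD (g / base N ^ D % φ.size - 1) φ = χ := by
  obtain ⟨l, l', h₁, h₂⟩ := exists_flat_eq (flat_getElem? h)
  have hs : ψ.size = χ.size + 1 := by simp [size, hχ]
  have := χ.size_pos
  refine ⟨by omega, ?_⟩
  rw [List.getD_eq_getElem?_getD, h₁, hχ, List.append_assoc, List.append_assoc,
    flat_getElem?_last (by omega)]
  rfl

theorem binary_child {χ₁ χ₂ : Fml} (h : ψ = φ.flat.getD (g / base N ^ D % φ.size) φ)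
    (hχ : ψ.flat = χ₁.flat ++ χ₂.flat ++ [ψ]) :
    χ₂.size + 1 ≤ g / base N ^ D % φ.size ∧ φ.flat.getD (g / base N ^ D % φ.size - 1) φ = χ₂ ∧
      φ.flat.getD (g / base N ^ D % φ.size - (χ₂.size + 1)) φ = χ₁ := by
  obtain ⟨l, l', h₁, h₂⟩ := exists_flat_eq (flat_getElem? h)
  have hs : ψ.size = χ₁.size + χ₂.size + 1 := by simp [size, hχ, Nat.add_assoc]
  have := χ₁.size_pos
  have := χ₂.size_pos
  refine ⟨by omega, ?_, ?_⟩
  · rw [List.getD_eq_getElem?_getD, h₁, hχ]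
    have : l ++ (χ₁.flat ++ χ₂.flat ++ [ψ]) ++ l' = (l ++ χ₁.flat) ++ (χ₂.flat ++ ([ψ] ++ l')) := by
      simp
    rw [this, flat_getElem?_last (by simp only [List.length_append, size] at *; omega)]
    rfl
  · rw [List.getD_eq_getElem?_getD, h₁, hχ]
    have : l ++ (χ₁.flat ++ χ₂.flat ++ [ψ]) ++ l' = l ++ (χ₁.flat ++ (χ₂.flat ++ ([ψ] ++ l'))) := by
      simp
    rw [this, flat_getElem?_last (by omega)]
    rfl

/-- A gate reads only gates in earlier blocks of `base N ^ D` gates. This gives the topological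
order, and it bounds the depth by the number of blocks, that is, of pairs of a round and a
subformula. -/
theorem deps_gate (h : ψ = φ.flat.getD (g / base N ^ D % φ.size) φ) :
    ∀ j ∈ (ψ.gate D φ.size N g).deps, j < g ∧ j / base N ^ D < g / base N ^ D := by
  have hA : 0 < base N ^ D := pow_pos (base_pos N) D
  have hblock : ∀ s, 1 ≤ s → s ≤ g / base N ^ D % φ.size →
      g - s * base N ^ D < g ∧ (g - s * base N ^ D) / base N ^ D < g / base N ^ D := by
    intro s hs hs'
    obtain ⟨h₁, -, -, -, h₅⟩ := sub_block hA hs'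
    have := Nat.mod_le (g / base N ^ D) φ.size
    rw [h₁]
    have := Nat.mul_le_mul hs hA
    omega
  intro j hj
  cases ψ with
  | num p =>
    simp only [gate] at hj
    split at hj <;> simp [Gate.deps] at hj
  | lit p =>
    simp only [gate] at hj
    split at hj <;> simp [Gate.deps] at hj
  | not χ =>
    simp only [gate, Gate.deps, List.mem_singleton] at hj
    subst hj
    simpa using hblock 1 le_rfl (unary_child h rfl).1
  | and χ₁ χ₂ | or χ₁ χ₂ =>
    have hc := binary_child h rfl
    simp only [gate, Gate.deps, List.mem_cons, List.not_mem_nil, or_false] at hj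
    rcases hj with rfl | rfl
    · simpa using hblock 1 le_rfl (by omega)
    · exact hblock _ (by omega) hc.1
  | ex i χ | all i χ =>
    simp only [gate, Gate.deps, List.mem_filter, List.mem_range, decide_eq_true_eq] at hj
    have := hj.2.1
    exact ⟨hj.1, by omega⟩
  | call f =>
    simp only [gate, Gate.deps, List.mem_filter, List.mem_range, decide_eq_true_eq] at hj
    have := hj.2.1
    have := Nat.div_mul_le_self (g / base N ^ D) φ.size
    exact ⟨hj.1, by omega⟩

theorem decEnv_apply_of_le {b D a j : ℕ} (h : ¬ j < D) : decEnv b D a j = 0 := by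
  simp [decEnv, normEnv, h]

open Classical in
-- The local check needed for `Circuit.values_map`: with the intended truth values at the gates it
-- reads, each gate gets its intended truth value.
theorem value_gate {w : List Bool} (hφ : φ.Uniform D) (hN : N = w.length)
    (h : ψ = φ.flat.getD (g / base N ^ D % φ.size) φ) {val : ℕ → Bool}
    (hval : ∀ j, val j = decide ((φ.flat.getD (j / base N ^ D % φ.size) φ).Eval D w
      (φ.stage D w (j / base N ^ D / φ.size)) (decEnv (base N) D (j % base N ^ D)))) :
    (ψ.gate D φ.size N g).value w ((List.range g).map val) = val g := by
  have hb := base_pos N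
  have hA : 0 < base N ^ D := pow_pos hb D
  have hdeps := deps_gate h
  have hu : ψ.Uniform D :=
    hφ.of_mem_flat (List.mem_of_getElem? (flat_getElem? h))
  rw [hval g, ← h]
  have hblock : ∀ {s χ}, s ≤ g / base N ^ D % φ.size → 1 ≤ s →
      φ.flat.getD (g / base N ^ D % φ.size - s) φ = χ →
      ((List.range g).map val).getD (g - s * base N ^ D) false =
        decide (χ.Eval D w (φ.stage D w (g / base N ^ D / φ.size))
          (decEnv (base N) D (g % base N ^ D))) := by
    intro s χ hs hs' hχ
    obtain ⟨h₁, h₂, h₃, h₄, h₅⟩ := sub_block hA hs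
    have := Nat.mul_le_mul hs' hA
    rw [getD_map_range (by omega), hval, h₁, h₂, h₃, h₄, hχ]
  have hchild : ∀ {χ i h}, i < D → φ.flat.getD (g / base N ^ D % φ.size - 1) φ = χ →
      1 ≤ g / base N ^ D % φ.size → QuantChild D N i g h →
      val h = decide (χ.Eval D w (φ.stage D w (g / base N ^ D / φ.size))
          (Function.update (decEnv (base N) D (g % base N ^ D)) i
            (decEnv (base N) D (h % base N ^ D) i))) := by
    intro χ i h hi hχ h1 hq
    obtain ⟨-, -, h₃, h₄, -⟩ := sub_block hA h1
    have e : h / base N ^ D = g / base N ^ D - 1 := Nat.eq_sub_of_add_eq hq.1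
    rw [hval, e, h₃, h₄, hχ]
    congr 2
    funext j
    rw [Function.update_apply]
    split
    · rename_i hj; rw [hj]
    · by_cases hj : j < D
      · exact hq.2 j hj ‹_›
      · rw [decEnv_apply_of_le hj, decEnv_apply_of_le hj]
  -- Each value `t` of the quantified variable is represented by a gate: the one in the preceding
  -- block whose code is that of the updated assignment.
  have hexists : ∀ {i t}, i < D → 1 ≤ g / base N ^ D % φ.size → t < base N →
      ∃ h < g, QuantChild D N i g h ∧ decEnv (base N) D (h % base N ^ D) i = t := by
    intro i t hi h1 ht
    obtain ⟨a, ha, hae⟩ := exists_decEnv (D := D) hb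
      (Function.update (decEnv (base N) D (g % base N ^ D)) i t)
    have hq := Nat.mod_le (g / base N ^ D) φ.size
    obtain ⟨q, hq'⟩ := Nat.exists_eq_add_of_le (h1.trans hq)
    have e1 : (q * base N ^ D + a) / base N ^ D = q := by
      rw [mul_comm, Nat.mul_add_div hA, Nat.div_eq_of_lt ha, add_zero]
    have e2 : (q * base N ^ D + a) % base N ^ D = a := by
      rw [mul_comm, Nat.mul_add_mod, Nat.mod_eq_of_lt ha]
    refine ⟨q * base N ^ D + a, ?_, ⟨?_, fun j hj hji => ?_⟩, ?_⟩
    · by_contra hlt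
      have := Nat.div_le_div_right (c := base N ^ D) (not_lt.1 hlt)
      omega
    · omega
    · rw [e2, hae, normEnv, if_pos hj, Function.update_of_ne hji, Nat.mod_eq_of_lt]
      simp only [decEnv, normEnv, hj, if_true]
      exact Nat.mod_lt _ hb
    · rw [e2, hae, normEnv, if_pos hi, Function.update_self, Nat.mod_eq_of_lt ht]
  have hlt : ∀ {i a}, decEnv (base N) D a i < base N := by
    intro i a
    simp only [decEnv, normEnv]
    split
    exacts [Nat.mod_lt _ hb, hb]
  cases ψ with
  | num p =>
    simp only [gate, Eval, hN]
    split <;> simp_all [Gate.value]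
  | lit pos =>
    simp only [gate, Eval, hN]
    split
    · simp [Gate.value]
    · rename_i hi
      simp only [Gate.value, List.any_nil]
      rw [List.getD_eq_default _ _ (not_lt.1 hi)]
      simp
  | not χ =>
    obtain ⟨h1, hχ⟩ := unary_child h rfl
    have := hblock h1 le_rfl hχ
    rw [one_mul] at this
    rw [Bool.eq_iff_iff, decide_eq_true_iff]
    simp [gate, Gate.value, Eval, -List.getD_eq_getElem?_getD, this]
  | and χ₁ χ₂ =>
    obtain ⟨h1, hχ, hχ'⟩ := binary_child h rfl
    have e₁ := hblock (show 1 ≤ _ by omega) le_rfl hχ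
    have e₂ := hblock h1 (by omega) hχ'
    rw [one_mul] at e₁
    rw [Bool.eq_iff_iff, decide_eq_true_iff]
    simp [gate, Gate.value, Eval, -List.getD_eq_getElem?_getD, e₁, e₂, and_comm]
  | or χ₁ χ₂ =>
    obtain ⟨h1, hχ, hχ'⟩ := binary_child h rfl
    have e₁ := hblock (show 1 ≤ _ by omega) le_rfl hχ
    have e₂ := hblock h1 (by omega) hχ'
    rw [one_mul] at e₁
    rw [Bool.eq_iff_iff, decide_eq_true_iff]
    simp [gate, Gate.value, Eval, -List.getD_eq_getElem?_getD, e₁, e₂, or_comm]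
  | ex i χ =>
    obtain ⟨h1, hχ⟩ := unary_child h rfl
    rw [Bool.eq_iff_iff, decide_eq_true_iff]
    simp only [gate, Gate.value, List.any_eq_true, List.mem_filter, List.mem_range,
      decide_eq_true_eq, Eval, ← hN]
    constructor
    · rintro ⟨j, ⟨hj, hq⟩, hv⟩
      rw [getD_map_range hj, hchild hu.1 hχ h1 hq, decide_eq_true_iff] at hv
      exact ⟨_, hlt, hv⟩
    · rintro ⟨t, ht, hv⟩
      obtain ⟨j, hj, hq, rfl⟩ := hexists hu.1 h1 ht
      refine ⟨j, ⟨hj, hq⟩, ?_⟩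
      rwa [getD_map_range hj, hchild hu.1 hχ h1 hq, decide_eq_true_iff]
  | all i χ =>
    obtain ⟨h1, hχ⟩ := unary_child h rfl
    rw [Bool.eq_iff_iff, decide_eq_true_iff]
    simp only [gate, Gate.value, List.all_eq_true, List.mem_filter, List.mem_range,
      decide_eq_true_eq, Eval, ← hN]
    constructor
    · intro hv t ht
      obtain ⟨j, hj, hq, rfl⟩ := hexists hu.1 h1 ht
      have := hv j ⟨hj, hq⟩
      rwa [getD_map_range hj, hchild hu.1 hχ h1 hq, decide_eq_true_iff] at this
    · rintro hv j ⟨hj, hq⟩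
      rw [getD_map_range hj, hchild hu.1 hχ h1 hq, decide_eq_true_iff]
      exact hv _ hlt
  | call f =>
    have hK := φ.size_pos
    rw [Bool.eq_iff_iff, decide_eq_true_iff]
    simp only [gate, Gate.value, List.any_eq_true, List.mem_filter, List.mem_range,
      decide_eq_true_eq, Eval, ← hN]
    have hqle := Nat.div_mul_le_self (g / base N ^ D) φ.size
    obtain hℓ | ⟨ℓ, hℓ⟩ : g / base N ^ D / φ.size = 0 ∨ ∃ ℓ, g / base N ^ D / φ.size = ℓ + 1 := by
      cases g / base N ^ D / φ.size <;> simp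
    -- In round zero there is no earlier gate to call, so the disjunction is empty and false, like
    -- stage `0`.
    · rw [hℓ]
      simp only [stage, iff_false]
      rintro ⟨j, ⟨-, hj, -⟩, -⟩
      rw [hℓ, zero_mul] at hj
      exact absurd hj (Nat.succ_ne_zero _)
    · have hv : ∀ j, CallChild D φ.size N f g j → (val j = true ↔
          φ.stage D w (g / base N ^ D / φ.size)
            (normEnv (base N) D (f N (decEnv (base N) D (g % base N ^ D))))) := by
        intro j hj
        -- The called gate is in the last block of the previous round, and the last subformula is
        -- `φ` itself.
        have e : j / base N ^ D = φ.size - 1 + φ.size * ℓ := by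
          have := hj.1
          rw [hℓ, add_mul, one_mul, mul_comm] at this
          omega
        have e1 : j / base N ^ D / φ.size = ℓ := by
          rw [e, Nat.add_mul_div_left _ _ hK, Nat.div_eq_of_lt (by omega), zero_add]
        have e2 : j / base N ^ D % φ.size = φ.size - 1 := by
          rw [e, Nat.add_mul_mod_self_left, Nat.mod_eq_of_lt (by omega)]
        have e3 : φ.flat.getD (φ.size - 1) φ = φ := by
          have := flat_getElem?_last (φ := φ) (l := []) (l' := []) (n := φ.size - 1)
            (by simp only [List.length_nil]; omega)
          simp only [List.nil_append, List.append_nil] at this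
          rw [List.getD_eq_getElem?_getD, this]
          rfl
        have e4 : decEnv (base N) D (j % base N ^ D) =
            normEnv (base N) D (f N (decEnv (base N) D (g % base N ^ D))) := by
          funext i
          by_cases hi : i < D
          · exact hj.2 i hi
          · rw [decEnv_apply_of_le hi, normEnv, if_neg hi]
        rw [hval, decide_eq_true_iff, e1, e2, e3, e4, hℓ]
        rfl
      constructor
      · rintro ⟨j, ⟨hj, hc⟩, hvj⟩
        rw [getD_map_range hj] at hvj
        exact (hv j hc).1 hvj
      · intro hs
        obtain ⟨a, ha, hae⟩ := exists_decEnv (D := D) hb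
          (f N (decEnv (base N) D (g % base N ^ D)))
        obtain ⟨q, hq⟩ : ∃ q, g / base N ^ D / φ.size * φ.size = q + 1 :=
          Nat.exists_eq_succ_of_ne_zero (by
            rw [hℓ]
            exact (Nat.mul_pos (Nat.succ_pos _) hK).ne')
        have e1 : (q * base N ^ D + a) / base N ^ D = q := by
          rw [mul_comm, Nat.mul_add_div hA, Nat.div_eq_of_lt ha, add_zero]
        have e2 : (q * base N ^ D + a) % base N ^ D = a := by
          rw [mul_comm, Nat.mul_add_mod, Nat.mod_eq_of_lt ha]
        have hc : CallChild D φ.size N f g (q * base N ^ D + a) :=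
          ⟨by rw [e1, hq], fun j _ => by rw [e2, hae]⟩
        have hj : q * base N ^ D + a < g := by
          by_contra hlt
          have := Nat.div_le_div_right (c := base N ^ D) (not_lt.1 hlt)
          omega
        refine ⟨_, ⟨hj, hc⟩, ?_⟩
        rw [getD_map_range hj]
        exact (hv _ hc).2 hs

end

theorem wellFormed_circuit (φ : Fml) (D N : ℕ) {T : ℕ} (hT : 0 < T) :
    (φ.circuit D T N).WellFormed N := by
  have hA : 0 < base N ^ D := pow_pos (base_pos N) D
  have hpos : 0 < T * φ.size * base N ^ D := Nat.mul_pos (Nat.mul_pos hT φ.size_pos) hA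
  refine ⟨fun h => ?_, fun m hm => ?_⟩
  · have := congrArg List.length h
    simp only [circuit, List.length_map, List.length_range, List.length_nil] at this
    omega
  · simp only [circuit, List.getElem_map, List.getElem_range]
    have hd := deps_gate (φ := φ) (D := D) (N := N) (g := m) rfl
    generalize hψ : φ.flat.getD (m / base N ^ D % φ.size) φ = ψ at hd ⊢
    have hin : ∀ i, ψ.gate D φ.size N m = .input i → i < N := by
      intro i hi
      cases ψ <;> simp only [gate] at hi <;> try split at hi
      all_goals simp at hi
      omega
    generalize ψ.gate D φ.size N m = G at hd hin
    cases G with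
    | input i => exact hin i rfl
    | not j => exact (hd j (by simp [Gate.deps])).1
    | and js | or js => exact fun j hj => (hd j hj).1

theorem depth_circuit (φ : Fml) (D N T : ℕ) : (φ.circuit D T N).depth ≤ T * φ.size := by
  have hA : 0 < base N ^ D := pow_pos (base_pos N) D
  obtain ⟨h₁, h₂⟩ := Circuit.depths_map (T := T * φ.size * base N ^ D)
    (gate := fun g => (φ.flat.getD (g / base N ^ D % φ.size) φ).gate D φ.size N g)
    (bnd := fun g => g / base N ^ D + 1)
    (fun g _ ds hds => Gate.depth_le fun j hj => by
      obtain ⟨h, h'⟩ := deps_gate (φ := φ) rfl j hj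
      exact (hds j h).trans h')
  refine foldr_max_le fun d hd => ?_
  obtain ⟨j, hj, rfl⟩ := List.mem_iff_getElem.1 hd
  have hj' : j < T * φ.size * base N ^ D := by rwa [← h₁]
  have : (φ.circuit D T N).depths.getD j 0 ≤ j / base N ^ D + 1 := h₂ j hj'
  rw [List.getD_eq_getElem _ _ hj] at this
  exact this.trans ((Nat.div_lt_iff_lt_mul hA).2 hj')

theorem output_circuit {φ : Fml} {D T : ℕ} (hφ : φ.Uniform D) (hT : 0 < T) (w : List Bool) :
    (φ.circuit D T w.length).output w = true ↔
      φ.stage D w T (fun i => if i < D then base w.length - 1 else 0) := by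
  classical
  have hA : 0 < base w.length ^ D := pow_pos (base_pos _) D
  have hK := φ.size_pos
  set val : ℕ → Bool := fun j => decide ((φ.flat.getD (j / base w.length ^ D % φ.size) φ).Eval D w
    (φ.stage D w (j / base w.length ^ D / φ.size))
    (decEnv (base w.length) D (j % base w.length ^ D))) with hval
  rw [Circuit.output, circuit, Circuit.values_map (val := val)
    fun g _ => value_gate hφ rfl rfl fun j => rfl]
  obtain ⟨t, rfl⟩ := Nat.exists_eq_succ_of_ne_zero hT.ne'
  obtain ⟨k, hk⟩ := Nat.exists_eq_succ_of_ne_zero hK.ne'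
  obtain ⟨A, hAe⟩ := Nat.exists_eq_succ_of_ne_zero hA.ne'
  simp only [Nat.succ_eq_add_one] at hk hAe ⊢
  -- The last gate belongs to the last round `t`, the last subformula `k` and the greatest code `A`.
  have e : (t + 1) * φ.size * base w.length ^ D =
      (t * φ.size + k) * base w.length ^ D + A + 1 := by
    rw [add_assoc, ← hAe, hk]
    ring
  rw [e, List.range_succ, List.map_append, List.map_singleton, List.getLastD_concat, hval,
    decide_eq_true_iff]
  have e1 : ((t * φ.size + k) * base w.length ^ D + A) / base w.length ^ D = t * φ.size + k := by
    rw [mul_comm, Nat.mul_add_div hA, Nat.div_eq_of_lt (by omega), add_zero]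
  have e2 : ((t * φ.size + k) * base w.length ^ D + A) % base w.length ^ D = A := by
    rw [mul_comm, Nat.mul_add_mod, Nat.mod_eq_of_lt (by omega)]
  have e3 : (t * φ.size + k) / φ.size = t := by
    rw [mul_comm, Nat.mul_add_div hK, Nat.div_eq_of_lt (by omega), add_zero]
  have e4 : (t * φ.size + k) % φ.size = k := by
    rw [mul_comm, Nat.mul_add_mod, Nat.mod_eq_of_lt (by omega)]
  have e5 : φ.flat.getD k φ = φ := by
    have := flat_getElem?_last (φ := φ) (l := []) (l' := []) (n := k)
      (by simp only [List.length_nil]; omega)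
    simp only [List.nil_append, List.append_nil] at this
    rw [List.getD_eq_getElem?_getD, this]
    rfl
  have e6 : A = base w.length ^ D - 1 := by omega
  rw [e1, e2, e3, e4, e5, e6, decEnv_last (base_pos _)]
  rfl

/-- Languages defined by iterating a formula for `O(log log n)` rounds are in `FOLL`. -/
theorem mem_FOLL {φ : Fml} {D : ℕ} (hφ : φ.Uniform D) (r : ℕ) {A : Language Bool}
    (hA : ∀ w : List Bool, w ∈ A ↔ φ.stage D w (Nat.log 2 (Nat.log 2 w.length) + r + 1)
      (fun i => if i < D then base w.length - 1 else 0)) : A ∈ FOLL := by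
  set T : ℕ → ℕ := fun N => Nat.log 2 (Nat.log 2 N) + r + 1 with hT
  -- One constant serves as factor and as exponent: the size is at most `(r + 2) * φ.size * (N + 2)
  -- ^ (2 * D + 1)`, and `N + 2 ≤ 3 * N` unless `N = 0`.
  set c := (r + 2) * φ.size * 3 ^ (2 * D + 1) + 2 * D + 1 with hc
  refine ⟨fun N => φ.circuit D (T N) N, c, ?_, fun N => ⟨?_, ?_, ?_⟩, fun w => ?_⟩
  · have := logSpaceOnUnary (hφ.emits_circuit (α := List Bool)
      (((LS.length.log.log).add (LS.const r)).succ))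
    simpa [inp] using this
  · exact wellFormed_circuit φ D N (Nat.succ_pos _)
  · have h1 : T N ≤ (r + 2) * (N + 2) := by
      have h1 := Nat.log_le_self 2 N
      have h2 := Nat.log_le_self 2 (Nat.log 2 N)
      simp only [hT]
      nlinarith
    have h2 : T N * φ.size * base N ^ D ≤ (r + 2) * φ.size * (N + 2) ^ (2 * D + 1) := by
      rw [base, ← pow_mul, pow_succ]
      calc T N * φ.size * (N + 2) ^ (2 * D)
          ≤ (r + 2) * (N + 2) * φ.size * (N + 2) ^ (2 * D) := by gcongr
        _ = _ := by ring
    have h3 : (N + 2) ^ (2 * D + 1) ≤ 3 ^ (2 * D + 1) * (N ^ c + 1) := by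
      rcases Nat.eq_zero_or_pos N with rfl | hN
      · have : 2 ^ (2 * D + 1) ≤ 3 ^ (2 * D + 1) := Nat.pow_le_pow_left (by omega) _
        rw [zero_add]
        exact this.trans (Nat.le_mul_of_pos_right _ (Nat.succ_pos _))
      · calc (N + 2) ^ (2 * D + 1) ≤ (3 * N) ^ (2 * D + 1) := Nat.pow_le_pow_left (by omega) _
          _ = 3 ^ (2 * D + 1) * N ^ (2 * D + 1) := mul_pow _ _ _
          _ ≤ 3 ^ (2 * D + 1) * (N ^ c + 1) := by
            gcongr
            exact (Nat.pow_le_pow_right hN (by omega)).trans (Nat.le_succ _)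
    have h4 : (φ.circuit D (T N) N).length = T N * φ.size * base N ^ D := by simp [circuit]
    rw [h4]
    calc T N * φ.size * base N ^ D ≤ (r + 2) * φ.size * (N + 2) ^ (2 * D + 1) := h2
      _ ≤ (r + 2) * φ.size * (3 ^ (2 * D + 1) * (N ^ c + 1)) := by gcongr
      _ = (r + 2) * φ.size * 3 ^ (2 * D + 1) * (N ^ c + 1) := by ring
      _ ≤ c * (N ^ c + 1) := by
        gcongr
        omega
      _ = _ := by ring
  · refine (depth_circuit φ D N (T N)).trans ?_
    have h3 : 1 ≤ 3 ^ (2 * D + 1) := Nat.one_le_pow _ _ (by omega)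
    have h4 : (r + 2) * φ.size ≤ c := by nlinarith
    simp only [hT]
    nlinarith [Nat.zero_le (Nat.log 2 (Nat.log 2 N)), Nat.zero_le (φ.size * r *
      Nat.log 2 (Nat.log 2 N)), Nat.mul_le_mul_right (Nat.log 2 (Nat.log 2 N)) h4]
  · rw [hA, output_circuit hφ (Nat.succ_pos _)]

end Fml

/-! ### Walks in quasigroups -/

/-- The composition of the maps `f i, …, f (i + s - 1)`. -/
def walk {G : Type*} (f : ℕ → G → G) (i : ℕ) : ℕ → G → G
  | 0, u => u
  | s + 1, u => f (i + s) (walk f i s u)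

theorem walk_add {G : Type*} (f : ℕ → G → G) (i s t : ℕ) (u : G) :
    walk f i (s + t) u = walk f (i + s) t (walk f i s u) := by
  induction t with
  | zero => rfl
  | succ t ih => rw [← Nat.add_assoc, walk, walk, ih, Nat.add_assoc]

theorem walk_congr {G : Type*} {f g : ℕ → G → G} {i s : ℕ} (h : ∀ j < s, f (i + j) = g (i + j))
    (u : G) : walk f i s u = walk g i s u := by
  induction s with
  | zero => rfl
  | succ s ih => rw [walk, walk, ih fun j hj => h j (by omega), h s (by omega)]

section

variable {G : Type*} {op : G → G → G}

namespace IsQuasigroup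

theorem left_inj (hq : IsQuasigroup op) {a x y : G} (h : op a x = op a y) : x = y :=
  (hq a (op a y)).1.unique h rfl

theorem right_inj (hq : IsQuasigroup op) {a x y : G} (h : op x a = op y a) : x = y :=
  (hq a (op y a)).2.unique h rfl

/-- Left multiplication as a bijection. -/
noncomputable def mulLeft (hq : IsQuasigroup op) (a : G) : G ≃ G :=
  Equiv.ofBijective (op a) ⟨fun _ _ h => hq.left_inj h, fun b => (hq a b).1.exists⟩

/-- Right multiplication as a bijection. -/
noncomputable def mulRight (hq : IsQuasigroup op) (a : G) : G ≃ G :=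
  Equiv.ofBijective (op · a) ⟨fun _ _ h => hq.right_inj h, fun b => (hq a b).2.exists⟩

theorem mulRight_symm (hq : IsQuasigroup op) (a u : G) : op ((hq.mulRight a).symm u) a = u :=
  (hq.mulRight a).apply_symm_apply u

/-- The map `u ↦ (u / b) h`. -/
noncomputable def shift (hq : IsQuasigroup op) (b h u : G) : G := op ((hq.mulRight b).symm u) h

theorem shift_eq_iff (hq : IsQuasigroup op) {b h u v : G} :
    hq.shift b h u = v ↔ ∃ z, op z b = u ∧ op z h = v := by
  constructor
  · exact fun h => ⟨_, hq.mulRight_symm b u, h⟩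
  · rintro ⟨z, rfl, rfl⟩
    exact congrArg (op · h) ((hq.mulRight b).symm_apply_apply z)

/-- The shifts by `h 0, h 1, …` that are selected by the bits of `e`. -/
noncomputable def pick (hq : IsQuasigroup op) (b : G) (h : ℕ → G) (e i : ℕ) (u : G) : G :=
  if e.testBit i then hq.shift b (h i) u else u

/-- Some shift enlarges a set such that the relative size of the complement is squared. -/
theorem exists_shift [Fintype G] [DecidableEq G] [Nonempty G] (hq : IsQuasigroup op) (b : G)
    (S : Finset G) : ∃ g, Fintype.card G * (S ∪ S.image (hq.shift b g))ᶜ.card ≤ Sᶜ.card ^ 2 := by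
  by_contra! hcon
  have hn : 0 < Fintype.card G := Fintype.card_pos
  -- Double counting of the pairs of `g` and a point `z` outside `S` that the shift by `g` does not
  -- reach: each `z` is missed by at most `|Sᶜ|` choices of `g`.
  have h1 : ∑ g : G, (S ∪ S.image (hq.shift b g))ᶜ.card ≤ Sᶜ.card ^ 2 := by
    have e : ∀ g : G, (S ∪ S.image (hq.shift b g))ᶜ.card =
        ∑ z ∈ Sᶜ, if z ∈ S.image (hq.shift b g) then 0 else 1 := by
      intro g
      rw [Finset.compl_union, ← Finset.filter_mem_eq_inter, Finset.card_filter]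
      refine Finset.sum_congr rfl fun z _ => ?_
      by_cases h : z ∈ S.image (hq.shift b g) <;> simp [h]
    rw [Finset.sum_congr rfl fun g _ => e g, Finset.sum_comm, sq, ← smul_eq_mul]
    refine Finset.sum_le_card_nsmul _ _ _ fun z _ => ?_
    have e2 : (∑ g : G, if z ∈ S.image (hq.shift b g) then 0 else 1) =
        (Finset.univ.filter fun g => z ∉ S.image (hq.shift b g)).card := by
      rw [Finset.card_filter]
      refine Finset.sum_congr rfl fun g _ => ?_
      by_cases h : z ∈ S.image (hq.shift b g) <;> simp [h]
    rw [e2]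
    have hex : ∀ x, ∃ g, op ((hq.mulRight b).symm x) g = z := fun x => (hq _ z).1.exists
    -- The element `q x` shifts `x` to `z`. As `q` is injective, at least `|S|` choices of `g` cover
    -- `z` from `S`.
    choose q hqx using hex
    have hinj : Function.Injective q := by
      intro x y hxy
      have h2 := (hqx x).trans (hqx y).symm
      rw [hxy] at h2
      exact (hq.mulRight b).symm.injective (hq.right_inj h2)
    rw [Finset.card_compl, ← Finset.card_image_of_injective S hinj, ← Finset.card_compl]
    refine Finset.card_le_card fun g hg => ?_
    rw [Finset.mem_compl]
    intro hgm
    obtain ⟨x, hx, rfl⟩ := Finset.mem_image.1 hgm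
    exact (Finset.mem_filter.1 hg).2 (Finset.mem_image.2 ⟨x, hx, hqx x⟩)
  have h2 : ∑ g : G, Sᶜ.card ^ 2 <
      ∑ g : G, Fintype.card G * (S ∪ S.image (hq.shift b g))ᶜ.card :=
    Finset.sum_lt_sum_of_nonempty Finset.univ_nonempty fun g _ => hcon g
  rw [← Finset.mul_sum, Finset.sum_const, Finset.card_univ, smul_eq_mul] at h2
  exact absurd (Nat.mul_le_mul_left (Fintype.card G) h1) (not_le.2 h2)

/-- Every quasigroup of order `n` has a sequence of `2 ⌈log₂ n⌉` elements such that the selections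
of shifts by these elements take a given element everywhere. -/
theorem exists_cube [Fintype G] [Nonempty G] (hq : IsQuasigroup op) (b u₀ : G) :
    ∃ h : ℕ → G, ∀ v, ∃ e < 2 ^ (2 * Nat.clog 2 (Fintype.card G)),
      walk (hq.pick b h e) 0 (2 * Nat.clog 2 (Fintype.card G)) u₀ = v := by
  classical
  set n := Fintype.card G with hn
  have hn0 : 0 < n := Fintype.card_pos
  choose g hg using hq.exists_shift b
  let S : ℕ → Finset G := fun k => Nat.rec {u₀} (fun _ S => S ∪ S.image (hq.shift b (g S))) k
  have hS : ∀ k, S (k + 1) = S k ∪ (S k).image (hq.shift b (g (S k))) := fun _ => rfl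
  -- It starts with `1 - 1/n ≤ exp (-1/n)`; squaring the relative size doubles the exponent.
  have hcard : ∀ k, ((S k)ᶜ.card : ℝ) ≤ n * Real.exp (-(2 ^ k / n)) := by
    have hnR : (0 : ℝ) < n := by exact_mod_cast hn0
    intro k
    induction k with
    | zero =>
      have h1 : (S 0)ᶜ.card = n - 1 := by
        rw [Finset.card_compl, ← hn]
        simp [S]
      rw [h1, Nat.cast_sub hn0, pow_zero, Nat.cast_one]
      have := Real.add_one_le_exp (-(1 / n : ℝ))
      have h2 : (n : ℝ) * (-(1 / n) + 1) = n - 1 := by field_simp; ring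
      rw [← h2]
      gcongr
    | succ k ih =>
      have h1 : ((n : ℝ) * (S (k + 1))ᶜ.card) ≤ ((S k)ᶜ.card : ℝ) ^ 2 := by
        exact_mod_cast hg (S k)
      have h2 : ((S k)ᶜ.card : ℝ) ^ 2 ≤ (n * Real.exp (-(2 ^ k / n))) ^ 2 := by gcongr
      have h3 : ((n : ℝ) * Real.exp (-(2 ^ k / n))) ^ 2 =
          n * (n * Real.exp (-(2 ^ (k + 1) / n))) := by
        rw [mul_pow, ← Real.exp_nat_mul]
        have : ((2 : ℕ) : ℝ) * -(2 ^ k / n) = -(2 ^ (k + 1) / n) := by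
          rw [pow_succ]; push_cast; ring
        rw [this]
        ring
      exact le_of_mul_le_mul_left (h1.trans (h2.trans h3.le)) hnR
  have hfull : S (2 * Nat.clog 2 n) = Finset.univ := by
    have hnR : (0 : ℝ) < n := by exact_mod_cast hn0
    have h1 := hcard (2 * Nat.clog 2 n)
    have h2 : (n : ℝ) ≤ 2 ^ Nat.clog 2 n := by exact_mod_cast Nat.le_pow_clog (by omega) n
    -- Twice the logarithm is needed to make the exponent at least `n`, so that fewer than one
    -- element is missing.
    have h3 : (n : ℝ) ≤ 2 ^ (2 * Nat.clog 2 n) / n := by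
      rw [le_div_iff₀ hnR, mul_comm 2, pow_mul, sq]
      gcongr
    have h4 : (n : ℝ) * Real.exp (-(2 ^ (2 * Nat.clog 2 n) / n)) < 1 := by
      have h5 : (n : ℝ) < Real.exp (2 ^ (2 * Nat.clog 2 n) / n) := by
        have := Real.add_one_le_exp ((2 : ℝ) ^ (2 * Nat.clog 2 n) / n)
        linarith
      rw [Real.exp_neg, ← div_eq_mul_inv, div_lt_one (Real.exp_pos _)]
      exact h5
    have h6 : (S (2 * Nat.clog 2 n))ᶜ.card = 0 := by
      have : ((S (2 * Nat.clog 2 n))ᶜ.card : ℝ) < 1 := h1.trans_lt h4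
      have : (S (2 * Nat.clog 2 n))ᶜ.card < 1 := by exact_mod_cast this
      omega
    rwa [Finset.card_eq_zero, Finset.compl_eq_empty_iff] at h6
  refine ⟨fun k => g (S k), fun v => ?_⟩
  suffices key : ∀ k, ∀ v ∈ S k, ∃ e < 2 ^ k,
      walk (hq.pick b (fun k => g (S k)) e) 0 k u₀ = v from
    key _ v (hfull ▸ Finset.mem_univ v)
  intro k
  induction k with
  | zero =>
    intro v hv
    exact ⟨0, by simp, (Finset.mem_singleton.1 hv).symm⟩
  | succ k ih =>
    intro v hv
    rw [hS, Finset.mem_union] at hv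
    rcases hv with hv | hv
    · obtain ⟨e, he, rfl⟩ := ih v hv
      refine ⟨e, by rw [pow_succ]; omega, ?_⟩
      rw [walk, pick, Nat.zero_add, Nat.testBit_lt_two_pow he]
      rfl
    · obtain ⟨u, hu, rfl⟩ := Finset.mem_image.1 hv
      obtain ⟨e, he, rfl⟩ := ih u hu
      -- Bit `k` records that step `k` is taken; the lower bits, and so the earlier steps, are
      -- unchanged.
      refine ⟨2 ^ k + e, by rw [pow_succ]; omega, ?_⟩
      have hk : (2 ^ k + e).testBit k = true := by
        rw [Nat.testBit_two_pow_add_eq, Nat.testBit_lt_two_pow he]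
        rfl
      rw [walk, pick, Nat.zero_add, hk, if_pos rfl, walk_congr (g := hq.pick b _ e)]
      intro j hj
      funext u
      rw [pick, pick, Nat.zero_add, Nat.testBit_two_pow_add_gt hj]

end IsQuasigroup

end

/-! ### Certificates for isotopy -/

/-- The equation `T e₃ = (T e₁ / b) (a \ T e₂)`. -/
def Triple {X G : Type*} (op : G → G → G) (a b : G) (T : X → G) (e₁ e₂ e₃ : X) : Prop :=
  ∃ x y, op x b = T e₁ ∧ op a y = T e₂ ∧ op x y = T e₃

/-- The third entry of a triple in `H` is determined by the names of the first two. Hence `T' e`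
depends only on `T e`, which defines γ; it is onto and so bijective by cardinality. The rest is
forced: α x = γ(x b) / b' and β y = a' \ γ(a y). An implication in one direction is enough. -/
theorem isotopic_of_triple {X G H : Type*} [Fintype G] [Fintype H] {op₁ : G → G → G}
    {op₂ : H → H → H} (h₁ : IsQuasigroup op₁) (h₂ : IsQuasigroup op₂)
    (hcard : Fintype.card G = Fintype.card H) {a b : G} {a' b' : H} {T : X → G} {T' : X → H}
    (hT : Function.Surjective T) (hT' : Function.Surjective T')
    (h : ∀ e₁ e₂ e₃, Triple op₁ a b T e₁ e₂ e₃ → Triple op₂ a' b' T' e₁ e₂ e₃) :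
    Isotopic op₁ op₂ := by
  choose r hr using hT
  have hwd : ∀ e e', T e = T e' → T' e = T' e' := by
    intro e e' hee
    obtain ⟨y, hy⟩ := (h₁ b (T e)).1.exists
    -- Both `e` and `e'` are third entries of triples with the same first two names, namely those
    -- for `x = b` and the `y` with `b y = T e`.
    obtain ⟨x₁, y₁, hx₁, hy₁, hz₁⟩ := h (r (op₁ b b)) (r (op₁ a y)) e
      ⟨b, y, (hr _).symm, (hr _).symm, hy⟩
    obtain ⟨x₂, y₂, hx₂, hy₂, hz₂⟩ := h (r (op₁ b b)) (r (op₁ a y)) e'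
      ⟨b, y, (hr _).symm, (hr _).symm, hy.trans hee⟩
    rw [← hz₁, ← hz₂, h₂.right_inj (hx₁.trans hx₂.symm), h₂.left_inj (hy₁.trans hy₂.symm)]
  have hsurj : Function.Surjective fun g => T' (r g) := by
    intro v
    obtain ⟨e, rfl⟩ := hT' v
    exact ⟨T e, hwd _ _ (hr _)⟩
  let γ : G ≃ H := Equiv.ofBijective _
    ((Fintype.bijective_iff_surjective_and_card _).2 ⟨hsurj, hcard⟩)
  refine ⟨(h₁.mulRight b).trans (γ.trans (h₂.mulRight b').symm),
    (h₁.mulLeft a).trans (γ.trans (h₂.mulLeft a').symm), γ, fun x y => ?_⟩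
  obtain ⟨x', y', hx', hy', hz'⟩ := h (r (op₁ x b)) (r (op₁ a y)) (r (op₁ x y))
    ⟨x, y, (hr _).symm, (hr _).symm, (hr _).symm⟩
  have hx : (h₂.mulRight b').symm (γ (op₁ x b)) = x' := by
    rw [Equiv.symm_apply_eq]
    exact hx'.symm
  have hy : (h₂.mulLeft a').symm (γ (op₁ a y)) = y' := by
    rw [Equiv.symm_apply_eq]
    exact hy'.symm
  change op₂ ((h₂.mulRight b').symm (γ (op₁ x b))) ((h₂.mulLeft a').symm (γ (op₁ a y))) = _
  rw [hx, hy]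
  exact hz'

/-- If u = z b, then γ u = α(z) β(b) and γ(z h) = α(z) β(h). So γ intertwines the shift by `h`
relative to `b` with the shift by `β h` relative to `β b`. -/
theorem walk_isotopy {G H : Type*} {op₁ : G → G → G} {op₂ : H → H → H} (h₁ : IsQuasigroup op₁)
    (h₂ : IsQuasigroup op₂) {α β γ : G ≃ H} (h : ∀ x y, op₂ (α x) (β y) = γ (op₁ x y)) (b : G)
    (g : ℕ → G) (e i s : ℕ) (u : G) :
    walk (h₂.pick (β b) (fun i => β (g i)) e) i s (γ u) = γ (walk (h₁.pick b g e) i s u) := by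
  induction s with
  | zero => rfl
  | succ s ih =>
    rw [walk, walk, ih, IsQuasigroup.pick, IsQuasigroup.pick]
    split
    · rw [IsQuasigroup.shift_eq_iff]
      refine ⟨α ((h₁.mulRight b).symm _), ?_, h _ _⟩
      rw [h, h₁.mulRight_symm]
    · rfl

open Ctx

/-! ### Positions in the encoding -/

theorem pair_cons (b : Bool) (x y : List Bool) : pair (b :: x) y = true :: b :: pair x y := rfl

theorem length_pair (x y : List Bool) : (pair x y).length = 2 * x.length + 1 + y.length := by
  induction x with
  | nil => simp [pair]; omega
  | cons b x ih => simp [pair_cons, ih]; omega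

theorem pair_getD_even {x : List Bool} (y : List Bool) {i : ℕ} (h : i < x.length) :
    (pair x y).getD (2 * i) false = true := by
  induction x generalizing i with
  | nil => simp at h
  | cons b x ih =>
    cases i with
    | zero => rfl
    | succ i =>
      rw [pair_cons, Nat.mul_succ, List.getD_cons_succ, List.getD_cons_succ]
      exact ih (Nat.lt_of_succ_lt_succ h)

theorem pair_getD_odd {x : List Bool} (y : List Bool) {i : ℕ} (h : i < x.length) :
    (pair x y).getD (2 * i + 1) false = x.getD i false := by
  induction x generalizing i with
  | nil => simp at h
  | cons b x ih =>
    cases i with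
    | zero => rfl
    | succ i =>
      rw [pair_cons, Nat.mul_succ, List.getD_cons_succ, List.getD_cons_succ, List.getD_cons_succ]
      exact ih (Nat.lt_of_succ_lt_succ h)

theorem pair_getD_mid (x y : List Bool) : (pair x y).getD (2 * x.length) false = false := by
  induction x with
  | nil => rfl
  | cons b x ih =>
    rw [pair_cons, List.length_cons, Nat.mul_succ, List.getD_cons_succ, List.getD_cons_succ, ih]

theorem pair_getD_right (x y : List Bool) (i : ℕ) :
    (pair x y).getD (2 * x.length + 1 + i) false = y.getD i false := by
  induction x with
  | nil =>
    rw [show 2 * ([] : List Bool).length + 1 + i = i + 1 by simp; omega]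
    rfl
  | cons b x ih =>
    rw [pair_cons, List.length_cons,
      show 2 * (x.length + 1) + 1 + i = 2 * x.length + 1 + i + 2 by omega,
      List.getD_cons_succ, List.getD_cons_succ, ih]

theorem length_flatMap_const {β : Type*} {F : β → List Bool} {m : ℕ} (hF : ∀ a, (F a).length = m)
    (l : List β) : (l.flatMap F).length = l.length * m := by
  induction l with
  | nil => simp
  | cons a l ih => simp [ih, hF]; ring

theorem getD_flatMap_const {β : Type*} {F : β → List Bool} {m : ℕ} (hF : ∀ a, (F a).length = m)
    {l : List β} {i j : ℕ} (hi : i < l.length) (hj : j < m) :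
    (l.flatMap F).getD (i * m + j) false = (F l[i]).getD j false := by
  induction l generalizing i with
  | nil => simp at hi
  | cons a l ih =>
    rw [List.flatMap_cons]
    cases i with
    | zero =>
      rw [List.getD_append _ _ _ _ (by rw [hF]; omega)]
      simp
    | succ i =>
      rw [List.getD_append_right _ _ _ _ (by rw [hF]; nlinarith), hF,
        show (i + 1) * m + j - m = i * m + j by rw [Nat.succ_mul]; omega,
        ih (Nat.lt_of_succ_lt_succ hi)]
      rfl

theorem length_encodeTable {n : ℕ} (op : Fin n → Fin n → Fin n) :
    (encodeTable op).length = n * n * Nat.clog 2 n := by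
  rw [encodeTable, length_flatMap_const (m := n * Nat.clog 2 n)]
  · simp [mul_assoc]
  · intro i
    rw [length_flatMap_const (m := Nat.clog 2 n)]
    · simp
    · intro j
      simp

theorem encodeTable_getD {n : ℕ} (op : Fin n → Fin n → Fin n) (a b : Fin n) {t : ℕ}
    (ht : t < Nat.clog 2 n) :
    (encodeTable op).getD ((a * n + b) * Nat.clog 2 n + t) false = (op a b : ℕ).testBit t := by
  have h1 : ∀ i j : Fin n,
      ((List.range (Nat.clog 2 n)).map fun t => (op i j : ℕ).testBit t).length = Nat.clog 2 n :=
    fun i j => by simp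
  have h2 : ∀ i : Fin n, ((List.finRange n).flatMap fun j =>
      (List.range (Nat.clog 2 n)).map fun t => (op i j : ℕ).testBit t).length =
        n * Nat.clog 2 n := fun i => by
    rw [length_flatMap_const (h1 i)]
    simp
  have hlt : b * Nat.clog 2 n + t < n * Nat.clog 2 n := by
    have := b.2
    nlinarith
  rw [encodeTable, show (a * n + b) * Nat.clog 2 n + t =
      a * (n * Nat.clog 2 n) + (b * Nat.clog 2 n + t) by ring,
    getD_flatMap_const h2 (by simp) hlt, getD_flatMap_const (h1 _) (by simp) ht]
  simp [ht]

/-- The number of bits of a table. -/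
def tableBits (n : ℕ) : ℕ := n * n * Nat.clog 2 n

/-- The length of the encoding of two tables. -/
def inputBits (n : ℕ) : ℕ := 3 * tableBits n + 1

/-- The position of bit `t` of entry `(a, b)` of table `j`. -/
def tablePos (n j a b t : ℕ) : ℕ :=
  -- The first table passes through the odd positions of two nested pairs, p ↦ 2(2p + 1) + 1. The
  -- second is copied plainly by the inner pair, after the doubled first table and the separator.
  if j = 0 then 4 * ((a * n + b) * Nat.clog 2 n + t) + 3
  else 2 * (2 * tableBits n + 1 + ((a * n + b) * Nat.clog 2 n + t)) + 1

/-- The position of bit `t` of element `i` of row `j` of the certificate. -/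
def certPos (n j i t : ℕ) : ℕ :=
  2 * inputBits n + 1 + ((j * (2 * Nat.clog 2 n + 3) + i) * Nat.clog 2 n + t)

/-- Entry `(a, b)` of table `j` is `c`. -/
def OpRel (w : List Bool) (n j a b c : ℕ) : Prop :=
  ∀ t < Nat.clog 2 n, w.getD (tablePos n j a b t) false = c.testBit t

/-- Element `i` of row `j` of the certificate is `c`. -/
def CertRel (w : List Bool) (n j i c : ℕ) : Prop :=
  ∀ t < Nat.clog 2 n, w.getD (certPos n j i t) false = c.testBit t

/-! ### The formula -/

/-- The assignment for a call about the walk of `s` steps from `u` to `v`. -/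
def pathEnv (n j e s i u v : ℕ) : Env
  | 0 => 1
  | 1 => n
  | 2 => j
  | 3 => e
  | 4 => s
  | 5 => i
  | 6 => u
  | 7 => v
  | _ => 0

namespace Fml

/-- Quantification over the numbers below variable `1`. -/
def exN (i : ℕ) (φ : Fml) : Fml := ex i (and (num fun _ v => v i < v 1) φ)

/-- Quantification over the numbers below variable `1`. -/
def allN (i : ℕ) (φ : Fml) : Fml := all i (or (num fun _ v => v 1 ≤ v i) φ)

/-- The bits of `w` from the position `pos` on are those of variable `c`, where the position of bit
`t` depends on `t`, which is variable `9`. -/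
def bitsF (pos : Env → ℕ) (c : ℕ) : Fml :=
  all 9 (or (num fun _ v => Nat.clog 2 (v 1) ≤ v 9)
    (or (and (lit fun _ v => pos v) (num fun _ v => (v c).testBit (v 9) = true))
      (and (not (lit fun _ v => pos v)) (num fun _ v => ¬ (v c).testBit (v 9) = true))))

/-- Entry `(a, b)` of the table is `c`. -/
def opF (a b c : ℕ) : Fml := bitsF (fun v => tablePos (v 1) (v 2) (v a) (v b) (v 9)) c

/-- Element `d` of the certificate is `c`. -/
def certF (d c : ℕ) : Fml := bitsF (fun v => certPos (v 1) (v 2) d (v 9)) c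

/-- One step of the walk. -/
def stepF : Fml :=
  or (num fun _ v => ¬ (v 3).testBit (v 5) = true ∧ v 6 = v 7)
    (and (num fun _ v => (v 3).testBit (v 5) = true)
      (exN 10 (exN 11 (exN 12 (and (certF 1 10)
        (and (bitsF (fun v => certPos (v 1) (v 2) (v 5 + 3) (v 9)) 12)
          (and (opF 11 10 6) (opF 11 12 7))))))))

/-- A walk of several steps, by calls about its two halves. -/
def pathF : Fml :=
  or (num fun _ v => v 4 = 0 ∧ v 6 = v 7)
    (or (and (num fun _ v => v 4 = 1) stepF)
      (and (num fun _ v => 2 ≤ v 4) (exN 8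
        (and (call fun _ v => pathEnv (v 1) (v 2) (v 3) (v 4 / 2) (v 5) (v 6) (v 8))
          (call fun _ v => pathEnv (v 1) (v 2) (v 3) (v 4 - v 4 / 2) (v 5 + v 4 / 2) (v 8)
            (v 7))))))

/-- The walk given by variable `e` ends in variable `c`. -/
def endF (e c : ℕ) : Fml :=
  exN 6 (and (certF 2 6)
    (call fun _ v => pathEnv (v 1) (v 2) (v e) (2 * Nat.clog 2 (v 1)) 0 (v 6) (v c)))

/-- The equation between the ends of the walks given by variables `15`, `16`, `17` in row `j`. -/
def tripleF (j : ℕ) : Fml :=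
  -- Variable `2` selects the table and the certificate row in all subformulas, so it is bound to
  -- the constant `j` here.
  ex 2 (and (num fun _ v => v 2 = j) (exN 13 (exN 14 (exN 8
    (and (exN 10 (exN 7 (and (certF 1 10) (and (endF 15 7) (opF 13 10 7)))))
      (and (exN 10 (exN 7 (and (certF 0 10) (and (endF 16 7) (opF 10 14 7)))))
        (and (opF 13 14 8) (endF 17 8))))))))

/-- The input consists of two tables of order `n` and a certificate. -/
def formatF : Fml :=
  and (all 5 (or (num fun _ v => inputBits (v 1) ≤ v 5) (lit fun _ v => 2 * v 5)))
    (and (not (lit fun _ v => 2 * inputBits (v 1)))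
      (and (all 5 (or (num fun _ v => tableBits (v 1) ≤ v 5) (lit fun _ v => 4 * v 5 + 1)))
        (not (lit fun _ v => 4 * tableBits (v 1) + 1))))

/-- Table and row `j` (variable `2`) are valid, and the walks reach everything. -/
def validF : Fml :=
  and (allN 13 (allN 14 (exN 8 (opF 13 14 8))))
    (and (allN 13 (allN 8 (exN 14 (opF 13 14 8))))
      (and (allN 14 (allN 8 (exN 13 (opF 13 14 8))))
        (and (all 5 (or (num fun _ v => 2 * Nat.clog 2 (v 1) + 3 ≤ v 5)
            (exN 8 (bitsF (fun v => certPos (v 1) (v 2) (v 5) (v 9)) 8))))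
          (allN 8 (ex 15 (endF 15 8))))))

/-- The input is a pair of tables with a certificate for isotopy. -/
def mainF : Fml :=
  ex 1 (and (num fun _ v => 0 < v 1) (and formatF
    (and (all 2 (or (num fun _ v => 2 ≤ v 2) validF))
      (all 15 (all 16 (all 17 (or (not (tripleF 0)) (tripleF 1))))))))

/-- The formula to be iterated: variable `0` tells calls about walks from the main formula. -/
def isotopyF : Fml :=
  or (and (num fun _ v => v 0 = 1) pathF) (and (num fun _ v => ¬ v 0 = 1) mainF)

end Fml

/-! ### Uniformity of the formula -/

section

variable {α : Type} [Ctx α] {n j a b i t e s u v : α → ℕ}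

theorem LS.tableBits (hn : LS n) : LS (fun x => tableBits (n x)) := (hn.mul hn).mul hn.clog

theorem LS.inputBits (hn : LS n) : LS (fun x => inputBits (n x)) :=
  ((LS.const 3).mul hn.tableBits).succ

theorem LS.tablePos (hn : LS n) (hj : LS j) (ha : LS a) (hb : LS b) (ht : LS t) :
    LS (fun x => tablePos (n x) (j x) (a x) (b x) (t x)) := by
  have h := (((ha.mul hn).add hb).mul hn.clog).add ht
  exact LS.ite (LSP.eq hj LS.zero) (((LS.const 4).mul h).add (LS.const 3))
    ((((LS.const 2).mul (((LS.const 2).mul hn.tableBits).succ.add h)).succ))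

theorem LS.certPos (hn : LS n) (hj : LS j) (hi : LS i) (ht : LS t) :
    LS (fun x => certPos (n x) (j x) (i x) (t x)) :=
  (((LS.const 2).mul hn.inputBits).succ).add
    ((((hj.mul (((LS.const 2).mul hn.clog).add (LS.const 3))).add hi).mul hn.clog).add ht)

theorem LS.pathEnv (hn : LS n) (hj : LS j) (he : LS e) (hs : LS s) (hi : LS i) (hu : LS u)
    (hv : LS v) (k : ℕ) :
    LS (fun x => pathEnv (n x) (j x) (e x) (s x) (i x) (u x) (v x) k) :=
  match k with
  | 0 => LS.const 1
  | 1 => hn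
  | 2 => hj
  | 3 => he
  | 4 => hs
  | 5 => hi
  | 6 => hu
  | 7 => hv
  | _ + 8 => LS.zero

end

namespace Fml

/-- The number `18` is one more than the largest variable index, `17`, in `isotopyF`. -/
theorem uniform_exN {i : ℕ} {φ : Fml} (hi : i < 18) (h : φ.Uniform 18) : (exN i φ).Uniform 18 :=
  ⟨hi, fun hv => LSP.lt (hv i) (hv 1), h⟩

theorem uniform_allN {i : ℕ} {φ : Fml} (hi : i < 18) (h : φ.Uniform 18) : (allN i φ).Uniform 18 :=
  ⟨hi, fun hv => LSP.le (hv 1) (hv i), h⟩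

theorem uniform_bitsF {pos : Env → ℕ} (hpos : NumLS fun _ v => pos v) (c : ℕ) :
    (bitsF pos c).Uniform 18 :=
  ⟨by omega, fun hv => LSP.le (hv 1).clog (hv 9), ⟨hpos, fun hv => LSP.testBit (hv c) (hv 9)⟩,
    hpos, fun hv => (LSP.testBit (hv c) (hv 9)).not⟩

theorem uniform_opF (a b c : ℕ) : (opF a b c).Uniform 18 :=
  uniform_bitsF (fun hv => LS.tablePos (hv 1) (hv 2) (hv a) (hv b) (hv 9)) c

theorem uniform_certF (d c : ℕ) : (certF d c).Uniform 18 :=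
  uniform_bitsF (fun hv => LS.certPos (hv 1) (hv 2) (LS.const d) (hv 9)) c

theorem uniform_stepF : stepF.Uniform 18 :=
  ⟨fun hv => (LSP.testBit (hv 3) (hv 5)).not.and (LSP.eq (hv 6) (hv 7)),
    fun hv => LSP.testBit (hv 3) (hv 5),
    uniform_exN (by omega) <| uniform_exN (by omega) <| uniform_exN (by omega)
      ⟨uniform_certF _ _, uniform_bitsF (fun hv => LS.certPos (hv 1) (hv 2)
        ((hv 5).add (LS.const 3)) (hv 9)) _, uniform_opF _ _ _, uniform_opF _ _ _⟩⟩

theorem uniform_pathF : pathF.Uniform 18 :=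
  ⟨fun hv => (LSP.eq (hv 4) LS.zero).and (LSP.eq (hv 6) (hv 7)),
    ⟨fun hv => LSP.eq (hv 4) (LS.const 1), uniform_stepF⟩,
    fun hv => LSP.le (LS.const 2) (hv 4), uniform_exN (by omega)
      ⟨fun k _ _ _ hv => LS.pathEnv (hv 1) (hv 2) (hv 3) ((hv 4).div (LS.const 2)) (hv 5) (hv 6)
        (hv 8) k,
      fun k _ _ _ hv => LS.pathEnv (hv 1) (hv 2) (hv 3) ((hv 4).sub ((hv 4).div (LS.const 2)))
        ((hv 5).add ((hv 4).div (LS.const 2))) (hv 8) (hv 7) k⟩⟩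

theorem uniform_endF (e c : ℕ) : (endF e c).Uniform 18 :=
  uniform_exN (by omega) ⟨uniform_certF _ _, fun k _ _ _ hv => LS.pathEnv (hv 1) (hv 2) (hv e)
    ((LS.const 2).mul (hv 1).clog) LS.zero (hv 6) (hv c) k⟩

theorem uniform_tripleF (j : ℕ) : (tripleF j).Uniform 18 :=
  ⟨by omega, fun hv => LSP.eq (hv 2) (LS.const j), uniform_exN (by omega) <|
    uniform_exN (by omega) <| uniform_exN (by omega)
    ⟨uniform_exN (by omega) <| uniform_exN (by omega)
      ⟨uniform_certF _ _, uniform_endF _ _, uniform_opF _ _ _⟩,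
    uniform_exN (by omega) <| uniform_exN (by omega)
      ⟨uniform_certF _ _, uniform_endF _ _, uniform_opF _ _ _⟩,
    uniform_opF _ _ _, uniform_endF _ _⟩⟩

theorem uniform_formatF : formatF.Uniform 18 :=
  ⟨⟨by omega, fun hv => LSP.le (hv 1).inputBits (hv 5), fun hv => (LS.const 2).mul (hv 5)⟩,
    fun hv => (LS.const 2).mul (hv 1).inputBits,
    ⟨by omega, fun hv => LSP.le (hv 1).tableBits (hv 5), fun hv => ((LS.const 4).mul (hv 5)).succ⟩,
    fun hv => ((LS.const 4).mul (hv 1).tableBits).succ⟩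

theorem uniform_validF : validF.Uniform 18 :=
  ⟨uniform_allN (by omega) <| uniform_allN (by omega) <| uniform_exN (by omega)
      (uniform_opF _ _ _),
    uniform_allN (by omega) <| uniform_allN (by omega) <| uniform_exN (by omega)
      (uniform_opF _ _ _),
    uniform_allN (by omega) <| uniform_allN (by omega) <| uniform_exN (by omega)
      (uniform_opF _ _ _),
    ⟨by omega, fun hv => LSP.le (((LS.const 2).mul (hv 1).clog).add (LS.const 3)) (hv 5),
      uniform_exN (by omega) <| uniform_bitsF
        (fun hv => LS.certPos (hv 1) (hv 2) (hv 5) (hv 9)) _⟩,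
    uniform_allN (by omega) ⟨by omega, uniform_endF _ _⟩⟩

theorem uniform_mainF : mainF.Uniform 18 :=
  ⟨by omega, fun hv => LSP.lt LS.zero (hv 1), uniform_formatF,
    ⟨by omega, fun hv => LSP.le (LS.const 2) (hv 2), uniform_validF⟩,
    by omega, by omega, by omega, uniform_tripleF 0, uniform_tripleF 1⟩

theorem uniform_isotopyF : isotopyF.Uniform 18 :=
  ⟨⟨fun hv => LSP.eq (hv 0) (LS.const 1), uniform_pathF⟩,
    fun hv => (LSP.eq (hv 0) (LS.const 1)).not, uniform_mainF⟩

end Fml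

/-! ### The meaning of the formula -/

/-- The walk given by `e` in row `j` ends in `c`, with `R` for the relation on assignments. -/
def EndRel (w : List Bool) (R : Env → Prop) (n j e c : ℕ) : Prop :=
  ∃ u < n, CertRel w n j 2 u ∧
    R (normEnv (base w.length) 18 (pathEnv n j e (2 * Nat.clog 2 n) 0 u c))

/-- The equation between the ends of three walks in row `j`. -/
def TripleRel (w : List Bool) (R : Env → Prop) (n j e₁ e₂ e₃ : ℕ) : Prop :=
  ∃ x < n, ∃ y < n, ∃ z < n,
    (∃ q < n, ∃ c < n, CertRel w n j 1 q ∧ EndRel w R n j e₁ c ∧ OpRel w n j x q c) ∧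
    (∃ q < n, ∃ c < n, CertRel w n j 0 q ∧ EndRel w R n j e₂ c ∧ OpRel w n j q y c) ∧
    OpRel w n j x y z ∧ EndRel w R n j e₃ z

/-- The input has the form of two tables of order `n` and a certificate. -/
def Format (w : List Bool) (n : ℕ) : Prop :=
  (∀ i < inputBits n, w.getD (2 * i) false = true) ∧ w.getD (2 * inputBits n) false = false ∧
  (∀ i < tableBits n, w.getD (4 * i + 1) false = true) ∧
    w.getD (4 * tableBits n + 1) false = false

/-- Table `j` is that of a quasigroup, row `j` of the certificate consists of elements, and the
walks in row `j` reach everything. -/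
def Valid (w : List Bool) (R : Env → Prop) (n j : ℕ) : Prop :=
  (∀ a < n, ∀ b < n, ∃ c < n, OpRel w n j a b c) ∧ (∀ a < n, ∀ c < n, ∃ b < n, OpRel w n j a b c) ∧
  (∀ b < n, ∀ c < n, ∃ a < n, OpRel w n j a b c) ∧
  (∀ i < 2 * Nat.clog 2 n + 3, ∃ c < n, CertRel w n j i c) ∧
  ∀ c < n, ∃ e < base w.length, EndRel w R n j e c

/-- The condition expressed by the main formula. -/
def Accept (w : List Bool) (R : Env → Prop) : Prop :=
  ∃ n, 0 < n ∧ Format w n ∧ (∀ j < 2, Valid w R n j) ∧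
    ∀ e₁ < base w.length, ∀ e₂ < base w.length, ∀ e₃ < base w.length,
      TripleRel w R n 0 e₁ e₂ e₃ → TripleRel w R n 1 e₁ e₂ e₃

theorem lt_base (N : ℕ) : 2 * N + 3 < base N := by
  unfold base
  nlinarith

theorem clog_le_self (n : ℕ) : Nat.clog 2 n ≤ n := by
  rw [Nat.clog_le_iff_le_pow (by omega)]
  exact Nat.lt_two_pow_self.le

theorem two_mul_le_inputBits (n : ℕ) : 2 * n ≤ inputBits n + 1 := by
  unfold inputBits tableBits
  rcases Nat.lt_or_ge n 2 with h | h
  · omega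
  · have := Nat.clog_pos (b := 2) (by omega) h
    have : n * n ≤ n * n * Nat.clog 2 n := Nat.le_mul_of_pos_right _ this
    nlinarith

/-- This is why `base` is a square: a variable must range over all names of walks, which have twice
as many bits as elements. -/
theorem two_pow_le_base {n N : ℕ} (hn : 2 * n ≤ N + 2) : 2 ^ (2 * Nat.clog 2 n) ≤ base N := by
  have h : 2 ^ Nat.clog 2 n ≤ N + 2 := by
    rcases Nat.lt_or_ge n 2 with h | h
    · rw [Nat.clog_of_right_le_one (by omega)]
      omega
    · have h1 := Nat.clog_pos (b := 2) (by omega) h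
      have h2 := Nat.pow_pred_clog_lt_self (b := 2) (by omega) (show 1 < n by omega)
      have h3 : 2 ^ Nat.clog 2 n = 2 ^ (Nat.clog 2 n).pred * 2 := by
        rw [← pow_succ, Nat.pred_eq_sub_one, Nat.sub_add_cancel h1]
      omega
  rw [mul_comm, pow_mul]
  exact Nat.pow_le_pow_left h 2

namespace Fml

variable {w : List Bool} {R : Env → Prop} {v : Env}

theorem eval_exN {i : ℕ} {φ : Fml} (hi : 1 ≠ i) (hn : v 1 ≤ base w.length) :
    (exN i φ).Eval 18 w R v ↔ ∃ t < v 1, φ.Eval 18 w R (Function.update v i t) := by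
  simp only [exN, Eval, Function.update_self, Function.update_of_ne hi]
  exact ⟨fun ⟨t, _, h⟩ => ⟨t, h⟩, fun ⟨t, h⟩ => ⟨t, h.1.trans_le hn, h⟩⟩

theorem eval_allN {i : ℕ} {φ : Fml} (hi : 1 ≠ i) (hn : v 1 ≤ base w.length) :
    (allN i φ).Eval 18 w R v ↔ ∀ t < v 1, φ.Eval 18 w R (Function.update v i t) := by
  simp only [allN, Eval, Function.update_self, Function.update_of_ne hi]
  refine ⟨fun h t ht => (h t (ht.trans_le hn)).resolve_left (by omega), fun h t _ => ?_⟩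
  rcases Nat.lt_or_ge t (v 1) with ht | ht
  exacts [Or.inr (h t ht), Or.inl ht]

theorem eval_bitsF {pos : Env → ℕ} {c : ℕ} (hc : c ≠ 9) (hn : v 1 ≤ base w.length) :
    (bitsF pos c).Eval 18 w R v ↔ ∀ t < Nat.clog 2 (v 1),
      w.getD (pos (Function.update v 9 t)) false = (v c).testBit t := by
  have hL := (clog_le_self (v 1)).trans hn
  simp only [bitsF, Eval, Function.update_self, Function.update_of_ne hc,
    Function.update_of_ne (show 1 ≠ 9 by omega)]
  have key : ∀ p q : Bool, (p = true ∧ q = true ∨ ¬ p = true ∧ ¬ q = true) ↔ p = q := by decide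
  simp only [key]
  refine ⟨fun h t ht => (h t (ht.trans_le hL)).resolve_left (by omega), fun h t _ => ?_⟩
  rcases Nat.lt_or_ge t (Nat.clog 2 (v 1)) with ht | ht
  exacts [Or.inr (h t ht), Or.inl ht]

theorem eval_opF {a b c : ℕ} (ha : a ≠ 9) (hb : b ≠ 9) (hc : c ≠ 9) (hn : v 1 ≤ base w.length) :
    (opF a b c).Eval 18 w R v ↔ OpRel w (v 1) (v 2) (v a) (v b) (v c) := by
  rw [opF, eval_bitsF hc hn, OpRel]
  simp only [Function.update_self, Function.update_of_ne ha, Function.update_of_ne hb,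
    Function.update_of_ne (show 1 ≠ 9 by omega), Function.update_of_ne (show 2 ≠ 9 by omega)]

theorem eval_certF {d c : ℕ} (hc : c ≠ 9) (hn : v 1 ≤ base w.length) :
    (certF d c).Eval 18 w R v ↔ CertRel w (v 1) (v 2) d (v c) := by
  rw [certF, eval_bitsF hc hn, CertRel]
  simp only [Function.update_self,
    Function.update_of_ne (show 1 ≠ 9 by omega), Function.update_of_ne (show 2 ≠ 9 by omega)]

theorem eval_endF {e c : ℕ} (he : e ≠ 6) (hc : c ≠ 6) (hn : v 1 ≤ base w.length) :
    (endF e c).Eval 18 w R v ↔ EndRel w R (v 1) (v 2) (v e) (v c) := by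
  rw [endF, eval_exN (by omega) hn, EndRel]
  refine exists_congr fun u => and_congr_right fun _ => ?_
  rw [Eval, eval_certF (by omega) (by simpa using hn), Eval]
  simp only [Function.update_self, Function.update_of_ne he, Function.update_of_ne hc,
    Function.update_of_ne (show 1 ≠ 6 by omega), Function.update_of_ne (show 2 ≠ 6 by omega)]

theorem eval_stepF (hn : v 1 ≤ base w.length) : stepF.Eval 18 w R v ↔
    (¬ (v 3).testBit (v 5) = true ∧ v 6 = v 7) ∨ ((v 3).testBit (v 5) = true ∧
      ∃ q < v 1, ∃ z < v 1, ∃ h < v 1, CertRel w (v 1) (v 2) 1 q ∧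
        CertRel w (v 1) (v 2) (v 5 + 3) h ∧ OpRel w (v 1) (v 2) z q (v 6) ∧
        OpRel w (v 1) (v 2) z h (v 7)) := by
  simp [stepF, Eval, eval_exN, eval_certF, eval_opF, eval_bitsF, hn, CertRel]

theorem eval_tripleF {j : ℕ} (hj : j < 2) (hn : v 1 ≤ base w.length) :
    (tripleF j).Eval 18 w R v ↔ TripleRel w R (v 1) j (v 15) (v 16) (v 17) := by
  have h := lt_base w.length
  have e : ∀ P : ℕ → Prop, (∃ t < base w.length, t = j ∧ P t) ↔ P j := fun P =>
    ⟨fun ⟨t, _, h, hP⟩ => h ▸ hP, fun hP => ⟨j, by omega, rfl, hP⟩⟩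
  simp only [tripleF, Eval, Function.update_self, e]
  simp [eval_exN, eval_certF, eval_opF, eval_endF, Eval, hn, TripleRel]

theorem eval_validF (hn : v 1 ≤ w.length) :
    validF.Eval 18 w R v ↔ Valid w R (v 1) (v 2) := by
  have h := lt_base w.length
  have hn' : v 1 ≤ base w.length := by omega
  have hL := clog_le_self (v 1)
  have e : ∀ P : ℕ → Prop, (∀ t < base w.length, 2 * Nat.clog 2 (v 1) + 3 ≤ t ∨ P t) ↔
      ∀ t < 2 * Nat.clog 2 (v 1) + 3, P t := fun P =>
    ⟨fun h t ht => (h t (by omega)).resolve_left (by omega), fun h t _ => by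
      by_cases ht : t < 2 * Nat.clog 2 (v 1) + 3
      exacts [Or.inr (h t ht), Or.inl (by omega)]⟩
  simp [validF, Eval, eval_exN, eval_allN, eval_opF, eval_endF, eval_bitsF, hn',
    Valid, e, CertRel]

/-- The quantifier over positions reaches `w.length`. If `inputBits` were larger, a `true` would be
required at position `2 * w.length`, where only the default `false` is read. So the format bounds
`n` by the length of the input. -/
theorem eval_formatF :
    formatF.Eval 18 w R v ↔ Format w (v 1) ∧ inputBits (v 1) ≤ w.length := by
  have hb := lt_base w.length
  have hN : (∀ t < base w.length, inputBits (v 1) ≤ t ∨ w.getD (2 * t) false = true) →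
      inputBits (v 1) ≤ w.length := by
    intro h
    refine (h w.length (by omega)).resolve_right ?_
    rw [List.getD_eq_default _ _ (by omega)]
    simp
  have e : ∀ (P : ℕ → Prop) (m : ℕ), m ≤ w.length →
      ((∀ t < base w.length, m ≤ t ∨ P t) ↔ ∀ t < m, P t) := fun P m hm =>
    ⟨fun h t ht => (h t (by omega)).resolve_left (by omega), fun h t _ => by
      by_cases ht : t < m
      exacts [Or.inr (h t ht), Or.inl (by omega)]⟩
  have hle : tableBits (v 1) ≤ inputBits (v 1) := by unfold inputBits; omega
  simp only [formatF, Eval, Function.update_self, Function.update_of_ne (show 1 ≠ 5 by omega),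
    Format, Bool.not_eq_true]
  constructor
  · rintro ⟨h₁, h₂, h₃, h₄⟩
    have := hN h₁
    exact ⟨⟨(e _ _ this).1 h₁, h₂, (e _ _ (hle.trans this)).1 h₃, h₄⟩, this⟩
  · rintro ⟨⟨h₁, h₂, h₃, h₄⟩, this⟩
    exact ⟨(e _ _ this).2 h₁, h₂, (e _ _ (hle.trans this)).2 h₃, h₄⟩

theorem _root_.LatinIsotopy.Format.inputBits_le {n : ℕ} (h : Format w n) :
    inputBits n ≤ w.length := by
  by_contra hcon
  have := h.1 w.length (by omega)
  rw [List.getD_eq_default _ _ (by omega)] at this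
  simp at this

theorem eval_mainF : mainF.Eval 18 w R v ↔ Accept w R := by
  have hb := lt_base w.length
  have key : ∀ n ≤ base w.length, ((0 < n ∧ formatF.Eval 18 w R (Function.update v 1 n) ∧
      (∀ j < base w.length, 2 ≤ j ∨
        validF.Eval 18 w R (Function.update (Function.update v 1 n) 2 j)) ∧
      ∀ e₁ < base w.length, ∀ e₂ < base w.length, ∀ e₃ < base w.length,
        ¬ (tripleF 0).Eval 18 w R (Function.update (Function.update (Function.update
            (Function.update v 1 n) 15 e₁) 16 e₂) 17 e₃) ∨
          (tripleF 1).Eval 18 w R (Function.update (Function.update (Function.update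
            (Function.update v 1 n) 15 e₁) 16 e₂) 17 e₃)) ↔
      0 < n ∧ Format w n ∧ (∀ j < 2, Valid w R n j) ∧
        ∀ e₁ < base w.length, ∀ e₂ < base w.length, ∀ e₃ < base w.length,
          TripleRel w R n 0 e₁ e₂ e₃ → TripleRel w R n 1 e₁ e₂ e₃) := by
    intro n hn
    rw [eval_formatF]
    refine and_congr_right fun _ => ?_
    rw [and_assoc, Function.update_self]
    refine and_congr_right fun hf => ?_
    have hX := hf.inputBits_le
    have hnX := two_mul_le_inputBits n
    refine (and_iff_right hX).trans (and_congr ?_ ?_)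
    · have : ∀ j, validF.Eval 18 w R (Function.update (Function.update v 1 n) 2 j) ↔
          Valid w R n j := fun j => by
        rw [eval_validF (by simp; omega)]
        simp
      simp only [this]
      exact ⟨fun h j hj => (h j (by omega)).resolve_left (by omega), fun h j _ => by
        by_cases hj : j < 2
        exacts [Or.inr (h j hj), Or.inl (by omega)]⟩
    · refine forall₂_congr fun e₁ _ => forall₂_congr fun e₂ _ => forall₂_congr fun e₃ _ => ?_
      rw [eval_tripleF (by omega) (by simpa using hn), eval_tripleF (by omega) (by simpa using hn)]
      simp [imp_iff_not_or]
  simp only [mainF, Eval, Function.update_self]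
  constructor
  · rintro ⟨n, hn, h⟩
    exact ⟨n, (key n hn.le).1 h⟩
  · rintro ⟨n, h⟩
    have hX := h.2.1.inputBits_le
    have hnX := two_mul_le_inputBits n
    exact ⟨n, by omega, (key n (by omega)).2 h⟩

end Fml

open Ctx

/-! ### Decoded inputs -/

/-- Table `j` is that of `op`, and row `j` of the certificate is `cert`. -/
structure Decodes (w : List Bool) {n : ℕ} (j : ℕ) (op : Fin n → Fin n → Fin n) (cert : ℕ → Fin n) :
    Prop where
  row_lt : j < 2
  length_le : inputBits n ≤ w.length
  op_iff : ∀ a b c : Fin n, OpRel w n j a b c ↔ op a b = c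
  cert_iff : ∀ i < 2 * Nat.clog 2 n + 3, ∀ c : Fin n, CertRel w n j i c ↔ cert i = c

/-- The end of the walk in a quasigroup that is given by `e`. -/
noncomputable def walkEnd {n : ℕ} {op : Fin n → Fin n → Fin n} (hq : IsQuasigroup op)
    (cert : ℕ → Fin n) (e : ℕ) : Fin n :=
  walk (hq.pick (cert 1) (fun i => cert (i + 3)) e) 0 (2 * Nat.clog 2 n) (cert 2)

/-- The relation `R` tells the ends of walks. -/
def WalkSpec (R : List Bool → Env → Prop) : Prop :=
  ∀ (w : List Bool) (n j : ℕ) (op : Fin n → Fin n → Fin n) (cert : ℕ → Fin n)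
    (hq : IsQuasigroup op), Decodes w j op cert → ∀ e < base w.length, ∀ u v : Fin n,
    R w (normEnv (base w.length) 18 (pathEnv n j e (2 * Nat.clog 2 n) 0 u v)) ↔
      walk (hq.pick (cert 1) (fun i => cert (i + 3)) e) 0 (2 * Nat.clog 2 n) u = v

theorem normEnv_pathEnv {b n j e s i u v : ℕ} (hb : 1 < b) (hn : n < b) (hj : j < b) (he : e < b)
    (hs : s < b) (hi : i < b) (hu : u < b) (hv : v < b) :
    normEnv b 18 (pathEnv n j e s i u v) = pathEnv n j e s i u v := by
  funext k
  unfold normEnv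
  split
  · apply Nat.mod_eq_of_lt
    unfold pathEnv
    split <;> omega
  · unfold pathEnv
    split <;> omega

namespace Decodes

variable {w : List Bool} {n j : ℕ} {op : Fin n → Fin n → Fin n} {cert : ℕ → Fin n}

theorem two_mul_le (D : Decodes w j op cert) : 2 * n ≤ w.length + 1 := by
  have := D.length_le
  have := two_mul_le_inputBits n
  omega

/-- Both `R` and `s` are arbitrary, since a single step makes no call and does not consult the
length of the walk. -/
theorem eval_stepF (D : Decodes w j op cert) (hq : IsQuasigroup op) {R : Env → Prop} (e s : ℕ)
    {i : ℕ} (hi : i < 2 * Nat.clog 2 n) (u v : Fin n) :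
    Fml.stepF.Eval 18 w R (pathEnv n j e s i u v) ↔
      hq.pick (cert 1) (fun i => cert (i + 3)) e i u = v := by
  have hb := lt_base w.length
  have hn := D.two_mul_le
  rw [Fml.eval_stepF (by change n ≤ _; omega)]
  change (¬ e.testBit i = true ∧ (u : ℕ) = v) ∨ (e.testBit i = true ∧ ∃ q < n, ∃ z < n, ∃ h < n,
    CertRel w n j 1 q ∧ CertRel w n j (i + 3) h ∧ OpRel w n j z q u ∧ OpRel w n j z h v) ↔ _
  unfold IsQuasigroup.pick
  split
  case isTrue ht =>
    simp only [ht, not_true, false_and, false_or, true_and]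
    rw [IsQuasigroup.shift_eq_iff]
    constructor
    · rintro ⟨q, hqn, z, hz, h, hh, h₁, h₂, h₃, h₄⟩
      rw [(D.cert_iff 1 (by omega) ⟨q, hqn⟩).1 h₁, (D.cert_iff (i + 3) (by omega) ⟨h, hh⟩).1 h₂]
      exact ⟨⟨z, hz⟩, (D.op_iff ⟨z, hz⟩ ⟨q, hqn⟩ u).1 h₃, (D.op_iff ⟨z, hz⟩ ⟨h, hh⟩ v).1 h₄⟩
    · rintro ⟨z, h₁, h₂⟩
      exact ⟨_, (cert 1).2, z, z.2, _, (cert (i + 3)).2, (D.cert_iff 1 (by omega) _).2 rfl,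
        (D.cert_iff (i + 3) (by omega) _).2 rfl, (D.op_iff _ _ _).2 h₁, (D.op_iff _ _ _).2 h₂⟩
  case isFalse hf => simp [hf, Fin.ext_iff]

variable {R : List Bool → Env → Prop}

theorem endRel_iff (D : Decodes w j op cert) (hq : IsQuasigroup op) (hR : WalkSpec R) {e : ℕ}
    (he : e < base w.length) (c : Fin n) : EndRel w (R w) n j e c ↔ walkEnd hq cert e = c := by
  constructor
  · rintro ⟨u, hu, h₁, h₂⟩
    have := (D.cert_iff 2 (by omega) ⟨u, hu⟩).1 h₁
    rw [walkEnd, this]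
    exact (hR w n j op cert hq D e he ⟨u, hu⟩ c).1 h₂
  · exact fun h => ⟨_, (cert 2).2, (D.cert_iff 2 (by omega) _).2 rfl,
      (hR w n j op cert hq D e he _ c).2 h⟩

theorem tripleRel_iff (D : Decodes w j op cert) (hq : IsQuasigroup op) (hR : WalkSpec R)
    {e₁ e₂ e₃ : ℕ} (h₁ : e₁ < base w.length) (h₂ : e₂ < base w.length) (h₃ : e₃ < base w.length) :
    TripleRel w (R w) n j e₁ e₂ e₃ ↔
      Triple op (cert 0) (cert 1) (walkEnd hq cert) e₁ e₂ e₃ := by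
  constructor
  · rintro ⟨x, hx, y, hy, z, hz, ⟨q, hqn, c, hc, a₁, a₂, a₃⟩,
      ⟨q', hqn', c', hc', b₁, b₂, b₃⟩, d₁, d₂⟩
    refine ⟨⟨x, hx⟩, ⟨y, hy⟩, ?_, ?_, ?_⟩
    · rw [(D.cert_iff 1 (by omega) ⟨q, hqn⟩).1 a₁, (D.endRel_iff hq hR h₁ ⟨c, hc⟩).1 a₂]
      exact (D.op_iff ⟨x, hx⟩ ⟨q, hqn⟩ ⟨c, hc⟩).1 a₃
    · rw [(D.cert_iff 0 (by omega) ⟨q', hqn'⟩).1 b₁, (D.endRel_iff hq hR h₂ ⟨c', hc'⟩).1 b₂]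
      exact (D.op_iff ⟨q', hqn'⟩ ⟨y, hy⟩ ⟨c', hc'⟩).1 b₃
    · rw [(D.endRel_iff hq hR h₃ ⟨z, hz⟩).1 d₂]
      exact (D.op_iff ⟨x, hx⟩ ⟨y, hy⟩ ⟨z, hz⟩).1 d₁
  · rintro ⟨x, y, a, b, d⟩
    exact ⟨x, x.2, y, y.2, _, (walkEnd hq cert e₃).2,
      ⟨_, (cert 1).2, _, (walkEnd hq cert e₁).2, (D.cert_iff 1 (by omega) _).2 rfl,
        (D.endRel_iff hq hR h₁ _).2 rfl, (D.op_iff _ _ _).2 a⟩,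
      ⟨_, (cert 0).2, _, (walkEnd hq cert e₂).2, (D.cert_iff 0 (by omega) _).2 rfl,
        (D.endRel_iff hq hR h₂ _).2 rfl, (D.op_iff _ _ _).2 b⟩,
      (D.op_iff _ _ _).2 d, (D.endRel_iff hq hR h₃ _).2 rfl⟩

end Decodes

/-! ### Walks in logarithmic space -/

open Classical in
/-- The element reached after `t` steps from `u`. -/
noncomputable def follow (w : List Bool) (n j e u : ℕ) : ℕ → ℕ
  | 0 => u
  | t + 1 => Nat.findGreatest (fun z =>
      Fml.stepF.Eval 18 w (fun _ => False) (pathEnv n j e 0 t (follow w n j e u t) z)) (n - 1)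

/-- The relation on assignments which tells walks by following them step by step. -/
def FollowRel (w : List Bool) (v : Env) : Prop :=
  follow w (v 1) (v 2) (v 3) (v 6) (2 * Nat.clog 2 (v 1)) = v 7

/-- The recursion remembers just one element. The bound `v 6 + v 1` holds on every input, even if
the tables are not quasigroups, because the search for a successor stays below `v 1`. -/
theorem lsp_followRel {α : Type} [Ctx α] {v : α → Env} (hv : ∀ i, LS fun a => v a i) :
    LSP fun a => FollowRel (inp a) (v a) := by
  classical
  refine LSP.eq (LS.recursion_le
    (F := fun a t => follow (inp a) (v a 1) (v a 2) (v a 3) (v a 6) t)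
    (h := fun b => Nat.findGreatest (fun z => Fml.stepF.Eval 18 (inp b) (fun _ => False)
      (pathEnv (v b.1.1 1) (v b.1.1 2) (v b.1.1 3) 0 b.1.2 b.2 z)) (v b.1.1 1 - 1))
    (hv 6) ((LS.const 2).mul (hv 1).clog) ?_ (fun _ => rfl) ?_
    ((hv 6).add (hv 1)).bounded ?_) (hv 7)
  · refine LS.findGreatest (p := fun b : ((α × ℕ) × ℕ) × ℕ =>
      Fml.stepF.Eval 18 (inp b) (fun _ => False)
        (pathEnv (v b.1.1.1 1) (v b.1.1.1 2) (v b.1.1.1 3) 0 b.1.1.2 b.1.2 b.2)) ?_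
      (hv 1).weaken.weaken.pred
    exact Fml.uniform_stepF.lsp (R := fun _ _ => False) (fun _ => LSP.const False) (LS.pathEnv
      (hv 1).weaken.weaken.weaken (hv 2).weaken.weaken.weaken (hv 3).weaken.weaken.weaken LS.zero
      LS.snd.weaken.weaken LS.snd.weaken LS.snd)
  · intro a t
    simp only [follow]
    congr
  · intro a t _
    cases t with
    | zero => exact Nat.le_add_right _ _
    | succ t => exact (Nat.findGreatest_le _).trans (by omega)

theorem walkSpec_followRel : WalkSpec FollowRel := by
  classical
  intro w n j op cert hq D e he u v
  have hb := lt_base w.length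
  have hn := D.two_mul_le
  have hj := D.row_lt
  have hL := clog_le_self n
  have := u.2
  have := v.2
  rw [normEnv_pathEnv (by omega) (by omega) (by omega) he (by omega) (by omega) (by omega)
    (by omega)]
  change follow w n j e u (2 * Nat.clog 2 n) = v ↔ _
  have key : ∀ t ≤ 2 * Nat.clog 2 n, follow w n j e u t =
      walk (hq.pick (cert 1) (fun i => cert (i + 3)) e) 0 t u := by
    intro t ht
    induction t with
    | zero => rfl
    | succ t ih =>
      -- In a quasigroup the successor is unique, so the greatest solution is the only one.
      rw [follow, ih (by omega), walk, Nat.zero_add, Nat.findGreatest_eq_iff]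
      set c := walk (hq.pick (cert 1) (fun i => cert (i + 3)) e) 0 t u
      refine ⟨by omega, fun _ => (D.eval_stepF hq e 0 (by omega) c _).2 rfl, ?_⟩
      intro z hz hzn h
      have := (D.eval_stepF hq e 0 (by omega) c ⟨z, by omega⟩).1 h
      rw [this] at hz
      exact lt_irrefl _ hz
  rw [key _ le_rfl, Fin.ext_iff]

/-! ### Walks by repeated halving -/

theorem eval_isotopyF_pathEnv {w : List Bool} {R : Env → Prop} {n j e s i u v : ℕ}
    (hn : n ≤ base w.length) : Fml.isotopyF.Eval 18 w R (pathEnv n j e s i u v) ↔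
      (s = 0 ∧ u = v) ∨ (s = 1 ∧ Fml.stepF.Eval 18 w R (pathEnv n j e s i u v)) ∨
      (2 ≤ s ∧ ∃ z < n, R (normEnv (base w.length) 18 (pathEnv n j e (s / 2) i u z)) ∧
        R (normEnv (base w.length) 18 (pathEnv n j e (s - s / 2) (i + s / 2) z v))) := by
  have h0 : pathEnv n j e s i u v 0 = 1 := rfl
  simp only [Fml.isotopyF, Fml.Eval, h0, true_and, not_true, false_and, or_false, Fml.pathF]
  refine or_congr Iff.rfl (or_congr Iff.rfl (and_congr_right fun _ => ?_))
  exact Fml.eval_exN (by omega) hn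

/-- Each stage doubles the length of the walks that are decided: both `s / 2` and `s - s / 2` are at
most `2 ^ ℓ` when `s ≤ 2 ^ (ℓ + 1)`. The extra stage is for walks of at most one step, as stage `0`
is empty. -/
theorem stage_pathEnv {w : List Bool} {n j : ℕ} {op : Fin n → Fin n → Fin n} {cert : ℕ → Fin n}
    (D : Decodes w j op cert) (hq : IsQuasigroup op) {e : ℕ} (he : e < base w.length) {ℓ s i : ℕ}
    (hs : s ≤ 2 ^ ℓ) (hi : i + s ≤ 2 * Nat.clog 2 n) (u v : Fin n) :
    Fml.isotopyF.stage 18 w (ℓ + 1) (pathEnv n j e s i u v) ↔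
      walk (hq.pick (cert 1) (fun i => cert (i + 3)) e) i s u = v := by
  have hb := lt_base w.length
  have hn := D.two_mul_le
  have hj := D.row_lt
  have hL := clog_le_self n
  have short : ∀ {R : Env → Prop} {s i : ℕ} (u v : Fin n), s ≤ 1 → i + s ≤ 2 * Nat.clog 2 n →
      (Fml.isotopyF.Eval 18 w R (pathEnv n j e s i u v) ↔
        walk (hq.pick (cert 1) (fun i => cert (i + 3)) e) i s u = v) := by
    intro R s i u v hs hi
    rw [eval_isotopyF_pathEnv (by omega)]
    rcases Nat.le_one_iff_eq_zero_or_eq_one.1 hs with rfl | rfl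
    · simp [walk, Fin.ext_iff]
    · rw [D.eval_stepF hq e 1 (by omega) u v]
      simp [walk]
  induction ℓ generalizing s i u v with
  | zero => exact short u v (by simpa using hs) hi
  | succ ℓ ih =>
    rcases Nat.lt_or_ge s 2 with h | h
    · exact short u v (by omega) hi
    rw [pow_succ] at hs
    have := u.2
    have := v.2
    have key : ∀ z : Fin n, (Fml.isotopyF.stage 18 w (ℓ + 1)
          (normEnv (base w.length) 18 (pathEnv n j e (s / 2) i u z)) ∧
        Fml.isotopyF.stage 18 w (ℓ + 1) (normEnv (base w.length) 18
          (pathEnv n j e (s - s / 2) (i + s / 2) z v))) ↔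
        walk (hq.pick (cert 1) (fun i => cert (i + 3)) e) i (s / 2) u = z ∧
          walk (hq.pick (cert 1) (fun i => cert (i + 3)) e) (i + s / 2) (s - s / 2) z = v := by
      intro z
      have := z.2
      rw [normEnv_pathEnv (by omega) (by omega) (by omega) he (by omega) (by omega) (by omega)
        (by omega), normEnv_pathEnv (by omega) (by omega) (by omega) he (by omega) (by omega)
        (by omega) (by omega)]
      exact and_congr (ih (by omega) (by omega) u z) (ih (by omega) (by omega) z v)
    rw [Fml.stage, eval_isotopyF_pathEnv (by omega)]
    have e1 := walk_add (hq.pick (cert 1) (fun i => cert (i + 3)) e) i (s / 2) (s - s / 2) u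
    rw [show s / 2 + (s - s / 2) = s by omega] at e1
    rw [e1]
    constructor
    · rintro (h | h | ⟨_, z, hz, h⟩)
      · omega
      · omega
      · obtain ⟨h₁, h₂⟩ := (key ⟨z, hz⟩).1 h
        rw [h₁, h₂]
    · exact fun h' => Or.inr (Or.inr ⟨h, _, Fin.is_lt _, (key _).2 ⟨rfl, h'⟩⟩)

/-- With N the input length, 2⌈log₂ n⌉ ≤ 2(log N + 1) ≤ 2^(log log N + 2), and one more stage is the
initial one. -/
theorem walkSpec_stage : WalkSpec fun w =>
    Fml.isotopyF.stage 18 w (Nat.log 2 (Nat.log 2 w.length) + 3) := by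
  intro w n j op cert hq D e he u v
  have hb := lt_base w.length
  have hn := D.two_mul_le
  have hj := D.row_lt
  have hL := clog_le_self n
  have := u.2
  have := v.2
  rw [normEnv_pathEnv (by omega) (by omega) (by omega) he (by omega) (by omega) (by omega)
    (by omega)]
  refine stage_pathEnv D hq he ?_ (by omega) u v
  have h₁ : Nat.clog 2 n ≤ Nat.log 2 w.length + 1 := by
    rw [Nat.clog_le_iff_le_pow (by omega)]
    have := Nat.lt_pow_succ_log_self (b := 2) (by omega) w.length
    have := D.length_le
    unfold inputBits at this
    omega
  have h₂ := Nat.lt_pow_succ_log_self (b := 2) (by omega) (Nat.log 2 w.length)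
  rw [pow_succ]
  omega

/-! ### Reading tables and certificates -/

theorem eq_of_testBit_clog {n a b : ℕ} (ha : a < n) (hb : b < n)
    (h : ∀ t < Nat.clog 2 n, a.testBit t = b.testBit t) : a = b := by
  have hn := Nat.le_pow_clog (b := 2) (by omega) n
  refine Nat.eq_of_testBit_eq fun t => ?_
  rcases Nat.lt_or_ge t (Nat.clog 2 n) with ht | ht
  · exact h t ht
  · have := Nat.pow_le_pow_right (n := 2) (by omega) ht
    rw [Nat.testBit_lt_two_pow (by omega), Nat.testBit_lt_two_pow (by omega)]

theorem OpRel.iff {w : List Bool} {n j a b : ℕ} {c : Fin n} (h : OpRel w n j a b c) (c' : Fin n) :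
    OpRel w n j a b c' ↔ c = c' :=
  ⟨fun h' => Fin.ext (eq_of_testBit_clog c.2 c'.2 fun t ht => (h t ht).symm.trans (h' t ht)),
    fun e => e ▸ h⟩

theorem CertRel.iff {w : List Bool} {n j i : ℕ} {c : Fin n} (h : CertRel w n j i c) (c' : Fin n) :
    CertRel w n j i c' ↔ c = c' :=
  ⟨fun h' => Fin.ext (eq_of_testBit_clog c.2 c'.2 fun t ht => (h t ht).symm.trans (h' t ht)),
    fun e => e ▸ h⟩

theorem index_lt {k m a t : ℕ} (ha : a < k) (ht : t < m) : a * m + t < k * m := by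
  have : (a + 1) * m ≤ k * m := Nat.mul_le_mul_right _ ha
  rw [Nat.succ_mul] at this
  omega

theorem entry_lt {n t : ℕ} (a b : Fin n) (ht : t < Nat.clog 2 n) :
    (a * n + b) * Nat.clog 2 n + t < tableBits n :=
  index_lt (index_lt a.2 b.2) ht

theorem exists_entry {n p : ℕ} (h : p < tableBits n) :
    ∃ a b : Fin n, ∃ t < Nat.clog 2 n, (a * n + b) * Nat.clog 2 n + t = p := by
  have hL : 0 < Nat.clog 2 n := by
    by_contra hL
    simp [tableBits, Nat.eq_zero_of_not_pos hL] at h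
  have h₁ : p / Nat.clog 2 n < n * n :=
    Nat.div_lt_of_lt_mul (by rwa [tableBits, mul_comm] at h)
  have hn : 0 < n := by
    by_contra hn
    simp [Nat.eq_zero_of_not_pos hn] at h₁
  refine ⟨⟨p / Nat.clog 2 n / n, Nat.div_lt_of_lt_mul h₁⟩, ⟨p / Nat.clog 2 n % n, Nat.mod_lt _ hn⟩,
    p % Nat.clog 2 n, Nat.mod_lt _ hL, ?_⟩
  simp only [Nat.div_add_mod']

theorem length_pair_encodeTable {n : ℕ} (op₀ op₁ : Fin n → Fin n → Fin n) :
    (pair (encodeTable op₀) (encodeTable op₁)).length = inputBits n := by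
  rw [length_pair, length_encodeTable, length_encodeTable, inputBits, tableBits]
  ring

theorem opRel_zero {n : ℕ} (op₀ op₁ : Fin n → Fin n → Fin n) (y : List Bool) (a b : Fin n) :
    OpRel (pair (pair (encodeTable op₀) (encodeTable op₁)) y) n 0 a b (op₀ a b) := by
  intro t ht
  have := entry_lt a b ht
  have hl := length_pair_encodeTable op₀ op₁
  rw [inputBits] at hl
  rw [← encodeTable_getD op₀ a b ht, tablePos, if_pos rfl,
    show ∀ p, 4 * p + 3 = 2 * (2 * p + 1) + 1 by intro p; ring, pair_getD_odd y (by omega),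
    pair_getD_odd _ (by rwa [length_encodeTable])]

theorem opRel_one {n : ℕ} (op₀ op₁ : Fin n → Fin n → Fin n) (y : List Bool) (a b : Fin n) :
    OpRel (pair (pair (encodeTable op₀) (encodeTable op₁)) y) n 1 a b (op₁ a b) := by
  intro t ht
  have := entry_lt a b ht
  have hl := length_pair_encodeTable op₀ op₁
  rw [inputBits] at hl
  rw [← encodeTable_getD op₁ a b ht, tablePos, if_neg one_ne_zero,
    pair_getD_odd y (by omega),
    ← pair_getD_right (encodeTable op₀) (encodeTable op₁), length_encodeTable]
  rfl

theorem format_pair {n : ℕ} (op₀ op₁ : Fin n → Fin n → Fin n) (y : List Bool) :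
    Format (pair (pair (encodeTable op₀) (encodeTable op₁)) y) n := by
  have hl := length_pair_encodeTable op₀ op₁
  have hA : (encodeTable op₀).length = tableBits n := length_encodeTable op₀
  have hi : inputBits n = 3 * tableBits n + 1 := rfl
  refine ⟨fun i hi => pair_getD_even y (by omega), hl ▸ pair_getD_mid _ y, fun i h => ?_, ?_⟩
  · rw [show 4 * i + 1 = 2 * (2 * i) + 1 by ring, pair_getD_odd y (by omega),
      pair_getD_even _ (by omega)]
  · rw [show 4 * tableBits n + 1 = 2 * (2 * tableBits n) + 1 by ring, pair_getD_odd y (by omega),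
      ← hA, pair_getD_mid]

/-- The first `false` at an even position of a pair is its separator, so both descriptions must put
it in the same place. -/
theorem Format.length_eq {x y : List Bool} {n : ℕ} (h : Format (pair x y) n) :
    x.length = inputBits n := by
  rcases lt_trichotomy x.length (inputBits n) with h₁ | h₁ | h₁
  · exact absurd ((h.1 _ h₁).symm.trans (pair_getD_mid x y)) (by decide)
  · exact h₁
  · exact absurd ((pair_getD_even y h₁).symm.trans h.2.1) (by decide)

theorem Format.eq_pair {x y : List Bool} {n : ℕ} (h : Format (pair x y) n)
    {op₀ op₁ : Fin n → Fin n → Fin n} (h₀ : ∀ a b : Fin n, OpRel (pair x y) n 0 a b (op₀ a b))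
    (h₁ : ∀ a b : Fin n, OpRel (pair x y) n 1 a b (op₁ a b)) :
    x = pair (encodeTable op₀) (encodeTable op₁) := by
  have hx := h.length_eq
  have hl := length_pair_encodeTable op₀ op₁
  have hA : (encodeTable op₀).length = tableBits n := length_encodeTable op₀
  have hi : inputBits n = 3 * tableBits n + 1 := rfl
  have key : ∀ k < inputBits n,
      x.getD k false = (pair (encodeTable op₀) (encodeTable op₁)).getD k false := by
    intro k hk
    rw [← pair_getD_odd (x := x) y (by omega)]
    -- The three cases are the doubled first table, the separator and the second table. `Format`
    -- gives the padding and separator bits, `OpRel` the rest.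
    rcases lt_trichotomy k (2 * tableBits n) with hk' | hk' | hk'
    · rcases Nat.even_or_odd' k with ⟨i, rfl | rfl⟩
      · rw [pair_getD_even (x := encodeTable op₀) _ (by omega), ← h.2.2.1 i (by omega)]
        congr 1
        ring
      · obtain ⟨a, b, t, ht, rfl⟩ := exists_entry (show i < tableBits n by omega)
        rw [pair_getD_odd (x := encodeTable op₀) _ (by omega), encodeTable_getD op₀ a b ht,
          ← h₀ a b t ht, tablePos, if_pos rfl]
        congr 1
        ring
    · rw [hk', ← hA, pair_getD_mid, hA, ← mul_assoc]
      exact h.2.2.2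
    · obtain ⟨i, rfl⟩ := Nat.exists_eq_add_of_le (show 2 * tableBits n + 1 ≤ k from hk')
      obtain ⟨a, b, t, ht, rfl⟩ := exists_entry (show i < tableBits n by omega)
      have hr := pair_getD_right (encodeTable op₀) (encodeTable op₁)
      rw [hA] at hr
      rw [hr, encodeTable_getD op₁ a b ht, ← h₁ a b t ht, tablePos, if_neg one_ne_zero]
  refine List.ext_getElem (hx.trans hl.symm) fun k hk hk' => ?_
  have := key k (by omega)
  rwa [List.getD_eq_getElem _ _ hk, List.getD_eq_getElem _ _ hk'] at this

/-- A certificate with two rows as a string. -/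
def encodeCert {n : ℕ} (cert : ℕ → ℕ → Fin n) : List Bool :=
  (List.range (2 * (2 * Nat.clog 2 n + 3) * Nat.clog 2 n)).map fun p =>
    (cert (p / Nat.clog 2 n / (2 * Nat.clog 2 n + 3))
      (p / Nat.clog 2 n % (2 * Nat.clog 2 n + 3)) : ℕ).testBit (p % Nat.clog 2 n)

theorem certRel_encodeCert {x : List Bool} {n : ℕ} (hx : x.length = inputBits n)
    (cert : ℕ → ℕ → Fin n) {j i : ℕ} (hj : j < 2) (hi : i < 2 * Nat.clog 2 n + 3) :
    CertRel (pair x (encodeCert cert)) n j i (cert j i) := by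
  intro t ht
  rw [certPos, ← hx, pair_getD_right, encodeCert]
  have hlt := index_lt (index_lt hj hi) ht
  have e₁ : ((j * (2 * Nat.clog 2 n + 3) + i) * Nat.clog 2 n + t) / Nat.clog 2 n =
      j * (2 * Nat.clog 2 n + 3) + i := by
    rw [Nat.mul_comm, Nat.mul_add_div (by omega), Nat.div_eq_of_lt ht, Nat.add_zero]
  have e₂ : ((j * (2 * Nat.clog 2 n + 3) + i) * Nat.clog 2 n + t) % Nat.clog 2 n = t := by
    rw [Nat.mul_comm, Nat.mul_add_mod, Nat.mod_eq_of_lt ht]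
  have e₃ : (j * (2 * Nat.clog 2 n + 3) + i) / (2 * Nat.clog 2 n + 3) = j := by
    rw [Nat.mul_comm, Nat.mul_add_div (by omega), Nat.div_eq_of_lt hi, Nat.add_zero]
  have e₄ : (j * (2 * Nat.clog 2 n + 3) + i) % (2 * Nat.clog 2 n + 3) = i := by
    rw [Nat.mul_comm, Nat.mul_add_mod, Nat.mod_eq_of_lt hi]
  rw [List.getD_eq_getElem _ _ (by simpa using hlt), List.getElem_map, List.getElem_range, e₁, e₂,
    e₃, e₄]

/-! ### Accepted inputs -/

theorem Decodes.valid {w : List Bool} {n j : ℕ} {op : Fin n → Fin n → Fin n} {cert : ℕ → Fin n}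
    {R : List Bool → Env → Prop} (D : Decodes w j op cert) (hq : IsQuasigroup op)
    (hR : WalkSpec R) (h : ∀ c, ∃ e < base w.length, walkEnd hq cert e = c) :
    Valid w (R w) n j := by
  refine ⟨fun a ha b hb => ⟨_, (op ⟨a, ha⟩ ⟨b, hb⟩).2, (D.op_iff ⟨a, ha⟩ ⟨b, hb⟩ _).2 rfl⟩,
    fun a ha c hc => ?_, fun b hb c hc => ?_,
    fun i hi => ⟨_, (cert i).2, (D.cert_iff i hi _).2 rfl⟩, fun c hc => ?_⟩
  · obtain ⟨b, hb⟩ := (hq ⟨a, ha⟩ ⟨c, hc⟩).1.exists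
    exact ⟨b, b.2, (D.op_iff ⟨a, ha⟩ b ⟨c, hc⟩).2 hb⟩
  · obtain ⟨a, ha⟩ := (hq ⟨b, hb⟩ ⟨c, hc⟩).2.exists
    exact ⟨a, a.2, (D.op_iff a ⟨b, hb⟩ ⟨c, hc⟩).2 ha⟩
  · obtain ⟨e, he, hc'⟩ := h ⟨c, hc⟩
    exact ⟨e, he, (D.endRel_iff hq hR he ⟨c, hc⟩).2 hc'⟩

/-- Existence statements suffice: an entry below `n` is determined by its bits, and a surjective
multiplication map on a finite set is bijective. -/
theorem Valid.exists_decodes {w : List Bool} {n j : ℕ} {R : Env → Prop} (h : Valid w R n j)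
    (hn : 0 < n) (hj : j < 2) (hw : inputBits n ≤ w.length) :
    ∃ op cert, IsQuasigroup op ∧ Decodes w (n := n) j op cert := by
  obtain ⟨h₁, h₂, h₃, h₄, -⟩ := h
  have h₁' : ∀ a b : Fin n, ∃ c : Fin n, OpRel w n j a b c := fun a b =>
    let ⟨c, hc, h⟩ := h₁ a a.2 b b.2; ⟨⟨c, hc⟩, h⟩
  choose op hop using h₁'
  have h₄' : ∀ i, ∃ c : Fin n, i < 2 * Nat.clog 2 n + 3 → CertRel w n j i c := fun i => by
    by_cases hi : i < 2 * Nat.clog 2 n + 3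
    · obtain ⟨c, hc, h⟩ := h₄ i hi
      exact ⟨⟨c, hc⟩, fun _ => h⟩
    · exact ⟨⟨0, hn⟩, fun h => absurd h hi⟩
  choose cert hcert using h₄'
  have hl : ∀ a, Function.Bijective (op a) := fun a =>
    Function.Surjective.bijective_of_finite fun c => by
      obtain ⟨b, hb, h⟩ := h₂ a a.2 c c.2
      exact ⟨⟨b, hb⟩, ((hop a ⟨b, hb⟩).iff c).1 h⟩
  have hr : ∀ b, Function.Bijective (op · b) := fun b =>
    Function.Surjective.bijective_of_finite fun c => by
      obtain ⟨a, ha, h⟩ := h₃ b b.2 c c.2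
      exact ⟨⟨a, ha⟩, ((hop ⟨a, ha⟩ b).iff c).1 h⟩
  exact ⟨op, cert, fun a c => ⟨(hl a).existsUnique c, (hr a).existsUnique c⟩, hj, hw,
    fun a b => (hop a b).iff, fun i hi => (hcert i hi).iff⟩

/-- The certificate with the elements `a, b, u, h 0, h 1, …`. -/
def certSeq {G : Type*} (a b u : G) (h : ℕ → G) : ℕ → G
  | 0 => a
  | 1 => b
  | 2 => u
  | i + 3 => h i

theorem accept_of_isotopic {R : List Bool → Env → Prop} (hR : WalkSpec R) {n : ℕ} (hn : 0 < n)
    {op₀ op₁ : Fin n → Fin n → Fin n} (h₀ : IsQuasigroup op₀) (h₁ : IsQuasigroup op₁)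
    (h : Isotopic op₀ op₁) : ∃ cert : ℕ → ℕ → Fin n,
      Accept (pair (pair (encodeTable op₀) (encodeTable op₁)) (encodeCert cert))
        (R (pair (pair (encodeTable op₀) (encodeTable op₁)) (encodeCert cert))) := by
  obtain ⟨α, β, γ, hiso⟩ := h
  have : Nonempty (Fin n) := ⟨⟨0, hn⟩⟩
  let z : Fin n := ⟨0, hn⟩
  -- Any elements may serve as `a`, `b` and `u₀`, so all three are `z`. The second row consists of
  -- the images under α, β, γ and, for the shifts, β.
  obtain ⟨g, hg⟩ := h₀.exists_cube z z
  rw [Fintype.card_fin] at hg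
  let cert : ℕ → ℕ → Fin n := fun j =>
    if j = 0 then certSeq z z z g else certSeq (α z) (β z) (γ z) fun i => β (g i)
  refine ⟨cert, ?_⟩
  have hl := length_pair_encodeTable op₀ op₁
  set x := pair (encodeTable op₀) (encodeTable op₁) with hxdef
  set w := pair x (encodeCert cert) with hw
  have hlen : inputBits n ≤ w.length := by
    rw [hw, length_pair]
    omega
  have hF : Format w n := format_pair op₀ op₁ _
  have D₀ : Decodes w 0 op₀ (cert 0) := ⟨by omega, hlen, fun a b => (opRel_zero op₀ op₁ _ a b).iff,
    fun i hi => (certRel_encodeCert hl cert (by omega) hi).iff⟩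
  have D₁ : Decodes w 1 op₁ (cert 1) := ⟨by omega, hlen, fun a b => (opRel_one op₀ op₁ _ a b).iff,
    fun i hi => (certRel_encodeCert hl cert (by omega) hi).iff⟩
  have hT : ∀ e, walkEnd h₁ (cert 1) e = γ (walkEnd h₀ (cert 0) e) := fun e =>
    walk_isotopy h₀ h₁ hiso z g e 0 _ z
  have hb : 2 ^ (2 * Nat.clog 2 n) ≤ base w.length :=
    two_pow_le_base (by have := D₀.two_mul_le; omega)
  have hs : ∀ c, ∃ e < base w.length, walkEnd h₀ (cert 0) e = c := fun c =>
    let ⟨e, he, hc⟩ := hg c; ⟨e, he.trans_le hb, hc⟩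
  refine ⟨n, hn, hF, fun j hj => ?_, fun e₁ he₁ e₂ he₂ e₃ he₃ => ?_⟩
  · rcases Nat.le_one_iff_eq_zero_or_eq_one.1 (Nat.le_of_lt_succ hj) with rfl | rfl
    · exact D₀.valid h₀ hR hs
    · refine D₁.valid h₁ hR fun c => ?_
      obtain ⟨e, he, hc⟩ := hs (γ.symm c)
      exact ⟨e, he, by rw [hT, hc, γ.apply_symm_apply]⟩
  · rw [D₀.tripleRel_iff h₀ hR he₁ he₂ he₃, D₁.tripleRel_iff h₁ hR he₁ he₂ he₃]
    rintro ⟨p, q, h₁, h₂, h₃⟩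
    exact ⟨α p, β q, (hiso p z).trans (by rw [hT]; exact congrArg γ h₁),
      (hiso z q).trans (by rw [hT]; exact congrArg γ h₂), (hiso p q).trans (by rw [hT, h₃])⟩

/-- Soundness does not need the rows of the certificate to come from an isotopy: the checked
surjectivity of both naming maps and the implication between triples are all that is used. -/
theorem mem_of_accept {R : List Bool → Env → Prop} (hR : WalkSpec R) {x y : List Bool}
    (h : Accept (pair x y) (R (pair x y))) : x ∈ LatinSquareIsotopy := by
  obtain ⟨n, hn, hF, hV, hT⟩ := h
  obtain ⟨op₀, cert₀, h₀, D₀⟩ := (hV 0 (by omega)).exists_decodes hn (by omega) hF.inputBits_le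
  obtain ⟨op₁, cert₁, h₁, D₁⟩ := (hV 1 (by omega)).exists_decodes hn (by omega) hF.inputBits_le
  refine ⟨n, n, op₀, op₁, hn, hn, h₀, h₁, ?_, hF.eq_pair (fun a b => (D₀.op_iff a b _).2 rfl)
    fun a b => (D₁.op_iff a b _).2 rfl⟩
  refine isotopic_of_triple (X := {e // e < base (pair x y).length}) h₀ h₁ rfl
    (a := cert₀ 0) (b := cert₀ 1) (a' := cert₁ 0) (b' := cert₁ 1)
    (T := fun e => walkEnd h₀ cert₀ e) (T' := fun e => walkEnd h₁ cert₁ e) ?_ ?_ ?_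
  · intro c
    obtain ⟨e, he, h⟩ := (hV 0 (by omega)).2.2.2.2 c c.2
    exact ⟨⟨e, he⟩, (D₀.endRel_iff h₀ hR he c).1 h⟩
  · intro c
    obtain ⟨e, he, h⟩ := (hV 1 (by omega)).2.2.2.2 c c.2
    exact ⟨⟨e, he⟩, (D₁.endRel_iff h₁ hR he c).1 h⟩
  · rintro ⟨e₁, he₁⟩ ⟨e₂, he₂⟩ ⟨e₃, he₃⟩ h
    exact (D₁.tripleRel_iff h₁ hR he₁ he₂ he₃).1
      (hT e₁ he₁ e₂ he₂ e₃ he₃ ((D₀.tripleRel_iff h₀ hR he₁ he₂ he₃).2 h))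

theorem mem_iff_exists_accept {R : List Bool → Env → Prop} (hR : WalkSpec R) (x : List Bool) :
    x ∈ LatinSquareIsotopy ↔ ∃ y : List Bool, y.length ≤ 18 * Nat.log 2 x.length ^ 2 + 18 ∧
      Accept (pair x y) (R (pair x y)) := by
  constructor
  · rintro ⟨n, m, op₀, op₁, hn, -, h₀, h₁, hiso, rfl⟩
    obtain rfl : n = m := by
      obtain ⟨α, -⟩ := hiso
      simpa using Fintype.card_congr α
    obtain ⟨cert, hc⟩ := accept_of_isotopic hR hn h₀ h₁ hiso
    refine ⟨encodeCert cert, ?_, hc⟩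
    rw [length_pair_encodeTable, encodeCert, List.length_map, List.length_range]
    have hL : Nat.clog 2 n ≤ Nat.log 2 (inputBits n) + 1 := by
      rw [Nat.clog_le_iff_le_pow (by omega)]
      have h₁ := Nat.lt_pow_succ_log_self (b := 2) (by omega) (inputBits n)
      have h₂ := two_mul_le_inputBits n
      omega
    have : 2 * (2 * Nat.clog 2 n + 3) * Nat.clog 2 n ≤
        2 * (2 * (Nat.log 2 (inputBits n) + 1) + 3) * (Nat.log 2 (inputBits n) + 1) := by gcongr
    -- With l the logarithm of the input length, 2(2l + 5)(l + 1) = 4l² + 14l + 10 ≤ 18l² + 18,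
    -- using l ≤ l².
    nlinarith [Nat.le_self_pow (show 2 ≠ 0 by omega) (Nat.log 2 (inputBits n))]
  · rintro ⟨y, -, h⟩
    exact mem_of_accept hR h

/-! ### Membership in the two classes. -/

theorem latinSquareIsotopy_mem_beta_logSpace : LatinSquareIsotopy ∈ Beta 2 LogSpace := by
  refine ⟨{w | Accept w (FollowRel w)}, mem_logSpace ?_, 18,
    mem_iff_exists_accept walkSpec_followRel⟩
  exact (Fml.uniform_mainF.lsp (α := List Bool) (R := FollowRel) lsp_followRel (v := fun _ _ => 0)
    fun _ => LS.zero).congr fun _ => Fml.eval_mainF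

theorem latinSquareIsotopy_mem_beta_foll : LatinSquareIsotopy ∈ Beta 2 FOLL := by
  refine ⟨{w | Accept w (Fml.isotopyF.stage 18 w (Nat.log 2 (Nat.log 2 w.length) + 3))},
    Fml.mem_FOLL Fml.uniform_isotopyF 3 fun w => ?_, 18, mem_iff_exists_accept walkSpec_stage⟩
  have hb := lt_base w.length
  -- At the output assignment variable `0` is `base - 1`, which is not the flag `1` of a walk query,
  -- so the last round evaluates the main formula on top of the `log log + 3` rounds for walks.
  have h0 : ¬ base w.length - 1 = 1 := by omega
  rw [Fml.stage, Fml.isotopyF, Fml.Eval, Fml.Eval, Fml.Eval, Fml.Eval, Fml.Eval, Fml.eval_mainF]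
  simp [h0]
  rfl

end LatinIsotopy

theorem theorem1 :
    LatinIsotopy.LatinSquareIsotopy ∈
      LatinIsotopy.Beta 2 LatinIsotopy.LogSpace ∩ LatinIsotopy.Beta 2 LatinIsotopy.FOLL :=
  ⟨LatinIsotopy.latinSquareIsotopy_mem_beta_logSpace,
    LatinIsotopy.latinSquareIsotopy_mem_beta_foll⟩
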